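/- Let $m\ge 1$ and let $(M,Z,\omega)$ be a $b^{2m}$-symplectic manifold with $M$ compact and connected: $Z\subset M$ is a closed hypersurface and $\omega$ is a closed nondegenerate two-form on the $b^{2m}$-tangent bundle, whose sections are locally generated by $z^{2m}\partial_z,\partial_{x_2},\dots,\partial_{x_n}$ near $Z=\{z=0\}$. Fix a tubular neighbourhood $(z,\pi):\mathcal N\cong(-\delta,\delta)\times Z$ in which $$\omega=\frac{dz}{z^{2m}}\wedge\sum_{i=0}^{2m-1}z^i\,\pi^*\alpha_i+\pi^*\beta$$ with closed forms $\alpha_i\in\Omega^1(Z)$, $\beta\in\Omega^2(Z)$ (here $\mathcal N$ has one component for each component $Z_j$ of $Z$, and $z$ is a local defining function on each of them). On $\mathcal N$ let $X^\sigma=z^{2m}\partial_z$, and let $R$ be the Reeb vector field, i.e. $dz(R)=0$, $\pi^*\alpha_0(R)=1$ and $\iota_R\pi^*\beta=0$. Let $H_t$, $t\in S^1=\mathbb R/\mathbb Z$, be a time-dependent $b^{2m}$-function: it is smooth on $S^1\times(M\setminus Z)$, and near each $Z_j$ it has the form $k(t)\log|z|+\sum_{i=1}^{2m-1}z^{-i}c_i(t,z)+h_t$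 with smooth $k,c_i,h$. Let $X_H^\omega$ be its Hamiltonian vector field, $\iota_{X_H^\omega}\omega=-dH_t$, which is a smooth vector field on $M$. Assume that $H$ is admissible: in some tubular neighbourhood $\{|z|<r\}$ of $Z$ one has $\mathcal L_{X^\sigma}H_t=k_j(t)$ around $Z_j$ with $k_j\in C^\infty(S^1)$, $\mathcal L_RH_t=0$, and $X_H^\omega$ has no $1$-periodic orbit contained in this neighbourhood. Assume moreover one of the following. 1. $H$ is unimodular: there are a global defining function $f:M\to\mathbb R$ of $Z$ (that is, $f$ is smooth, $f^{-1}(0)=Z$ and $df\ne0$ on $Z$) with $f=z$ near $Z$, and a single $k\in C^\infty(S^1)$, such that $H_t=k(t)f^{-(2m-1)}+h_t$ near $Z$ with $h_t$ smooth (also across $Z$). 2. $(M,Z)$ is acyclic: the multigraph whose vertices are the components of $M\setminus Z$ and whose edges are the components of $Z$, each joining the components of $M\setminus Z$ that it borders, has no cycle (loops and double edges count as cycles). Then for all sufficiently small $\varepsilon>0$ and every odd $\varphi\in C^\infty(\mathbb R)$ with $\varphi'>0$ on $[-1,1]$ and $\varphi(x)=-\frac{1}{(2m-1)x^{2m-1}}\pm2$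 for $\pm x>1$, the following holds. Put $\varphi_\varepsilon(x)=\varepsilon^{-(2m-1)}\varphi(x/\varepsilon)$, and let $\omega_\varepsilon$ be the desingularization of $\omega$, equal to $$\omega_\varepsilon=d\varphi_\varepsilon(z)\wedge\sum_{i=0}^{2m-1}z^i\,\pi^*\alpha_i+\pi^*\beta$$ on $\{|z|<\varepsilon\}$ and to $\omega$ elsewhere. Then $\omega_\varepsilon$ is a smooth symplectic form on $M$, and there is a smooth function $\widetilde H:S^1\times M\to\mathbb R$ whose Hamiltonian vector field with respect to $\omega_\varepsilon$, defined by $\iota_X\omega_\varepsilon=-d\widetilde H_t$, equals $X_H^\omega$ on all of $M$. -/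

import Mathlib

open Set
open scoped Manifold ContDiff Topology

noncomputable section

namespace BSymplectic

/-! ### Differential forms of degree one and two on a manifold modelled on `E` -/

/-- A (not necessarily smooth) field of covectors on `M`. -/
abbrev OneForm (E M : Type*) [NormedAddCommGroup E] [NormedSpace ℝ E] [TopologicalSpace M]
    [ChartedSpace E M] : Type _ :=
  ∀ x : M, TangentSpace 𝓘(ℝ, E) x →L[ℝ] ℝ

/-- A (not necessarily smooth or alternating) field of bilinear forms on `M`. -/
abbrev TwoForm (E M : Type*) [NormedAddCommGroup E] [NormedSpace ℝ E] [TopologicalSpace M]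
    [ChartedSpace E M] : Type _ :=
  ∀ x : M, TangentSpace 𝓘(ℝ, E) x →L[ℝ] TangentSpace 𝓘(ℝ, E) x →L[ℝ] ℝ

/-- The wedge product of two covectors, `(a ∧ b)(v, w) = a v * b w - b v * a w`. -/
def wedge {V : Type*} [AddCommGroup V] [Module ℝ V] [TopologicalSpace V]
    [IsTopologicalAddGroup V] [ContinuousSMul ℝ V] (a b : V →L[ℝ] ℝ) : V →L[ℝ] V →L[ℝ] ℝ :=
  a.smulRight b - b.smulRight a

section Forms

variable {E : Type*} [NormedAddCommGroup E] [NormedSpace ℝ E]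
  {M : Type*} [TopologicalSpace M] [ChartedSpace E M]

/-- The form `a` is smooth at all points of `U`, as a section of the cotangent bundle. -/
def SmoothOneFormOn [IsManifold 𝓘(ℝ, E) ∞ M] (U : Set M) (a : OneForm E M) : Prop :=
  ContMDiffOn 𝓘(ℝ, E) (𝓘(ℝ, E).prod 𝓘(ℝ, E →L[ℝ] ℝ)) ∞
    (fun x ↦ Bundle.TotalSpace.mk' (E →L[ℝ] ℝ) x (a x)) U

/-- The form `σ` is smooth at all points of `U`, as a section of the bundle of bilinear forms. -/
def SmoothTwoFormOn [IsManifold 𝓘(ℝ, E) ∞ M] (U : Set M) (σ : TwoForm E M) : Prop :=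
  ContMDiffOn 𝓘(ℝ, E) (𝓘(ℝ, E).prod 𝓘(ℝ, E →L[ℝ] E →L[ℝ] ℝ)) ∞
    (fun x ↦ Bundle.TotalSpace.mk' (E →L[ℝ] E →L[ℝ] ℝ) x (σ x)) U

/-- The derivative of the inverse of the chart around `x`, at a point `y` of the model space.
(Every tangent space of `M` is, as a vector space, the model space `E`.) -/
def chartFrame (x : M) (y : E) :
    E →L[ℝ] E :=
  mfderiv 𝓘(ℝ, E) 𝓘(ℝ, E) (extChartAt 𝓘(ℝ, E) x).symm y

/-- The expression of a one-form in the chart around `x`. -/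
def chartOneForm (a : OneForm E M) (x : M) (y : E) : E →L[ℝ] ℝ :=
  ContinuousLinearMap.comp (M₂ := E) (a ((extChartAt 𝓘(ℝ, E) x).symm y)) (chartFrame x y)

/-- The expression of a two-form in the chart around `x`. -/
def chartTwoForm (σ : TwoForm E M) (x : M) (y : E) : E →L[ℝ] E →L[ℝ] ℝ :=
  ContinuousLinearMap.bilinearComp (E := E) (F := E) (σ ((extChartAt 𝓘(ℝ, E) x).symm y))
    (chartFrame x y) (chartFrame x y)

/-- `da = 0` on `U`; the exterior derivative at `x` is computed in the chart around `x`. -/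
def ClosedOneFormOn (U : Set M) (a : OneForm E M) : Prop :=
  ∀ x ∈ U, ∀ u v : E,
    fderiv ℝ (chartOneForm a x) (extChartAt 𝓘(ℝ, E) x x) u v =
      fderiv ℝ (chartOneForm a x) (extChartAt 𝓘(ℝ, E) x x) v u

/-- `dσ = 0` on `U`; the exterior derivative at `x` is computed in the chart around `x`. -/
def ClosedTwoFormOn (U : Set M) (σ : TwoForm E M) : Prop :=
  ∀ x ∈ U, ∀ u v w : E,
    fderiv ℝ (chartTwoForm σ x) (extChartAt 𝓘(ℝ, E) x x) u v w +
      fderiv ℝ (chartTwoForm σ x) (extChartAt 𝓘(ℝ, E) x x) v w u +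
      fderiv ℝ (chartTwoForm σ x) (extChartAt 𝓘(ℝ, E) x x) w u v = 0

/-- `σ` is a symplectic form on the open set `U`: smooth, alternating, closed, nondegenerate. -/
structure IsSymplecticOn [IsManifold 𝓘(ℝ, E) ∞ M] (U : Set M) (σ : TwoForm E M) : Prop where
  smooth : SmoothTwoFormOn U σ
  alternating : ∀ x ∈ U, ∀ v, σ x v v = 0
  closed : ClosedTwoFormOn U σ
  nondegenerate : ∀ x ∈ U, ∀ v, (∀ w, σ x v w = 0) → v = 0

/-! ### Singular hypersurfaces and `b^m`-symplectic forms -/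

/-- `Z` is a closed subset of `M` and the regular zero level set of `z : U → ℝ`, where `U` is an
open neighbourhood of `Z`. For `U = univ` this says that `z` is a global defining function. -/
structure IsDefiningFunction (Z U : Set M) (z : M → ℝ) : Prop where
  isClosed : IsClosed Z
  isOpen : IsOpen U
  subset : Z ⊆ U
  smooth : ContMDiffOn 𝓘(ℝ, E) 𝓘(ℝ, ℝ) ∞ z U
  zero_iff : ∀ x ∈ U, z x = 0 ↔ x ∈ Z
  regular : ∀ x ∈ Z, mvfderiv 𝓘(ℝ, E) z x ≠ 0

/-- `Ω` is a `b^m`-symplectic form on `(M, Z)`, where the `b^m`-tangent bundle is the one whose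
sections are locally generated by `z ^ m ∂_z, ∂_{x_2}, …, ∂_{x_n}` for the defining function `z`
of `Z` on `U`. Only the values of `Ω` off `Z` matter.

Off `Z` the form is an ordinary symplectic form. Near `Z` a smooth `b^m`-form of degree two is
`z ^ (-m) dz ∧ a + b` with `a`, `b` smooth forms. At a point `x` of `Z` the `b^m`-tangent space is
spanned by `z ^ m ∂_z` and `T_x Z = ker dz`, and the value of the form on the pair
`(s z ^ m ∂_z + u, s' z ^ m ∂_z + u')` is `s a(u') - s' a(u) + b(u, u')`. -/
structure IsBSymplectic [IsManifold 𝓘(ℝ, E) ∞ M] (m : ℕ) (Z U : Set M) (z : M → ℝ)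
    (Ω : TwoForm E M) : Prop where
  isDefiningFunction : IsDefiningFunction (E := E) Z U z
  symplectic : IsSymplecticOn Zᶜ Ω
  singular : ∃ (a : OneForm E M) (b : TwoForm E M),
    SmoothOneFormOn U a ∧ SmoothTwoFormOn U b ∧ (∀ x ∈ U, ∀ v, b x v v = 0) ∧
    (∀ x ∈ U \ Z, Ω x = (z x ^ m)⁻¹ • wedge (mvfderiv 𝓘(ℝ, E) z x) (a x) + b x) ∧
    ∀ x ∈ Z, ∀ (s : ℝ) (u : TangentSpace 𝓘(ℝ, E) x), mvfderiv 𝓘(ℝ, E) z x u = 0 →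
      (∀ (s' : ℝ) (u' : TangentSpace 𝓘(ℝ, E) x), mvfderiv 𝓘(ℝ, E) z x u' = 0 →
        s * a x u' - s' * a x u + b x u u' = 0) →
      s = 0 ∧ u = 0

/-! ### Time-dependent functions and their Hamiltonian vector fields -/

/-- `h` is a smooth time-dependent function on `S¹ × U`, where `S¹ = ℝ / ℤ`. -/
def SmoothPeriodicOn (E : Type*) [NormedAddCommGroup E] [NormedSpace ℝ E]
    {M : Type*} [TopologicalSpace M] [ChartedSpace E M] (U : Set M) (h : ℝ → M → ℝ) : Prop :=
  ContMDiffOn (𝓘(ℝ, ℝ).prod 𝓘(ℝ, E)) 𝓘(ℝ, ℝ) ∞ (fun p : ℝ × M ↦ h p.1 p.2) (univ ×ˢ U) ∧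
    ∀ t, ∀ x ∈ U, h (t + 1) x = h t x

/-- `k` is a smooth function on `S¹ = ℝ / ℤ`. -/
def SmoothPeriodic (k : ℝ → ℝ) : Prop :=
  ContDiff ℝ ∞ k ∧ ∀ t, k (t + 1) = k t

/-- `X_t` is the Hamiltonian vector field of `H_t` on `U`, that is `ι_{X_t} σ = - dH_t`. -/
def IsHamiltonianFieldOn (U : Set M) (σ : TwoForm E M) (H : ℝ → M → ℝ)
    (X : ℝ → ∀ x : M, TangentSpace 𝓘(ℝ, E) x) : Prop :=
  ∀ t, ∀ x ∈ U, ∀ v, σ x (X t x) v = - mvfderiv 𝓘(ℝ, E) (H t) x v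

/-- `X` is the Hamiltonian vector field of the `b^m`-function `H` for the `b^m`-symplectic form `Ω`:
the time-dependent vector field that is smooth on all of `M` and satisfies `ι_{X_t} Ω = - dH_t` off
`Z`. It is unique, because `Ω` is nondegenerate off `Z` and the complement of `Z` is dense. -/
def IsBHamiltonianField [IsManifold 𝓘(ℝ, E) ∞ M] (Z : Set M) (Ω : TwoForm E M) (H : ℝ → M → ℝ)
    (X : ℝ → ∀ x : M, TangentSpace 𝓘(ℝ, E) x) : Prop :=
  ContMDiff (𝓘(ℝ, ℝ).prod 𝓘(ℝ, E)) 𝓘(ℝ, E).tangent ∞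
    (fun p : ℝ × M ↦ (⟨p.2, X p.1 p.2⟩ : TangentBundle 𝓘(ℝ, E) M)) ∧
  IsHamiltonianFieldOn Zᶜ Ω H X

/-- `γ` is a `1`-periodic orbit of the time-dependent vector field `X`. -/
def IsOnePeriodicOrbit (X : ℝ → ∀ x : M, TangentSpace 𝓘(ℝ, E) x) (γ : ℝ → M) : Prop :=
  (∀ t, HasMFDerivAt 𝓘(ℝ, ℝ) 𝓘(ℝ, E) γ t
    ((1 : ℝ →L[ℝ] ℝ).smulRight (X t (γ t)))) ∧
  ∀ t, γ (t + 1) = γ t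

end Forms

/-! ### Tubular neighbourhoods and the Laurent decomposition -/

/-- A tubular neighbourhood `N` of `Z`, with its defining function `z` and its projection
`proj : N → Z`, such that `(z, proj) : N → (-δ, δ) × Z` is a diffeomorphism (a smooth bijection with
injective differential) that is the identity on `Z = {0} × Z`. The hypersurface `Z` may have several
components; the restrictions of `z` to the components of `N` are their local defining functions. -/
structure TubularNbhd (E : Type*) [NormedAddCommGroup E] [NormedSpace ℝ E]
    {M : Type*} [TopologicalSpace M] [ChartedSpace E M] (Z : Set M) where
  N : Set M
  δ : ℝ
  z : M → ℝ
  proj : M → M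
  isOpen : IsOpen N
  subset : Z ⊆ N
  δ_pos : 0 < δ
  smooth_z : ContMDiffOn 𝓘(ℝ, E) 𝓘(ℝ, ℝ) ∞ z N
  smooth_proj : ContMDiffOn 𝓘(ℝ, E) 𝓘(ℝ, E) ∞ proj N
  bijOn : BijOn (fun x ↦ (z x, proj x)) N (Ioo (-δ) δ ×ˢ Z)
  injective_deriv : ∀ x ∈ N, ∀ v : TangentSpace 𝓘(ℝ, E) x,
    mvfderiv 𝓘(ℝ, E) z x v = 0 → mfderiv 𝓘(ℝ, E) 𝓘(ℝ, E) proj x v = 0 → v = 0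
  z_eq : ∀ x ∈ Z, z x = 0
  proj_eq : ∀ x ∈ Z, proj x = x

section Tubular

variable {E : Type*} [NormedAddCommGroup E] [NormedSpace ℝ E]
  {M : Type*} [TopologicalSpace M] [ChartedSpace E M] {Z : Set M}

/-- The smaller tubular neighbourhood `{|z| < r}`. -/
def TubularNbhd.tube (T : TubularNbhd E Z) (r : ℝ) : Set M :=
  {x | x ∈ T.N ∧ |T.z x| < r}

/-- The component of the tubular neighbourhood around the connected component of `Z` through `p`. -/
def TubularNbhd.around (T : TubularNbhd E Z) (p : M) : Set M :=
  {x | x ∈ T.N ∧ T.proj x ∈ connectedComponentIn Z p}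

/-- The decomposition
`Ω = dz / z ^ (2 m) ∧ ∑_{i < 2 m} z ^ i π^* α_i + π^* β` on the tubular neighbourhood, with
`α_i` closed one-forms and `β` a closed two-form on `Z`. The fields `A i` and `B` are the forms
`π^* α_i` and `π^* β` on `N`; a form on `N` is the pull-back of a form on `Z` by the retraction `π = T.proj`
exactly if it is the pull-back of its own restriction to `Z`. The leading coefficient is `A 0`. -/
structure LaurentDecomposition [IsManifold 𝓘(ℝ, E) ∞ M] (T : TubularNbhd E Z) (m : ℕ)
    (Ω : TwoForm E M) where
  A : ℕ → OneForm E M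
  B : TwoForm E M
  smooth_A : ∀ i < 2 * m, SmoothOneFormOn T.N (A i)
  closed_A : ∀ i < 2 * m, ClosedOneFormOn T.N (A i)
  pullback_A : ∀ i < 2 * m, ∀ x ∈ T.N, ∀ v,
    A i x v = A i (T.proj x) (mfderiv 𝓘(ℝ, E) 𝓘(ℝ, E) T.proj x v)
  smooth_B : SmoothTwoFormOn T.N B
  alternating_B : ∀ x ∈ T.N, ∀ v, B x v v = 0
  closed_B : ClosedTwoFormOn T.N B
  pullback_B : ∀ x ∈ T.N, ∀ v w,
    B x v w = B (T.proj x) (mfderiv 𝓘(ℝ, E) 𝓘(ℝ, E) T.proj x v) (mfderiv 𝓘(ℝ, E) 𝓘(ℝ, E) T.proj x w)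
  eq_laurent : ∀ x ∈ T.N \ Z,
    Ω x = (T.z x ^ (2 * m))⁻¹ • wedge (mvfderiv 𝓘(ℝ, E) T.z x)
      (∑ i ∈ Finset.range (2 * m), T.z x ^ i • A i x) + B x

/-- `v` is the value at `x` of the normal symplectic `b^{2m}`-vector field `X^σ = z ^ (2 m) ∂_z`,
extended to the tubular neighbourhood by its product structure. -/
def TubularNbhd.IsNormalVector (T : TubularNbhd E Z) (m : ℕ) (x : M)
    (v : TangentSpace 𝓘(ℝ, E) x) : Prop :=
  mvfderiv 𝓘(ℝ, E) T.z x v = T.z x ^ (2 * m) ∧ mfderiv 𝓘(ℝ, E) 𝓘(ℝ, E) T.proj x v = 0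

variable [IsManifold 𝓘(ℝ, E) ∞ M] {T : TubularNbhd E Z} {m : ℕ} {Ω : TwoForm E M}

/-- `v` is the value at `x` of the Reeb vector field `R` of the cosymplectic structure on `Z`
given by the leading coefficient and `β`, extended to the tubular neighbourhood by its product
structure: tangent to the levels of `z`, in the kernel of `π^* β` and normalized. -/
def LaurentDecomposition.IsReebVector (L : LaurentDecomposition T m Ω) (x : M)
    (v : TangentSpace 𝓘(ℝ, E) x) : Prop :=
  mvfderiv 𝓘(ℝ, E) T.z x v = 0 ∧ L.A 0 x v = 1 ∧ ∀ w, L.B x v w = 0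

/-! ### Admissible and unimodular Hamiltonians -/

/-- `H` is a time-dependent `b^{2m}`-function: smooth off `Z`, and around every component of `Z` of
the form `k(t) log |z| + ∑_{i = 1}^{2m - 1} z ^ (-i) c_i(t, z) + h_t` with smooth `k`, `c_i`, `h`.
The values of `H` on `Z` do not matter. -/
def IsBFunction (T : TubularNbhd E Z) (m : ℕ) (H : ℝ → M → ℝ) : Prop :=
  SmoothPeriodicOn E Zᶜ H ∧
  ∀ p ∈ Z, ∃ (k : ℝ → ℝ) (c : ℕ → ℝ → ℝ → ℝ) (h : ℝ → M → ℝ),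
    SmoothPeriodic k ∧ (∀ i, SmoothPeriodicOn ℝ univ (c i)) ∧
    SmoothPeriodicOn E (T.around p) h ∧
    ∀ t, ∀ x ∈ T.around p \ Z,
      H t x = k t * Real.log |T.z x| +
        ∑ i ∈ Finset.Icc 1 (2 * m - 1), (T.z x ^ i)⁻¹ * c i t (T.z x) + h t x

/-- `H` is an admissible Hamiltonian: in a tubular neighbourhood of `Z` it is linear along `X^σ`
(with a slope that may depend on the component of `Z`), it is invariant under the Reeb vector
field, and its Hamiltonian vector field has no `1`-periodic orbits there. -/
def IsAdmissible (L : LaurentDecomposition T m Ω) (H : ℝ → M → ℝ) : Prop :=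
  IsBFunction T m H ∧
  ∃ r > 0,
    (∀ p ∈ Z, ∃ k : ℝ → ℝ, SmoothPeriodic k ∧
      ∀ t, ∀ x ∈ (T.around p ∩ T.tube r) \ Z, ∀ v, T.IsNormalVector m x v →
        mvfderiv 𝓘(ℝ, E) (H t) x v = k t) ∧
    (∀ t, ∀ x ∈ T.tube r \ Z, ∀ v, L.IsReebVector x v →
      mvfderiv 𝓘(ℝ, E) (H t) x v = 0) ∧
    ∀ X, IsBHamiltonianField Z Ω H X →
      ¬ ∃ γ : ℝ → M, (∀ t, γ t ∈ T.tube r) ∧ IsOnePeriodicOrbit X γ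

/-- `H` is unimodular: `Z` has a global defining function `f`, extending (the germ along `Z` of)
the defining function `z` of the tubular neighbourhood, such that near `Z` the Hamiltonian is
`k(t) / f ^ (2 m - 1) + h_t` with one smooth function `k` for all components of `Z` and a smooth
function `h`. -/
def IsUnimodular (T : TubularNbhd E Z) (m : ℕ) (H : ℝ → M → ℝ) : Prop :=
  ∃ f : M → ℝ, IsDefiningFunction (E := E) Z univ f ∧
    (∃ r > 0, ∀ x ∈ T.tube r, f x = T.z x) ∧
    ∃ (k : ℝ → ℝ) (U : Set M) (h : ℝ → M → ℝ), SmoothPeriodic k ∧ IsOpen U ∧ Z ⊆ U ∧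
      SmoothPeriodicOn E U h ∧
      ∀ t, ∀ x ∈ U \ Z, H t x = k t / f x ^ (2 * m - 1) + h t x

/-! ### The desingularization -/

/-- `f` is an odd smooth function with `f' > 0` on `[-1, 1]` that equals
`- 1 / ((2 m - 1) x ^ (2 m - 1)) ± 2` for `± x > 1`. -/
structure IsDesingularizingFunction (m : ℕ) (f : ℝ → ℝ) : Prop where
  smooth : ContDiff ℝ ∞ f
  odd : ∀ x, f (-x) = - f x
  deriv_pos : ∀ x ∈ Icc (-1 : ℝ) 1, 0 < deriv f x
  eq_of_lt : ∀ x < -1, f x = -1 / ((2 * (m : ℝ) - 1) * x ^ (2 * m - 1)) - 2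
  eq_of_gt : ∀ x > 1, f x = -1 / ((2 * (m : ℝ) - 1) * x ^ (2 * m - 1)) + 2

/-- The rescaled function `f_ε(x) = ε ^ (-(2 m - 1)) f(x / ε)`. -/
def rescale (m : ℕ) (f : ℝ → ℝ) (ε x : ℝ) : ℝ :=
  (ε ^ (2 * m - 1))⁻¹ * f (x / ε)

open Classical in
/-- The desingularization `Ω_ε`: it is `d(f_ε(z)) ∧ ∑_{i < 2 m} z ^ i π^* α_i + π^* β` where
`|z| < ε`, and `Ω` elsewhere. -/
def LaurentDecomposition.desingularization (L : LaurentDecomposition T m Ω) (f : ℝ → ℝ) (ε : ℝ) :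
    TwoForm E M := fun x ↦
  if x ∈ T.tube ε then
    wedge (mvfderiv 𝓘(ℝ, E) (fun y ↦ rescale m f ε (T.z y)) x)
      (∑ i ∈ Finset.range (2 * m), T.z x ^ i • L.A i x) + L.B x
  else Ω x

end Tubular

/-! ### The graph of a pair `(M, Z)` -/

/-- The graph associated to `(M, Z)`, a multigraph: the vertices are the connected components of
the complement of `Z`, the edges are the connected components of `Z`, and an edge joins the
component or components of the complement that it borders. It may have loops (a component of `Z`
with the same component of the complement on both sides) and multiple edges. -/
def associatedGraph {M : Type*} [TopologicalSpace M] (Z : Set M) : Graph (Set M) (Set M) where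
  vertexSet := {W | ∃ x ∈ Zᶜ, W = connectedComponentIn Zᶜ x}
  IsLink e u v := (∃ p ∈ Z, e = connectedComponentIn Z p) ∧
    {W | (∃ x ∈ Zᶜ, W = connectedComponentIn Zᶜ x) ∧ (closure W ∩ e).Nonempty} = {u, v}
  isLink_symm := fun _ _ ↦ ⟨fun u v h ↦ ⟨h.1, by rw [h.2, Set.pair_comm]⟩⟩
  eq_or_eq_of_isLink_of_isLink := by
    intro e x y v w h h'
    have hx : x ∈ ({v, w} : Set (Set M)) := by
      rw [← h'.2, h.2]
      exact Set.mem_insert x {y}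
    simpa using hx
  left_mem_of_isLink := by
    intro e x y h
    have hx : x ∈ ({x, y} : Set (Set M)) := Set.mem_insert x {y}
    rw [← h.2] at hx
    exact hx.1

/-- A multigraph is acyclic if it has no cycle: no cyclic sequence of `n + 1 ≥ 1` distinct vertices
and `n + 1` distinct edges joining consecutive ones. A loop is a cycle of length one and a double
edge is a cycle of length two. -/
def GraphIsAcyclic {α β : Type*} (G : Graph α β) : Prop :=
  ¬ ∃ (n : ℕ) (v : ZMod (n + 1) → α) (e : ZMod (n + 1) → β),
    Function.Injective v ∧ Function.Injective e ∧ ∀ i, G.IsLink (e i) (v i) (v (i + 1))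

end BSymplectic

end

/-!
# Hamiltonian vector fields of desingularized `b^{2m}`-symplectic forms

Near a component of `Z`, an admissible Hamiltonian is `H_t = - k(t) / ((2 m - 1) z ^ (2 m - 1)) +
G_t` with `G` smooth across `Z`: linearity along `X^σ` gives this with an additive constant on
each side, and comparison with the form of a `b^{2m}`-function shows that the two constants agree
(`TubularNbhd.exists_regularPart_near`, `log_coeff_eq_zero_of_contDiffAt`). Both `ω` and `dH_t = k
z ^ (- 2 m) dz + dG_t` are thus affine in the coefficient `z ^ (- 2 m)`, and the desingularization
replaces this coefficient by `φ_ε'(z)` in `ω`. Replacing it in `dH_t` as well gives a covector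
with the same Hamiltonian vector. Indeed `ι_X ω = - dH_t`, tested on `X^σ` and on the Reeb vector
field, says `(∑ z ^ i π^* α_i)(X) = k` and `dz(X) = 0`, so the terms with the coefficient cancel
from the equation (`hamiltonian_of_smul_wedge_add`). For the same reason a nonzero coefficient
does not affect nondegeneracy, so that `ω_ε` is symplectic
(`LaurentDecomposition.isSymplecticOn_desingularization`).

Near `Z` the new Hamiltonian is therefore `k φ_ε(z) + G` up to constants. For `|z| ≥ ε` the
function `φ_ε(z)` is `- 1 / ((2 m - 1) z ^ (2 m - 1)) ± 2 / ε ^ (2 m - 1)`, and away from `Z` the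
new Hamiltonian has to be `H_t` plus a locally constant function. The two fit together if there is
a locally constant function `C_t` off `Z` that is `D_t + k(t) sign z` near each component of `Z`,
with `D_t` constant near the component (`TubularNbhd.IsJumpSolution`). In the unimodular case all
`k` agree and `C_t = k(t) sign f` works. If the graph is acyclic, removing an edge disconnects its
ends, so there is a locally constant function with values `± 1` that jumps across the
corresponding component of `Z` only, and the solution is a superposition of these
(`TubularNbhd.exists_isJumpSolution_of_acyclic`).

The vector field is obtained as the Hamiltonian vector field of the new, smooth, Hamiltonian for
`ω_ε`, and the pointwise computation shows that it is also that of `H` off `Z`. The topological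
input (connected sides of `Z`, small tubes, openness of the components of `Z`) comes from
coordinates in which `z` is linear and the fibres of the projection are parallel lines
(`TubularNbhd.exists_straightening`).
-/

noncomputable section

namespace BSymplectic

/-! ### Forms and functions in charts -/

section Charts

variable {E : Type*} [NormedAddCommGroup E] [NormedSpace ℝ E]
  {M : Type*} [TopologicalSpace M] [ChartedSpace E M]

theorem extChartAt_target_mem_nhds' {x : M} {y : E} (hy : y ∈ (extChartAt 𝓘(ℝ, E) x).target) :
    (extChartAt 𝓘(ℝ, E) x).target ∈ 𝓝 y :=
  (isOpen_extChartAt_target x).mem_nhds hy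

theorem contMDiffAt_iff_chart {F : Type*} [NormedAddCommGroup F] [NormedSpace ℝ F]
    {f : M → F} {x : M} :
    ContMDiffAt 𝓘(ℝ, E) 𝓘(ℝ, F) ∞ f x ↔
      ContDiffAt ℝ ∞ (fun y ↦ f ((extChartAt 𝓘(ℝ, E) x).symm y)) (extChartAt 𝓘(ℝ, E) x x) := by
  rw [contMDiffAt_iff_source]
  simp only [modelWithCornersSelf_coe, range_id, contMDiffWithinAt_univ]
  exact contMDiffAt_iff_contDiffAt

theorem contMDiffAt_prod_iff_chart {F : Type*} [NormedAddCommGroup F] [NormedSpace ℝ F]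
    {f : ℝ × M → F} {t : ℝ} {x : M} :
    ContMDiffAt (𝓘(ℝ, ℝ).prod 𝓘(ℝ, E)) 𝓘(ℝ, F) ∞ f (t, x) ↔
      ContDiffAt ℝ ∞ (fun p : ℝ × E ↦ f (p.1, (extChartAt 𝓘(ℝ, E) x).symm p.2))
        (t, extChartAt 𝓘(ℝ, E) x x) := by
  rw [contMDiffAt_iff_source]
  rw [ModelWithCorners.range_eq_univ, contMDiffWithinAt_univ]
  simp only [extChartAt_prod, extChartAt_model_space_eq_id]
  exact contMDiffAt_iff_contDiffAt (E := ℝ × E)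

variable [IsManifold 𝓘(ℝ, E) ∞ M]

theorem mdifferentiableAt_extChartAt_symm {x : M} {y : E}
    (hy : y ∈ (extChartAt 𝓘(ℝ, E) x).target) :
    MDifferentiableAt 𝓘(ℝ, E) 𝓘(ℝ, E) (extChartAt 𝓘(ℝ, E) x).symm y :=
  ((contMDiffOn_extChartAt_symm (n := ∞) x).contMDiffAt
    (extChartAt_target_mem_nhds' hy)).mdifferentiableAt (by simp)

theorem mfderiv_comp_chartFrame {x : M} {y : E} (hy : y ∈ (extChartAt 𝓘(ℝ, E) x).target) (v : E) :
    mfderiv 𝓘(ℝ, E) 𝓘(ℝ, E) (extChartAt 𝓘(ℝ, E) x) ((extChartAt 𝓘(ℝ, E) x).symm y)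
      (chartFrame x y v) = v := by
  have : IsManifold 𝓘(ℝ, E) 1 M := .of_le (n := ∞) (by simp)
  have h := mfderiv_extChartAt_comp_mfderivWithin_extChartAt_symm (I := 𝓘(ℝ, E)) hy
  simp only [modelWithCornersSelf_coe, range_id, mfderivWithin_univ] at h
  exact DFunLike.congr_fun h v

theorem chartFrame_comp_mfderiv {x : M} {y : E} (hy : y ∈ (extChartAt 𝓘(ℝ, E) x).target)
    (v : TangentSpace 𝓘(ℝ, E) ((extChartAt 𝓘(ℝ, E) x).symm y)) :
    chartFrame x y (mfderiv 𝓘(ℝ, E) 𝓘(ℝ, E) (extChartAt 𝓘(ℝ, E) x)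
      ((extChartAt 𝓘(ℝ, E) x).symm y) v) = v := by
  have : IsManifold 𝓘(ℝ, E) 1 M := .of_le (n := ∞) (by simp)
  have h := mfderivWithin_extChartAt_symm_comp_mfderiv_extChartAt (I := 𝓘(ℝ, E)) hy
  simp only [modelWithCornersSelf_coe, range_id, mfderivWithin_univ] at h
  exact DFunLike.congr_fun h v

theorem chartFrame_self (x : M) (v : E) : chartFrame x (extChartAt 𝓘(ℝ, E) x x) v = v := by
  have : IsManifold 𝓘(ℝ, E) 1 M := .of_le (n := ∞) (by simp)
  have h := chartFrame_comp_mfderiv (mem_extChartAt_target (I := 𝓘(ℝ, E)) x) v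
  rw [extChartAt_to_inv (I := 𝓘(ℝ, E)) x, mfderiv_extChartAt_self] at h
  exact h

theorem chartOneForm_mvfderiv {f : M → ℝ} {x : M} {y : E}
    (hy : y ∈ (extChartAt 𝓘(ℝ, E) x).target)
    (hf : MDifferentiableAt 𝓘(ℝ, E) 𝓘(ℝ, ℝ) f ((extChartAt 𝓘(ℝ, E) x).symm y)) :
    chartOneForm (mvfderiv 𝓘(ℝ, E) f) x y =
      fderiv ℝ (fun y ↦ f ((extChartAt 𝓘(ℝ, E) x).symm y)) y := by
  have h := mfderiv_comp y hf (mdifferentiableAt_extChartAt_symm hy)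
  rw [mfderiv_eq_fderiv] at h
  exact h.symm

/-- Smoothness as a section of the cotangent bundle is smoothness of the expression in the chart. -/
theorem smoothOneFormAt_iff {a : OneForm E M} {x₀ : M} :
    ContMDiffAt 𝓘(ℝ, E) (𝓘(ℝ, E).prod 𝓘(ℝ, E →L[ℝ] ℝ)) ∞
      (fun x ↦ Bundle.TotalSpace.mk' (E →L[ℝ] ℝ) x (a x)) x₀ ↔
    ContDiffAt ℝ ∞ (chartOneForm a x₀) (extChartAt 𝓘(ℝ, E) x₀ x₀) := by
  have : IsManifold 𝓘(ℝ, E) 1 M := .of_le (n := ∞) (by simp)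
  rw [Bundle.contMDiffAt_section, contMDiffAt_iff_chart]
  suffices H : _ =ᶠ[𝓝 (extChartAt 𝓘(ℝ, E) x₀ x₀)] _ from
    ⟨fun h ↦ h.congr_of_eventuallyEq H.symm, fun h ↦ h.congr_of_eventuallyEq H⟩
  filter_upwards [extChartAt_target_mem_nhds (I := 𝓘(ℝ, E)) x₀] with y hy
  have hx : (extChartAt 𝓘(ℝ, E) x₀).symm y ∈ (chartAt E x₀).source := by
    simpa using (extChartAt 𝓘(ℝ, E) x₀).map_target hy
  rw [hom_trivializationAt_apply]
  simp only [ContinuousLinearMap.inCoordinates, TangentBundle.symmL_trivializationAt hx]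
  rw [(extChartAt 𝓘(ℝ, E) x₀).right_inv hy]
  simp only [modelWithCornersSelf_coe, range_id, mfderivWithin_univ]
  ext v
  simp [chartOneForm]
  rfl

/-- Smoothness as a section of the bundle of bilinear forms is smoothness of the expression in the
chart. -/
theorem smoothTwoFormAt_iff {σ : TwoForm E M} {x₀ : M} :
    ContMDiffAt 𝓘(ℝ, E) (𝓘(ℝ, E).prod 𝓘(ℝ, E →L[ℝ] E →L[ℝ] ℝ)) ∞
      (fun x ↦ Bundle.TotalSpace.mk' (E →L[ℝ] E →L[ℝ] ℝ) x (σ x)) x₀ ↔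
    ContDiffAt ℝ ∞ (chartTwoForm σ x₀) (extChartAt 𝓘(ℝ, E) x₀ x₀) := by
  have : IsManifold 𝓘(ℝ, E) 1 M := .of_le (n := ∞) (by simp)
  rw [Bundle.contMDiffAt_section, contMDiffAt_iff_chart]
  suffices H : _ =ᶠ[𝓝 (extChartAt 𝓘(ℝ, E) x₀ x₀)] _ from
    ⟨fun h ↦ h.congr_of_eventuallyEq H.symm, fun h ↦ h.congr_of_eventuallyEq H⟩
  filter_upwards [extChartAt_target_mem_nhds (I := 𝓘(ℝ, E)) x₀] with y hy
  have hx : (extChartAt 𝓘(ℝ, E) x₀).symm y ∈ (chartAt E x₀).source := by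
    simpa using (extChartAt 𝓘(ℝ, E) x₀).map_target hy
  have hs := TangentBundle.symmL_trivializationAt (I := 𝓘(ℝ, E)) hx
  rw [(extChartAt 𝓘(ℝ, E) x₀).right_inv hy] at hs
  simp only [modelWithCornersSelf_coe, range_id, mfderivWithin_univ] at hs
  rw [hom_trivializationAt_apply]
  ext v w
  rw [inCoordinates_apply_eq₂ (by simpa using hx) (by simpa using hx) (by simp)]
  have h1 : ∀ v, (trivializationAt E (TangentSpace 𝓘(ℝ, E)) x₀).symm
      ((extChartAt 𝓘(ℝ, E) x₀).symm y) v = chartFrame x₀ y v := fun v ↦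
    (Bundle.Trivialization.symmL_apply (R := ℝ) _ (by simpa using hx) v).symm.trans
      (DFunLike.congr_fun hs v)
  rw [h1, h1]
  simp [chartTwoForm]
  rfl

/-- A time-dependent vector field is smooth if its expression in the chart is smooth in time and
space. -/
theorem contMDiffAt_vectorField {X : ℝ → ∀ x : M, TangentSpace 𝓘(ℝ, E) x} {t₀ : ℝ} {x₀ : M}
    (h : ContDiffAt ℝ ∞ (fun p : ℝ × E ↦ (mfderiv 𝓘(ℝ, E) 𝓘(ℝ, E) (extChartAt 𝓘(ℝ, E) x₀)
      ((extChartAt 𝓘(ℝ, E) x₀).symm p.2) (X p.1 ((extChartAt 𝓘(ℝ, E) x₀).symm p.2)) : E))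
      (t₀, extChartAt 𝓘(ℝ, E) x₀ x₀)) :
    ContMDiffAt (𝓘(ℝ, ℝ).prod 𝓘(ℝ, E)) 𝓘(ℝ, E).tangent ∞
      (fun p : ℝ × M ↦ (⟨p.2, X p.1 p.2⟩ : TangentBundle 𝓘(ℝ, E) M)) (t₀, x₀) := by
  have : IsManifold 𝓘(ℝ, E) 1 M := .of_le (n := ∞) (by simp)
  refine Bundle.contMDiffAt_totalSpace.2 ⟨contMDiffAt_snd, ?_⟩
  rw [contMDiffAt_prod_iff_chart]
  refine h.congr_of_eventuallyEq ?_
  have : ∀ᶠ p : ℝ × E in 𝓝 (t₀, extChartAt 𝓘(ℝ, E) x₀ x₀),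
      p.2 ∈ (extChartAt 𝓘(ℝ, E) x₀).target :=
    continuousAt_snd.eventually (extChartAt_target_mem_nhds (I := 𝓘(ℝ, E)) x₀)
  filter_upwards [this] with p hy
  have hx : (extChartAt 𝓘(ℝ, E) x₀).symm p.2 ∈ (chartAt E x₀).source := by
    simpa using (extChartAt 𝓘(ℝ, E) x₀).map_target hy
  have hs := TangentBundle.continuousLinearMapAt_trivializationAt (I := 𝓘(ℝ, E)) hx
  rw [← hs]
  symm
  exact Bundle.Trivialization.continuousLinearMapAt_apply_of_mem ℝ _ (by simpa using hx) _

end Charts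

/-! ### Linear algebra of desingularized forms -/

section LinearAlgebra

/-- If `(d, P)` is injective and `P` takes values in the hyperplane `ker ζ`, then `(d, P)` is, for
reasons of dimension, an isomorphism onto `ℝ × ker ζ`. -/
theorem exists_lift_of_jointly_injective {V W : Type*} [AddCommGroup V] [Module ℝ V]
    [AddCommGroup W] [Module ℝ W] [FiniteDimensional ℝ V] [FiniteDimensional ℝ W]
    (hVW : Module.finrank ℝ V = Module.finrank ℝ W) (d : V →ₗ[ℝ] ℝ) (P : V →ₗ[ℝ] W)
    (ζ : W →ₗ[ℝ] ℝ) (hζ : ζ ≠ 0) (hP : ∀ v, ζ (P v) = 0)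
    (hinj : ∀ v, d v = 0 → P v = 0 → v = 0) (s : ℝ) (u : W) (hu : ζ u = 0) :
    ∃ v, d v = s ∧ P v = u := by
  let T : V →ₗ[ℝ] ℝ × LinearMap.ker ζ := d.prod (P.codRestrict _ hP)
  have hT : Function.Injective T := by
    refine (injective_iff_map_eq_zero T).2 fun v hv ↦ ?_
    have h := Prod.ext_iff.1 hv
    exact hinj v h.1 (congrArg Subtype.val h.2)
  have hfin : Module.finrank ℝ V = Module.finrank ℝ (ℝ × LinearMap.ker ζ) := by
    have := Module.Dual.finrank_ker_add_one_of_ne_zero (f := ζ) hζ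
    rw [Module.finrank_prod, Module.finrank_self]
    omega
  obtain ⟨v, hv⟩ := (LinearMap.injective_iff_surjective_of_finrank_eq_finrank hfin).1 hT
    (s, ⟨u, hu⟩)
  have h := Prod.ext_iff.1 hv
  exact ⟨v, h.1, congrArg Subtype.val h.2⟩

/-- The pointwise Reeb vector: nondegeneracy of `ds ∧ a + b` on `ℝ × ker ζ` makes every functional
on this space a contraction of the form, and the functional `(s', u') ↦ - s'` is the contraction
with the wanted vector. -/
theorem exists_reeb_of_nondegenerate {W : Type*} [AddCommGroup W] [Module ℝ W]
    [FiniteDimensional ℝ W] (ζ a : W →ₗ[ℝ] ℝ) (b : W →ₗ[ℝ] W →ₗ[ℝ] ℝ) (hb : ∀ u, b u u = 0)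
    (h : ∀ (s : ℝ) (u : W), ζ u = 0 →
      (∀ (s' : ℝ) (u' : W), ζ u' = 0 → s * a u' - s' * a u + b u u' = 0) → s = 0 ∧ u = 0) :
    ∃ u, ζ u = 0 ∧ a u = 1 ∧ ∀ u', ζ u' = 0 → b u u' = 0 := by
  let K := LinearMap.ker ζ
  let T : ℝ × K →ₗ[ℝ] Module.Dual ℝ (ℝ × K) :=
    LinearMap.mk₂ ℝ (fun p q ↦ p.1 * a q.2 - q.1 * a p.2 + b p.2 q.2)
      (fun p p' q ↦ by simp; ring) (fun c p q ↦ by simp; ring)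
      (fun p q q' ↦ by simp; ring) (fun c p q ↦ by simp; ring)
  have hT : Function.Injective T := by
    refine (injective_iff_map_eq_zero T).2 fun p hp ↦ ?_
    have := h p.1 p.2 p.2.2 fun s' u' hu' ↦ DFunLike.congr_fun hp (s', (⟨u', hu'⟩ : K))
    exact Prod.ext this.1 (Subtype.ext this.2)
  have hfin : Module.finrank ℝ (ℝ × K) = Module.finrank ℝ (Module.Dual ℝ (ℝ × K)) :=
    (Subspace.dual_finrank_eq).symm
  obtain ⟨⟨s, u⟩, hp⟩ := (LinearMap.injective_iff_surjective_of_finrank_eq_finrank hfin).1 hT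
    (-(LinearMap.fst ℝ ℝ K))
  have key : ∀ (s' : ℝ) (u' : K), s * a u' - s' * a u + b u u' = -s' :=
    fun s' u' ↦ DFunLike.congr_fun hp (s', u')
  have h1 : a u = 1 := by simpa using key 1 0
  have hs : s = 0 := by simpa [h1, hb] using key 0 u
  exact ⟨u, u.2, h1, fun u' hu' ↦ by simpa [hs] using key 0 ⟨u', hu'⟩⟩

variable {V : Type*} [AddCommGroup V] [Module ℝ V] [TopologicalSpace V]
    [IsTopologicalAddGroup V] [ContinuousSMul ℝ V]

@[simp]
theorem wedge_apply (a b : V →L[ℝ] ℝ) (v w : V) : wedge a b v w = a v * b w - b v * a w := by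
  simp [wedge]

/-- Nondegeneracy of `c dz ∧ A + B` does not depend on `c ≠ 0` if a vector `n` with `dz n = 1` is in
the kernel of `A` and `B`: the kernels for different `c` correspond under a rescaling of the
normal component. -/
theorem nondegenerate_of_smul_wedge_add {dz A : V →L[ℝ] ℝ} {B : V →L[ℝ] V →L[ℝ] ℝ} {c c' : ℝ}
    (hc : c ≠ 0) (hc' : c' ≠ 0) {n : V} (hn : dz n = 1) (hA : A n = 0) (hB : ∀ w, B n w = 0)
    (hB' : ∀ w, B w n = 0) (h : ∀ v, (∀ w, (c • wedge dz A + B) v w = 0) → v = 0) {v : V}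
    (hv : ∀ w, (c' • wedge dz A + B) v w = 0) : v = 0 := by
  have hv' : ∀ w, c' * (dz v * A w - A v * dz w) + B v w = 0 := fun w ↦ by simpa using hv w
  have hAv : A v = 0 := by simpa [hA, hB', hn, hc'] using hv' n
  have h0 : v + ((c' / c - 1) * dz v) • n = 0 := by
    refine h _ fun w ↦ ?_
    have := hv' w
    simp only [add_apply, smul_apply, map_add, map_smul,
      wedge_apply, smul_eq_mul, hA, hB, hn, hAv] at this ⊢
    have hcc : c * (c' / c) = c' := by field_simp
    linear_combination this + (dz v * A w) * hcc
  have h1 : dz v = 0 := by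
    have := congrArg dz h0
    simp only [map_add, map_smul, smul_eq_mul, hn, map_zero] at this
    have h2 : c' / c * dz v = 0 := by linarith
    simpa [hc, hc'] using h2
  simpa [h1] using h0

/-- A vector `X` that is Hamiltonian for `c dz ∧ A + B` and the covector `c k dz + g` is Hamiltonian
for `c₀ dz ∧ A + B` and `c₀ k dz + g`, provided that `g` kills the normal vector `n` and a Reeb
vector `R`. Testing with `n` gives `A X = k`, testing with `R` gives `dz X = 0`, and then both
equations say `B X w - k c dz w = - (c k dz w + g w)` with the terms in `c` cancelling. -/
theorem hamiltonian_of_smul_wedge_add {dz A A₀ g : V →L[ℝ] ℝ} {B : V →L[ℝ] V →L[ℝ] ℝ}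
    {c c₀ k : ℝ} (hc : c ≠ 0) {n R X : V} (hn : dz n = 1) (hA : A n = 0)
    (hBalt : ∀ v, B v v = 0) (hBn : ∀ w, B w n = 0) (hgn : g n = 0)
    (hR : dz R = 0) (hRA : A₀ R = 1) (hBR : ∀ w, B R w = 0) (hgR : g R = 0)
    (h : ∀ v, (∀ w, (c₀ • wedge dz A + B) v w = 0) → v = 0)
    (hX : ∀ w, (c • wedge dz A + B) X w = -(c * k * dz w + g w)) (w : V) :
    (c₀ • wedge dz A + B) X w = -(c₀ * k * dz w + g w) := by
  have hX' : ∀ w, c * (dz X * A w - A X * dz w) + B X w = -(c * k * dz w + g w) :=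
    fun w ↦ by simpa using hX w
  have hBX : B X R = 0 := by
    have := hBalt (X + R)
    simp only [map_add, add_apply, hBalt, hBR] at this
    linarith
  have hAX : A X = k := by
    have := hX' n
    rw [hn, hA, hBn, hgn] at this
    have : c * (A X - k) = 0 := by linarith
    simpa [hc, sub_eq_zero] using this
  have hAR : A R ≠ 0 := by
    intro h0
    have : R = 0 := h R fun w ↦ by simp [hR, h0, hBR]
    simp [this] at hRA
  have hdz : dz X = 0 := by
    have := hX' R
    rw [hR, hBX, hgR] at this
    have : c * (dz X * A R) = 0 := by linarith
    simpa [hc, hAR] using this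
  have := hX' w
  simp only [add_apply, smul_apply, wedge_apply,
    smul_eq_mul, hAX, hdz] at this ⊢
  linarith

end LinearAlgebra

/-! ### Calculus of the desingularizing function -/

section Calculus

theorem hasDerivAt_neg_inv_pow (n : ℕ) {x : ℝ} (hx : x ≠ 0) :
    HasDerivAt (fun x : ℝ ↦ -1 / (((n + 1 : ℕ) : ℝ) * x ^ (n + 1))) (x ^ (n + 2))⁻¹ x := by
  have h := (((hasDerivAt_pow (n + 1) x).const_mul ((n + 1 : ℕ) : ℝ)).inv
    (mul_ne_zero (by positivity) (pow_ne_zero _ hx))).const_mul (-1)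
  refine (h.congr_deriv ?_).congr_of_eventuallyEq (Filter.Eventually.of_forall fun y ↦ ?_)
  · have : ((n + 1 : ℕ) : ℝ) ≠ 0 := by positivity
    simp only [Nat.add_sub_cancel]
    field_simp
    ring
  · simp [div_eq_mul_inv]

/-- A smooth function that equals `s ^ n * (a + b * log |s|)` for `s > 0` and
`s ^ n * (a' + b * log |s|)` for `s < 0` has no logarithmic term and the same constant on both
sides. Differentiation lowers `n`, and for `n = 0` continuity suffices. (In Mathlib `Real.log s` is
`log |s|` for negative `s`.) -/
theorem log_coeff_eq_zero_of_contDiffAt {η : ℝ} (hη : 0 < η) (n : ℕ) :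
    ∀ (Q : ℝ → ℝ) (a a' b : ℝ), ContDiffOn ℝ ∞ Q (Ioo (-η) η) →
      (∀ s ∈ Ioo 0 η, Q s = s ^ n * (a + b * Real.log s)) →
      (∀ s ∈ Ioo (-η) 0, Q s = s ^ n * (a' + b * Real.log s)) → b = 0 ∧ a = a' := by
  have h0mem : Ioo (-η) η ∈ 𝓝 (0 : ℝ) := Ioo_mem_nhds (by linarith) hη
  induction n with
  | zero =>
    intro Q a a' b hQ hpos hneg
    have hc : ContinuousAt Q 0 := hQ.continuousOn.continuousAt h0mem
    have hr : Filter.Tendsto (fun s ↦ a + b * Real.log s) (𝓝[>] 0) (𝓝 (Q 0)) := by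
      refine (hc.mono_left nhdsWithin_le_nhds).congr' ?_
      filter_upwards [Ioo_mem_nhdsGT hη] with s hs
      simpa using hpos s hs
    have hl : Filter.Tendsto (fun s ↦ a' + b * Real.log s) (𝓝[<] 0) (𝓝 (Q 0)) := by
      refine (hc.mono_left nhdsWithin_le_nhds).congr' ?_
      filter_upwards [Ioo_mem_nhdsLT (neg_lt_zero.2 hη)] with s hs
      simpa using hneg s hs
    have hb : b = 0 := by
      by_contra hb
      have h1 : Filter.Tendsto Real.log (𝓝[>] 0) (𝓝 ((Q 0 - a) / b)) := by
        refine ((hr.sub_const a).div_const b).congr fun s ↦ ?_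
        field_simp
        ring
      have h2 : Filter.Tendsto Real.log (𝓝[>] 0) Filter.atBot :=
        Real.tendsto_log_nhdsNE_zero.mono_left
          (nhdsWithin_mono _ fun x (hx : 0 < x) ↦ hx.ne')
      exact not_tendsto_nhds_of_tendsto_atBot h2 _ h1
    subst hb
    refine ⟨rfl, ?_⟩
    simp only [zero_mul, add_zero] at hr hl
    exact (tendsto_nhds_unique tendsto_const_nhds hr).trans
      (tendsto_nhds_unique hl tendsto_const_nhds)
  | succ n ih =>
    intro Q a a' b hQ hpos hneg
    have key : ∀ (α s : ℝ), s ≠ 0 → HasDerivAt (fun s ↦ s ^ (n + 1) * (α + b * Real.log s))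
        (s ^ n * (((n + 1) * α + b) + ((n + 1) * b) * Real.log s)) s := by
      intro α s hs
      refine ((hasDerivAt_pow (n + 1) s).mul
        (((Real.hasDerivAt_log hs).const_mul b).const_add α)).congr_deriv ?_
      push_cast
      field_simp
      ring
    have h := ih (deriv Q) ((n + 1) * a + b) ((n + 1) * a' + b) ((n + 1) * b)
      (hQ.deriv_of_isOpen isOpen_Ioo (by simp)) (fun s hs ↦ ?_) (fun s hs ↦ ?_)
    · have hn : ((n : ℝ) + 1) ≠ 0 := by positivity
      have hb : b = 0 := by simpa [hn] using h.1
      refine ⟨hb, ?_⟩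
      have := h.2
      simpa [hn] using this
    · refine ((key a s hs.1.ne').congr_of_eventuallyEq ?_).deriv
      filter_upwards [isOpen_Ioo.mem_nhds hs] with u hu using hpos u hu
    · refine ((key a' s hs.2.ne).congr_of_eventuallyEq ?_).deriv
      filter_upwards [isOpen_Ioo.mem_nhds hs] with u hu using hneg u hu

variable {m : ℕ} {f : ℝ → ℝ}

theorem odd_two_mul_sub_one (hm : 1 ≤ m) : Odd (2 * m - 1) := ⟨m - 1, by omega⟩

namespace IsDesingularizingFunction

theorem eq_of_ge (hf : IsDesingularizingFunction m f) {x : ℝ} (hx : 1 ≤ x) :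
    f x = -1 / ((2 * (m : ℝ) - 1) * x ^ (2 * m - 1)) + 2 := by
  rcases hx.lt_or_eq with h | rfl
  · exact hf.eq_of_gt x h
  · have h1 : Filter.Tendsto f (𝓝[>] 1) (𝓝 (f 1)) :=
      hf.smooth.continuous.continuousAt.mono_left nhdsWithin_le_nhds
    have h2 : Filter.Tendsto (fun x : ℝ ↦ -1 / (2 * (m : ℝ) - 1) * (x ^ (2 * m - 1))⁻¹ + 2) (𝓝[>] 1)
        (𝓝 (-1 / (2 * (m : ℝ) - 1) * ((1 : ℝ) ^ (2 * m - 1))⁻¹ + 2)) := by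
      refine Filter.Tendsto.mono_left ?_ nhdsWithin_le_nhds
      exact (((continuousAt_id.pow _).inv₀ (by simp)).const_mul _).add_const _
    have h3 := tendsto_nhds_unique h1 (h2.congr' ?_)
    · rw [h3, div_mul_eq_div_div, ← div_eq_mul_inv]
    · filter_upwards [self_mem_nhdsWithin] with x hx
      rw [hf.eq_of_gt x hx, div_mul_eq_div_div, ← div_eq_mul_inv]

theorem eq_of_le (hf : IsDesingularizingFunction m f) (hm : 1 ≤ m) {x : ℝ} (hx : x ≤ -1) :
    f x = -1 / ((2 * (m : ℝ) - 1) * x ^ (2 * m - 1)) - 2 := by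
  have h := hf.eq_of_ge (x := -x) (by linarith)
  rw [hf.odd, (odd_two_mul_sub_one hm).neg_pow, mul_neg, div_neg] at h
  linarith

theorem deriv_of_abs_gt (hf : IsDesingularizingFunction m f) (hm : 1 ≤ m) {x : ℝ} (hx : 1 < |x|) :
    deriv f x = (x ^ (2 * m))⁻¹ := by
  have hx0 : x ≠ 0 := by rintro rfl; simp at hx; linarith
  obtain ⟨n, rfl⟩ : ∃ n, m = n + 1 := ⟨m - 1, by omega⟩
  have h := hasDerivAt_neg_inv_pow (2 * n) hx0
  have e : ((2 * n + 1 : ℕ) : ℝ) = 2 * ((n + 1 : ℕ) : ℝ) - 1 := by push_cast; ring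
  rcases lt_abs.1 hx with h1 | h1
  · refine ((h.add_const 2).congr_of_eventuallyEq ?_).deriv
    filter_upwards [isOpen_Ioi.mem_nhds h1] with y hy
    rw [hf.eq_of_gt y hy, e]; rfl
  · refine ((h.sub_const 2).congr_of_eventuallyEq ?_).deriv
    filter_upwards [isOpen_Iio.mem_nhds (show x < -1 by linarith)] with y hy
    rw [hf.eq_of_lt y hy, e]; rfl

/-- The formula for `|x| > 1` extends to `x = ± 1` by continuity. -/
theorem deriv_of_abs_ge (hf : IsDesingularizingFunction m f) (hm : 1 ≤ m) {x : ℝ} (hx : 1 ≤ |x|) :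
    deriv f x = (x ^ (2 * m))⁻¹ := by
  have hx0 : x ≠ 0 := by rintro rfl; simp at hx; linarith
  -- the points `c * x` with `c > 1` satisfy the strict inequality
  have hc : Filter.Tendsto (fun c : ℝ ↦ c * x) (𝓝[>] 1) (𝓝 x) := by
    have : ContinuousAt (fun c : ℝ ↦ c * x) 1 := by fun_prop
    simpa [ContinuousAt] using this.mono_left (nhdsWithin_le_nhds (s := Ioi (1 : ℝ)))
  have h1 : Filter.Tendsto (fun c : ℝ ↦ deriv f (c * x)) (𝓝[>] 1) (𝓝 (deriv f x)) :=
    ((hf.smooth.continuous_deriv (by simp)).tendsto x).comp hc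
  have h2 : Filter.Tendsto (fun c : ℝ ↦ ((c * x) ^ (2 * m))⁻¹) (𝓝[>] 1) (𝓝 (x ^ (2 * m))⁻¹) :=
    (hc.pow _).inv₀ (pow_ne_zero _ hx0)
  refine tendsto_nhds_unique h1 (h2.congr' ?_)
  filter_upwards [self_mem_nhdsWithin] with c hc
  have hc : (1 : ℝ) < c := hc
  refine (hf.deriv_of_abs_gt hm ?_).symm
  rw [abs_mul, abs_of_pos (by linarith)]
  nlinarith [abs_pos.2 hx0]

/-- Where `|s| ≥ ε`, the rescaled function differs from `- 1 / ((2 m - 1) s ^ (2 m - 1))` by the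
constant `± 2 / ε ^ (2 m - 1)`, whose sign is that of `s`. -/
theorem rescale_of_le (hf : IsDesingularizingFunction m f) (hm : 1 ≤ m) {ε s : ℝ} (hε : 0 < ε)
    (hs : ε ≤ |s|) : rescale m f ε s =
      -1 / ((2 * (m : ℝ) - 1) * s ^ (2 * m - 1)) + 2 / ε ^ (2 * m - 1) * SignType.sign s := by
  have hs0 : s ≠ 0 := by rintro rfl; simp at hs; linarith
  have hm' : (2 * (m : ℝ) - 1) ≠ 0 := by
    have : (1 : ℝ) ≤ m := by exact_mod_cast hm
    linarith
  have hsp : s ^ (2 * m - 1) ≠ 0 := pow_ne_zero _ hs0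
  have hεp : ε ^ (2 * m - 1) ≠ 0 := pow_ne_zero _ hε.ne'
  unfold rescale
  rcases lt_or_gt_of_ne hs0 with h | h
  · rw [abs_of_neg h] at hs
    rw [hf.eq_of_le hm ((div_le_iff₀ hε).2 (by linarith)), sign_neg h, div_pow]
    simp only [SignType.coe_neg, SignType.coe_one]
    field_simp
    ring
  · rw [abs_of_pos h] at hs
    rw [hf.eq_of_ge ((le_div_iff₀ hε).2 (by linarith)), sign_pos h, div_pow]
    simp only [SignType.coe_one]
    field_simp

theorem contDiff_rescale (hf : IsDesingularizingFunction m f) (ε : ℝ) :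
    ContDiff ℝ ∞ (rescale m f ε) :=
  contDiff_const.mul (hf.smooth.comp (contDiff_id.div_const ε))

theorem deriv_rescale (hf : IsDesingularizingFunction m f) (hm : 1 ≤ m) {ε : ℝ} (s : ℝ) :
    deriv (rescale m f ε) s = (ε ^ (2 * m))⁻¹ * deriv f (s / ε) := by
  have h1 : HasDerivAt f (deriv f (s / ε)) (s / ε) :=
    ((hf.smooth.differentiable (by simp)) _).hasDerivAt
  have h2 := (h1.comp s ((hasDerivAt_id s).div_const ε)).const_mul (ε ^ (2 * m - 1))⁻¹
  have e : ε ^ (2 * m) = ε ^ (2 * m - 1) * ε := by rw [← pow_succ]; congr 1; omega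
  rw [show rescale m f ε = fun s ↦ (ε ^ (2 * m - 1))⁻¹ * (f ∘ fun x ↦ id x / ε) s from rfl,
    h2.deriv, e, mul_inv]
  ring

theorem deriv_rescale_of_le (hf : IsDesingularizingFunction m f) (hm : 1 ≤ m) {ε s : ℝ}
    (hε : 0 < ε) (hs : ε ≤ |s|) : deriv (rescale m f ε) s = (s ^ (2 * m))⁻¹ := by
  rw [hf.deriv_rescale hm, hf.deriv_of_abs_ge hm, div_pow]
  · have : ε ^ (2 * m) ≠ 0 := pow_ne_zero _ hε.ne'
    field_simp
  · rwa [abs_div, abs_of_pos hε, le_div_iff₀ hε, one_mul]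

theorem deriv_rescale_pos (hf : IsDesingularizingFunction m f) (hm : 1 ≤ m) {ε : ℝ}
    (hε : 0 < ε) (s : ℝ) : 0 < deriv (rescale m f ε) s := by
  rcases le_or_gt ε |s| with hs | hs
  · rw [hf.deriv_rescale_of_le hm hε hs]
    have hs0 : s ≠ 0 := by rintro rfl; simp at hs; linarith
    have : Even (2 * m) := even_two_mul m
    exact inv_pos.2 (this.pow_pos hs0)
  · rw [hf.deriv_rescale hm]
    refine mul_pos (by positivity) (hf.deriv_pos _ (abs_le.1 ?_))
    rw [abs_div, abs_of_pos hε]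
    exact (div_le_one hε).2 hs.le

end IsDesingularizingFunction
end Calculus

/-! ### Tubular neighbourhoods and Laurent decompositions -/

section ChartForms

variable {E : Type*} [NormedAddCommGroup E] [NormedSpace ℝ E]
  {M : Type*} [TopologicalSpace M] [ChartedSpace E M]

theorem SmoothOneFormOn.contDiffAt [IsManifold 𝓘(ℝ, E) ∞ M] {U : Set M} {a : OneForm E M}
    (h : SmoothOneFormOn U a) (hU : IsOpen U) {x : M} (hx : x ∈ U) :
    ContDiffAt ℝ ∞ (chartOneForm a x) (extChartAt 𝓘(ℝ, E) x x) :=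
  smoothOneFormAt_iff.1 (h.contMDiffAt (hU.mem_nhds hx))

theorem SmoothTwoFormOn.contDiffAt [IsManifold 𝓘(ℝ, E) ∞ M] {U : Set M} {σ : TwoForm E M}
    (h : SmoothTwoFormOn U σ) (hU : IsOpen U) {x : M} (hx : x ∈ U) :
    ContDiffAt ℝ ∞ (chartTwoForm σ x) (extChartAt 𝓘(ℝ, E) x x) :=
  smoothTwoFormAt_iff.1 (h.contMDiffAt (hU.mem_nhds hx))

theorem chartOneForm_apply (a : OneForm E M) (x : M) (y v : E) :
    chartOneForm a x y v = a ((extChartAt 𝓘(ℝ, E) x).symm y) (chartFrame x y v) := rfl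

theorem chartTwoForm_apply (σ : TwoForm E M) (x : M) (y v w : E) :
    chartTwoForm σ x y v w =
      σ ((extChartAt 𝓘(ℝ, E) x).symm y) (chartFrame x y v) (chartFrame x y w) := rfl

theorem chartOneForm_self [IsManifold 𝓘(ℝ, E) ∞ M] (a : OneForm E M) (x : M) (v : E) :
    chartOneForm a x (extChartAt 𝓘(ℝ, E) x x) v = a x v := by
  have key : ∀ x', x' = x → ∀ v : E, (a x' v : ℝ) = a x v := by rintro _ rfl _; rfl
  rw [chartOneForm_apply, chartFrame_self]
  exact key _ (extChartAt_to_inv (I := 𝓘(ℝ, E)) x) v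

theorem chartTwoForm_self [IsManifold 𝓘(ℝ, E) ∞ M] (σ : TwoForm E M) (x : M) (v w : E) :
    chartTwoForm σ x (extChartAt 𝓘(ℝ, E) x x) v w = σ x v w := by
  have key : ∀ x', x' = x → ∀ v w : E, (σ x' v w : ℝ) = σ x v w := by rintro _ rfl _ _; rfl
  rw [chartTwoForm_apply, chartFrame_self, chartFrame_self]
  exact key _ (extChartAt_to_inv (I := 𝓘(ℝ, E)) x) v w

theorem chartTwoForm_smul_wedge_add {σ b : TwoForm E M} {d a : OneForm E M} {c : ℝ} {x : M} {y : E}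
    (h : σ ((extChartAt 𝓘(ℝ, E) x).symm y) = c • wedge (d ((extChartAt 𝓘(ℝ, E) x).symm y))
      (a ((extChartAt 𝓘(ℝ, E) x).symm y)) + b ((extChartAt 𝓘(ℝ, E) x).symm y)) :
    chartTwoForm σ x y =
      c • wedge (chartOneForm d x y) (chartOneForm a x y) + chartTwoForm b x y := by
  ext v w
  rw [chartTwoForm_apply, h]
  rfl

theorem eventually_extChartAt_symm {x : M} {p : M → Prop} (h : ∀ᶠ x' in 𝓝 x, p x') :
    ∀ᶠ y in 𝓝 (extChartAt 𝓘(ℝ, E) x x), p ((extChartAt 𝓘(ℝ, E) x).symm y) := by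
  have hc := continuousAt_extChartAt_symm (I := 𝓘(ℝ, E)) x
  refine hc.eventually ?_
  rwa [extChartAt_to_inv (I := 𝓘(ℝ, E)) x]

/-- The complement of a regular level set accumulates at the level set, so continuous functions that
vanish there vanish on the level set. -/
theorem eq_zero_of_eventually_off_zero {ζ : E → ℝ} {ζ' : E →L[ℝ] ℝ} {y₀ : E}
    (hζ : HasFDerivAt ζ ζ' y₀) (hζ' : ζ' ≠ 0) (hζ0 : ζ y₀ = 0) {g : E → ℝ}
    (hg : ContinuousAt g y₀) (h : ∀ᶠ y in 𝓝 y₀, ζ y ≠ 0 → g y = 0) : g y₀ = 0 := by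
  by_contra hne
  obtain ⟨v, hv⟩ : ∃ v, ζ' v ≠ 0 := by
    by_contra! hcon
    exact hζ' (ContinuousLinearMap.ext hcon)
  have hl : HasDerivAt (fun s : ℝ ↦ y₀ + s • v) v 0 := by
    simpa using ((hasDerivAt_id (0 : ℝ)).smul_const v).const_add y₀
  have hd : HasDerivAt (fun s : ℝ ↦ ζ (y₀ + s • v)) (ζ' v) 0 := by
    have h0 : HasFDerivAt ζ ζ' (y₀ + (0 : ℝ) • v) := by simpa using hζ
    exact h0.comp_hasDerivAt (0 : ℝ) hl
  have h1 := hd.eventually_ne (c := ζ y₀) hv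
  have h2 : Filter.Tendsto (fun s : ℝ ↦ y₀ + s • v) (𝓝[≠] 0) (𝓝 y₀) := by
    have : ContinuousAt (fun s : ℝ ↦ y₀ + s • v) 0 := hl.continuousAt
    simpa [ContinuousAt] using this.mono_left (nhdsWithin_le_nhds (s := {0}ᶜ))
  obtain ⟨s, hs1, hs2, hs3⟩ := (h1.and ((h2.eventually h).and
    (h2.eventually (hg.eventually_ne hne)))).exists
  exact hs3 (hs2 (hζ0 ▸ hs1))

end ChartForms

section Tubular

variable {E : Type*} [NormedAddCommGroup E] [NormedSpace ℝ E]
  {M : Type*} [TopologicalSpace M] [ChartedSpace E M] {Z : Set M}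

namespace TubularNbhd

variable (T : TubularNbhd E Z)

theorem proj_mem {x : M} (hx : x ∈ T.N) : T.proj x ∈ Z := (T.bijOn.mapsTo hx).2

theorem z_proj {x : M} (hx : x ∈ T.N) : T.z (T.proj x) = 0 := T.z_eq _ (T.proj_mem hx)

theorem z_eq_zero_iff {x : M} (hx : x ∈ T.N) : T.z x = 0 ↔ x ∈ Z := by
  refine ⟨fun h ↦ ?_, T.z_eq x⟩
  have hp := T.proj_mem hx
  have : T.proj x = x := T.bijOn.injOn (T.subset hp) hx (by
    simp only [T.z_eq _ hp, T.proj_eq _ hp, h])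
  exact this ▸ hp

theorem contMDiffAt_z {x : M} (hx : x ∈ T.N) : ContMDiffAt 𝓘(ℝ, E) 𝓘(ℝ, ℝ) ∞ T.z x :=
  T.smooth_z.contMDiffAt (T.isOpen.mem_nhds hx)

theorem mdifferentiableAt_z {x : M} (hx : x ∈ T.N) : MDifferentiableAt 𝓘(ℝ, E) 𝓘(ℝ, ℝ) T.z x :=
  (T.contMDiffAt_z hx).mdifferentiableAt (by simp)

theorem contMDiffAt_proj {x : M} (hx : x ∈ T.N) : ContMDiffAt 𝓘(ℝ, E) 𝓘(ℝ, E) ∞ T.proj x :=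
  T.smooth_proj.contMDiffAt (T.isOpen.mem_nhds hx)

theorem mdifferentiableAt_proj {x : M} (hx : x ∈ T.N) :
    MDifferentiableAt 𝓘(ℝ, E) 𝓘(ℝ, E) T.proj x :=
  (T.contMDiffAt_proj hx).mdifferentiableAt (by simp)

theorem mvfderiv_z_mfderiv_proj {x : M} (hx : x ∈ T.N) (v : TangentSpace 𝓘(ℝ, E) x) :
    mvfderiv 𝓘(ℝ, E) T.z (T.proj x) (mfderiv 𝓘(ℝ, E) 𝓘(ℝ, E) T.proj x v) = 0 := by
  have h := mfderiv_comp x (T.mdifferentiableAt_z (T.subset (T.proj_mem hx)))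
    (T.mdifferentiableAt_proj hx)
  have h0 : T.z ∘ T.proj =ᶠ[𝓝 x] fun _ ↦ 0 := by
    filter_upwards [T.isOpen.mem_nhds hx] with y hy using T.z_proj hy
  rw [h0.mfderiv_eq, mfderiv_const] at h
  exact (DFunLike.congr_fun h v).symm

/-- At a point of the tubular neighbourhood, `(dz, dπ)` is an isomorphism of the tangent space onto
`ℝ × T Z`. -/
theorem exists_lift [FiniteDimensional ℝ E] {x : M} (hx : x ∈ T.N)
    (hreg : mvfderiv 𝓘(ℝ, E) T.z (T.proj x) ≠ 0)
    (s : ℝ) (u : TangentSpace 𝓘(ℝ, E) (T.proj x)) (hu : mvfderiv 𝓘(ℝ, E) T.z (T.proj x) u = 0) :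
    ∃ v : TangentSpace 𝓘(ℝ, E) x, mvfderiv 𝓘(ℝ, E) T.z x v = s ∧
      mfderiv 𝓘(ℝ, E) 𝓘(ℝ, E) T.proj x v = u := by
  let d : E →ₗ[ℝ] ℝ := (mvfderiv 𝓘(ℝ, E) T.z x).toLinearMap
  let P : E →ₗ[ℝ] E := (mfderiv 𝓘(ℝ, E) 𝓘(ℝ, E) T.proj x).toLinearMap
  let ζ : E →ₗ[ℝ] ℝ := (mvfderiv 𝓘(ℝ, E) T.z (T.proj x)).toLinearMap
  exact exists_lift_of_jointly_injective rfl d P ζ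
    (fun h ↦ hreg (ContinuousLinearMap.ext fun v ↦ DFunLike.congr_fun h v))
    (T.mvfderiv_z_mfderiv_proj hx) (T.injective_deriv x hx) s u hu

theorem mvfderiv_comp_z {g : ℝ → ℝ} {g' : ℝ} {x : M} (hg : HasDerivAt g g' (T.z x))
    (hx : x ∈ T.N) :
    mvfderiv 𝓘(ℝ, E) (fun y ↦ g (T.z y)) x = g' • mvfderiv 𝓘(ℝ, E) T.z x := by
  have hg' : MDifferentiableAt 𝓘(ℝ, ℝ) 𝓘(ℝ, ℝ) g (T.z x) := hg.differentiableAt.mdifferentiableAt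
  have h := mvfderiv_comp x hg' (T.mdifferentiableAt_z hx)
  have hf : (mvfderiv 𝓘(ℝ, ℝ) g (T.z x) : ℝ →L[ℝ] ℝ) = fderiv ℝ g (T.z x) := mfderiv_eq_fderiv
  ext v
  refine (DFunLike.congr_fun h v).trans ((DFunLike.congr_fun hf _).trans ?_)
  change fderiv ℝ g (T.z x) (mvfderiv 𝓘(ℝ, E) T.z x v) = _
  rw [fderiv_eq_smul_deriv, smul_eq_mul, mul_comm, hg.deriv]
  rfl

theorem contDiffAt_chart_z {x : M} (hx : x ∈ T.N) :
    ContDiffAt ℝ ∞ (fun y ↦ T.z ((extChartAt 𝓘(ℝ, E) x).symm y)) (extChartAt 𝓘(ℝ, E) x x) :=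
  contMDiffAt_iff_chart.1 (T.contMDiffAt_z hx)

end TubularNbhd

variable [IsManifold 𝓘(ℝ, E) ∞ M] {T : TubularNbhd E Z} {m : ℕ} {Ω : TwoForm E M}

namespace LaurentDecomposition

variable (L : LaurentDecomposition T m Ω)

/-- The sum `∑_{i < 2 m} z ^ i π^* α_i`. -/
def sumA : OneForm E M := fun x ↦ ∑ i ∈ Finset.range (2 * m), T.z x ^ i • L.A i x

theorem sumA_apply (x : M) (v : TangentSpace 𝓘(ℝ, E) x) :
    L.sumA x v = ∑ i ∈ Finset.range (2 * m), T.z x ^ i * L.A i x v := by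
  simp [sumA]

theorem chartOneForm_sumA (x : M) (y : E) : chartOneForm L.sumA x y =
    ∑ i ∈ Finset.range (2 * m), T.z ((extChartAt 𝓘(ℝ, E) x).symm y) ^ i •
      chartOneForm (L.A i) x y := by
  ext v
  refine (L.sumA_apply _ (chartFrame x y v)).trans ?_
  simp only [sum_apply, smul_apply, smul_eq_mul]
  rfl

theorem contDiffAt_chart_sumA {x : M} (hx : x ∈ T.N) :
    ContDiffAt ℝ ∞ (chartOneForm L.sumA x) (extChartAt 𝓘(ℝ, E) x x) := by
  have : chartOneForm L.sumA x = fun y ↦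
    ∑ i ∈ Finset.range (2 * m), T.z ((extChartAt 𝓘(ℝ, E) x).symm y) ^ i •
      chartOneForm (L.A i) x y := funext (L.chartOneForm_sumA x)
  rw [this]
  exact ContDiffAt.sum fun i hi ↦ ((T.contDiffAt_chart_z hx).pow i).smul
    ((L.smooth_A i (Finset.mem_range.1 hi)).contDiffAt T.isOpen hx)

theorem eventually_chartOneForm_z {x : M} (hx : x ∈ T.N) :
    ∀ᶠ y in 𝓝 (extChartAt 𝓘(ℝ, E) x x), chartOneForm (mvfderiv 𝓘(ℝ, E) T.z) x y =
      fderiv ℝ (fun y ↦ T.z ((extChartAt 𝓘(ℝ, E) x).symm y)) y := by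
  filter_upwards [extChartAt_target_mem_nhds (I := 𝓘(ℝ, E)) x,
    eventually_extChartAt_symm (T.isOpen.mem_nhds hx)] with y hy hyN
  exact chartOneForm_mvfderiv hy (T.mdifferentiableAt_z hyN)

theorem sumA_of_mem (hm : 1 ≤ m) {x : M} (hx : x ∈ Z) : L.sumA x = L.A 0 x := by
  rw [sumA, Finset.sum_eq_single_of_mem 0 (Finset.mem_range.2 (by omega))]
  · simp
  · intro i _ hi
    simp [T.z_eq x hx, hi]

/-- Two decompositions `z ^ (- 2 m) dz ∧ a + b` of the same form have the same `a` and `b` on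
vectors tangent to `Z`. This passes the nondegeneracy of the `b^{2m}`-form on `Z` to the leading
coefficient and `β`. -/
theorem eq_on_kernel (hm : 1 ≤ m) {a : OneForm E M} {b : TwoForm E M}
    (ha : SmoothOneFormOn T.N a) (hb : SmoothTwoFormOn T.N b)
    (hab : ∀ x ∈ T.N \ Z,
      Ω x = (T.z x ^ (2 * m))⁻¹ • wedge (mvfderiv 𝓘(ℝ, E) T.z x) (a x) + b x)
    {x : M} (hx : x ∈ Z) (hreg : mvfderiv 𝓘(ℝ, E) T.z x ≠ 0) :
    (∀ u, mvfderiv 𝓘(ℝ, E) T.z x u = 0 → a x u = L.A 0 x u) ∧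
    ∀ u u', mvfderiv 𝓘(ℝ, E) T.z x u = 0 → mvfderiv 𝓘(ℝ, E) T.z x u' = 0 →
      b x u u' = L.B x u u' := by
  have hxN := T.subset hx
  have self₁ := fun c : OneForm E M ↦ chartOneForm_self c x
  have self₂ := fun c : TwoForm E M ↦ chartTwoForm_self c x
  have hζx : T.z ((extChartAt 𝓘(ℝ, E) x).symm (extChartAt 𝓘(ℝ, E) x x)) = 0 := by
    rw [extChartAt_to_inv (I := 𝓘(ℝ, E)) x]
    exact T.z_eq x hx
  have hdz' := (eventually_chartOneForm_z hxN).self_of_nhds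
  have hζ : ContDiffAt ℝ ∞ (fun y ↦ T.z ((extChartAt 𝓘(ℝ, E) x).symm y)) (extChartAt 𝓘(ℝ, E) x x) :=
    T.contDiffAt_chart_z hxN
  have haC := (ha.contDiffAt T.isOpen hxN).sub (L.contDiffAt_chart_sumA hxN)
  have hbC := (hb.contDiffAt T.isOpen hxN).sub (L.smooth_B.contDiffAt T.isOpen hxN)
  have hev := (eventually_chartOneForm_z hxN).and
    (eventually_extChartAt_symm (T.isOpen.mem_nhds hxN))
  generalize extChartAt 𝓘(ℝ, E) x x = y₀ at *
  set ζ : E → ℝ := fun y ↦ T.z ((extChartAt 𝓘(ℝ, E) x).symm y) with hζdef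
  replace hζx : ζ y₀ = 0 := hζx
  have hζ1 : ContDiffAt ℝ ∞ (fderiv ℝ ζ) y₀ := hζ.fderiv_right (by simp)
  have hdz : ∀ v : E, fderiv ℝ ζ y₀ v = mvfderiv 𝓘(ℝ, E) T.z x v := fun v ↦ by
    rw [← self₁, hdz']
  have hne : fderiv ℝ ζ y₀ ≠ 0 := fun h ↦ hreg (ContinuousLinearMap.ext fun v ↦ by
    rw [← hdz v, h]; rfl)
  have hζd : HasFDerivAt ζ (fderiv ℝ ζ y₀) y₀ :=
    (hζ.differentiableAt (by simp)).hasFDerivAt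
  let α : E → E →L[ℝ] ℝ := fun y ↦ chartOneForm a x y - chartOneForm L.sumA x y
  let β : E → E →L[ℝ] E →L[ℝ] ℝ := fun y ↦ chartTwoForm b x y - chartTwoForm L.B x y
  have hα : ContinuousAt α y₀ := haC.continuousAt
  have hβ : ContinuousAt β y₀ := hbC.continuousAt
  have hζ1c : ContinuousAt (fderiv ℝ ζ) y₀ := hζ1.continuousAt
  have hζc : ContinuousAt ζ y₀ := hζ.continuousAt
  -- off the hypersurface the two expressions of the form can be compared
  have key : ∀ᶠ y in 𝓝 y₀, ζ y ≠ 0 → ∀ v w : E,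
      fderiv ℝ ζ y v * α y w - fderiv ℝ ζ y w * α y v + ζ y ^ (2 * m) * β y v w = 0 := by
    filter_upwards [hev] with y ⟨hy, hyN⟩ hy0 v w
    have hyZ : (extChartAt 𝓘(ℝ, E) x).symm y ∈ T.N \ Z := ⟨hyN, fun h ↦ hy0 (T.z_eq _ h)⟩
    have h1 := (chartTwoForm_smul_wedge_add (d := mvfderiv 𝓘(ℝ, E) T.z) (hab _ hyZ)).symm.trans
      (chartTwoForm_smul_wedge_add (a := L.sumA) (L.eq_laurent _ hyZ))
    have h2 := DFunLike.congr_fun (DFunLike.congr_fun h1 v) w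
    have hp : ζ y ^ (2 * m) ≠ 0 := pow_ne_zero _ hy0
    rw [hy] at h2
    have h3 : (ζ y ^ (2 * m))⁻¹ * (fderiv ℝ ζ y v * chartOneForm a x y w
        - chartOneForm a x y v * fderiv ℝ ζ y w) + chartTwoForm b x y v w =
      (ζ y ^ (2 * m))⁻¹ * (fderiv ℝ ζ y v * chartOneForm L.sumA x y w
        - chartOneForm L.sumA x y v * fderiv ℝ ζ y w) + chartTwoForm L.B x y v w := by
      simpa only [add_apply, smul_apply, wedge_apply, smul_eq_mul] using h2
    simp only [α, β, sub_apply]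
    field_simp at h3
    linear_combination h3
  obtain ⟨n, hn⟩ : ∃ n, fderiv ℝ ζ y₀ n = 1 := by
    obtain ⟨v, hv⟩ : ∃ v, fderiv ℝ ζ y₀ v ≠ 0 := by
      by_contra! hcon
      exact hne (ContinuousLinearMap.ext hcon)
    exact ⟨(fderiv ℝ ζ y₀ v)⁻¹ • v, by simp [hv]⟩
  have h₁ : ∀ u : E, fderiv ℝ ζ y₀ u = 0 → a x u = L.A 0 x u := by
    intro u hu
    have h := eq_zero_of_eventually_off_zero hζd hne hζx
      (g := fun y ↦ fderiv ℝ ζ y n * α y u - fderiv ℝ ζ y u * α y n + ζ y ^ (2 * m) * β y n u)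
      (by fun_prop) (key.mono fun y hy h ↦ hy h n u)
    simp only [hn, hu, hζx, one_mul, zero_mul, zero_pow (show 2 * m ≠ 0 by omega), add_zero,
      sub_zero, α, sub_apply, self₁, L.sumA_of_mem hm hx] at h
    exact sub_eq_zero.1 h
  have h₂ : ∀ u u' : E, fderiv ℝ ζ y₀ u = 0 → fderiv ℝ ζ y₀ u' = 0 → b x u u' = L.B x u u' := by
    intro u u' hu hu'
    -- the vectors are moved to nearby points inside the kernel of `dz`
    let w : E → E → E := fun u y ↦ fderiv ℝ ζ y n • u - fderiv ℝ ζ y u • n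
    have hw : ∀ u, ContinuousAt (w u) y₀ := fun u ↦ by fun_prop
    have h := eq_zero_of_eventually_off_zero hζd hne hζx
      (g := fun y ↦ β y (w u y) (w u' y)) (((hβ.clm_apply (hw u))).clm_apply (hw u'))
      (key.mono fun y hy h ↦ by
        have h1 := hy h (w u y) (w u' y)
        have h2 : ∀ u, fderiv ℝ ζ y (w u y) = 0 := fun u ↦ by
          simp only [w, map_sub, map_smul, smul_eq_mul]; ring
        rw [h2, h2] at h1
        simpa [h] using h1)
    simp only [w, hn, hu, hu', one_smul, zero_smul, sub_zero, β, sub_apply, self₂] at h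
    exact sub_eq_zero.1 h
  exact ⟨fun u hu ↦ h₁ u ((hdz u).trans hu),
    fun u u' hu hu' ↦ h₂ u u' ((hdz u).trans hu) ((hdz u').trans hu')⟩

end LaurentDecomposition
end Tubular

/-! ### The desingularized form is symplectic -/

section ClosedForms

variable {E : Type*} [NormedAddCommGroup E] [NormedSpace ℝ E]

theorem contDiffAt_wedge {a b : E → E →L[ℝ] ℝ} {y₀ : E} (ha : ContDiffAt ℝ ∞ a y₀)
    (hb : ContDiffAt ℝ ∞ b y₀) : ContDiffAt ℝ ∞ (fun y ↦ wedge (a y) (b y)) y₀ :=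
  (ha.smulRight hb).sub (hb.smulRight ha)

theorem contDiffAt_smul_wedge {c : E → ℝ} {a b : E → E →L[ℝ] ℝ} {y₀ : E}
    (hc : ContDiffAt ℝ ∞ c y₀) (ha : ContDiffAt ℝ ∞ a y₀) (hb : ContDiffAt ℝ ∞ b y₀) :
    ContDiffAt ℝ ∞ (fun y ↦ c y • wedge (a y) (b y)) y₀ := by
  refine (contDiffAt_wedge (hc.smul ha) hb).congr_of_eventuallyEq (.of_forall fun y ↦ ?_)
  ext v w
  simp only [smul_apply, wedge_apply, smul_eq_mul, Pi.smul_apply']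
  ring

/-- If `a` is closed then so is `p(ζ) dζ ∧ a`. -/
theorem closed_smul_wedge_fderiv {p : ℝ → ℝ} {ζ : E → ℝ} {a : E → E →L[ℝ] ℝ} {y₀ : E}
    (hp : ContDiff ℝ ∞ p) (hζ : ContDiffAt ℝ ∞ ζ y₀) (ha : ContDiffAt ℝ ∞ a y₀)
    (hda : ∀ u v, fderiv ℝ a y₀ u v = fderiv ℝ a y₀ v u) (u v w : E) :
    fderiv ℝ (fun y ↦ p (ζ y) • wedge (fderiv ℝ ζ y) (a y)) y₀ u v w +
      fderiv ℝ (fun y ↦ p (ζ y) • wedge (fderiv ℝ ζ y) (a y)) y₀ v w u +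
      fderiv ℝ (fun y ↦ p (ζ y) • wedge (fderiv ℝ ζ y) (a y)) y₀ w u v = 0 := by
  have hζ1 : ContDiffAt ℝ ∞ (fderiv ℝ ζ) y₀ := hζ.fderiv_right (by simp)
  have hpζ : ContDiffAt ℝ ∞ (fun y ↦ p (ζ y)) y₀ := hp.contDiffAt.comp y₀ hζ
  have hτ : DifferentiableAt ℝ (fun y ↦ p (ζ y) • wedge (fderiv ℝ ζ y) (a y)) y₀ :=
    (contDiffAt_smul_wedge hpζ hζ1 ha).differentiableAt (by simp)
  have hsymm : ∀ u v, fderiv ℝ (fderiv ℝ ζ) y₀ u v = fderiv ℝ (fderiv ℝ ζ) y₀ v u :=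
    hζ.isSymmSndFDerivAt (by
      rw [minSmoothness_of_isRCLikeNormedField]
      exact WithTop.coe_le_coe.2 (le_top (a := (2 : ℕ∞))))
  have hpd : HasFDerivAt (fun y ↦ p (ζ y)) (deriv p (ζ y₀) • fderiv ℝ ζ y₀) y₀ :=
    (hp.differentiable (by simp) _).hasDerivAt.comp_hasFDerivAt y₀
      (hζ.differentiableAt (by simp)).hasFDerivAt
  have h1 : ∀ v, HasFDerivAt (fun y ↦ fderiv ℝ ζ y v) ((fderiv ℝ (fderiv ℝ ζ) y₀).flip v) y₀ :=
    fun v ↦ by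
      simpa using (hζ1.differentiableAt (by simp)).hasFDerivAt.clm_apply (hasFDerivAt_const v y₀)
  have h2 : ∀ v, HasFDerivAt (fun y ↦ a y v) ((fderiv ℝ a y₀).flip v) y₀ := fun v ↦ by
    simpa using (ha.differentiableAt (by simp)).hasFDerivAt.clm_apply (hasFDerivAt_const v y₀)
  have key : ∀ u v w, fderiv ℝ (fun y ↦ p (ζ y) • wedge (fderiv ℝ ζ y) (a y)) y₀ u v w =
      p (ζ y₀) * (fderiv ℝ ζ y₀ v * fderiv ℝ a y₀ u w +
        a y₀ w * fderiv ℝ (fderiv ℝ ζ) y₀ u v - (a y₀ v * fderiv ℝ (fderiv ℝ ζ) y₀ u w +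
        fderiv ℝ ζ y₀ w * fderiv ℝ a y₀ u v)) +
      (fderiv ℝ ζ y₀ v * a y₀ w - a y₀ v * fderiv ℝ ζ y₀ w) *
        (deriv p (ζ y₀) * fderiv ℝ ζ y₀ u) := by
    intro u v w
    have e1 := (hτ.hasFDerivAt.clm_apply (hasFDerivAt_const v y₀)).clm_apply
      (hasFDerivAt_const w y₀)
    have e2 := hpd.mul (((h1 v).mul (h2 w)).sub ((h2 v).mul (h1 w)))
    have e3 := e1.unique (e2.congr_of_eventuallyEq (Filter.Eventually.of_forall fun y ↦ by
      simp [wedge]))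
    have e4 := DFunLike.congr_fun e3 u
    simpa using e4
  rw [key, key, key, hsymm v u, hsymm w u, hsymm w v, hda v u, hda w u, hda w v]
  ring

end ClosedForms

section Desingularization

variable {E : Type*} [NormedAddCommGroup E] [NormedSpace ℝ E]
  {M : Type*} [TopologicalSpace M] [ChartedSpace E M]

theorem chartTwoForm_congr {σ τ : TwoForm E M} {x : M} (h : ∀ᶠ x' in 𝓝 x, σ x' = τ x') :
    chartTwoForm σ x =ᶠ[𝓝 (extChartAt 𝓘(ℝ, E) x x)] chartTwoForm τ x := by
  filter_upwards [eventually_extChartAt_symm h] with y hy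
  unfold chartTwoForm
  rw [hy]

theorem TubularNbhd.exists_normal [FiniteDimensional ℝ E] {Z : Set M} (T : TubularNbhd E Z)
    (hreg : ∀ x ∈ Z, mvfderiv 𝓘(ℝ, E) T.z x ≠ 0) {x : M} (hx : x ∈ T.N) :
    ∃ n : TangentSpace 𝓘(ℝ, E) x, mvfderiv 𝓘(ℝ, E) T.z x n = 1 ∧
      mfderiv 𝓘(ℝ, E) 𝓘(ℝ, E) T.proj x n = 0 :=
  T.exists_lift hx (hreg _ (T.proj_mem hx)) 1 0 (map_zero _)

variable [IsManifold 𝓘(ℝ, E) ∞ M] {Z : Set M} {T : TubularNbhd E Z} {m : ℕ} {Ω : TwoForm E M}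

namespace LaurentDecomposition

variable (L : LaurentDecomposition T m Ω)

theorem A_apply_of_proj_eq_zero {i : ℕ} (hi : i < 2 * m) {x : M} (hx : x ∈ T.N)
    {n : TangentSpace 𝓘(ℝ, E) x} (hn : mfderiv 𝓘(ℝ, E) 𝓘(ℝ, E) T.proj x n = 0) :
    L.A i x n = 0 := by
  rw [L.pullback_A i hi x hx, hn, map_zero]

theorem sumA_apply_of_proj_eq_zero {x : M} (hx : x ∈ T.N)
    {n : TangentSpace 𝓘(ℝ, E) x} (hn : mfderiv 𝓘(ℝ, E) 𝓘(ℝ, E) T.proj x n = 0) :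
    L.sumA x n = 0 := by
  rw [sumA_apply]
  exact Finset.sum_eq_zero fun i hi ↦ by
    rw [L.A_apply_of_proj_eq_zero (Finset.mem_range.1 hi) hx hn, mul_zero]

theorem B_apply_left_of_proj_eq_zero {x : M} (hx : x ∈ T.N)
    {n : TangentSpace 𝓘(ℝ, E) x} (hn : mfderiv 𝓘(ℝ, E) 𝓘(ℝ, E) T.proj x n = 0)
    (w : TangentSpace 𝓘(ℝ, E) x) : L.B x n w = 0 := by
  rw [L.pullback_B x hx, hn, map_zero]; rfl

theorem B_apply_right_of_proj_eq_zero {x : M} (hx : x ∈ T.N)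
    {n : TangentSpace 𝓘(ℝ, E) x} (hn : mfderiv 𝓘(ℝ, E) 𝓘(ℝ, E) T.proj x n = 0)
    (w : TangentSpace 𝓘(ℝ, E) x) : L.B x w n = 0 := by
  rw [L.pullback_B x hx, hn, map_zero]

theorem laurent_eq {x : M} (hx : x ∈ T.N \ Z) :
    Ω x = (T.z x ^ (2 * m))⁻¹ • wedge (mvfderiv 𝓘(ℝ, E) T.z x) (L.sumA x) + L.B x :=
  L.eq_laurent x hx

/-- The formula for the form on the tube holds in the whole tubular neighbourhood, because the
derivative of the rescaled function is `s ^ (- 2 m)` for `|s| ≥ ε`. -/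
theorem desingularization_eq_of_mem {f : ℝ → ℝ} (hf : IsDesingularizingFunction m f) (hm : 1 ≤ m)
    {ε : ℝ} (hε : 0 < ε) {x : M} (hx : x ∈ T.N) :
    L.desingularization f ε x = deriv (rescale m f ε) (T.z x) •
      wedge (mvfderiv 𝓘(ℝ, E) T.z x) (L.sumA x) + L.B x := by
  unfold desingularization
  split_ifs with h
  · rw [T.mvfderiv_comp_z ((hf.contDiff_rescale ε).differentiable (by simp) _).hasDerivAt hx]
    ext v w
    change wedge _ (L.sumA x) v w + L.B x v w = _
    simp only [wedge_apply, add_apply, smul_apply, smul_eq_mul]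
    ring
  · have hz : ε ≤ |T.z x| := not_lt.1 fun h' ↦ h ⟨hx, h'⟩
    have hxZ : x ∉ Z := fun hxZ ↦ by
      rw [T.z_eq x hxZ, abs_zero] at hz
      linarith
    rw [L.laurent_eq ⟨hx, hxZ⟩, hf.deriv_rescale_of_le hm hε hz]

theorem desingularization_eq_of_notMem {f : ℝ → ℝ} {ε : ℝ} {x : M} (hx : x ∉ T.tube ε) :
    L.desingularization f ε x = Ω x := if_neg hx

/-- The leading coefficient and `β` form a cosymplectic structure on `Z`. -/
theorem nondegenerate_on_hypersurface (hm : 1 ≤ m) (hΩ : IsBSymplectic (2 * m) Z T.N T.z Ω)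
    {x : M} (hx : x ∈ Z) (s : ℝ) (u : TangentSpace 𝓘(ℝ, E) x)
    (hu : mvfderiv 𝓘(ℝ, E) T.z x u = 0)
    (h : ∀ (s' : ℝ) (u' : TangentSpace 𝓘(ℝ, E) x), mvfderiv 𝓘(ℝ, E) T.z x u' = 0 →
      s * L.A 0 x u' - s' * L.A 0 x u + L.B x u u' = 0) : s = 0 ∧ u = 0 := by
  obtain ⟨a, b, ha, hb, -, hab, hnd⟩ := hΩ.singular
  obtain ⟨h1, h2⟩ := L.eq_on_kernel hm ha hb hab hx (hΩ.isDefiningFunction.regular x hx)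
  exact hnd x hx s u hu fun s' u' hu' ↦ by
    rw [h1 u hu, h1 u' hu', h2 u u' hu hu']
    exact h s' u' hu'

theorem exists_isReebVector [FiniteDimensional ℝ E] (hm : 1 ≤ m)
    (hΩ : IsBSymplectic (2 * m) Z T.N T.z Ω) {x : M} (hx : x ∈ T.N) : ∃ R, L.IsReebVector x R := by
  have hq := T.proj_mem hx
  have hqN := T.subset hq
  have hreg := hΩ.isDefiningFunction.regular
  have hfin : FiniteDimensional ℝ (TangentSpace 𝓘(ℝ, E) (T.proj x)) :=
    inferInstanceAs (FiniteDimensional ℝ E)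
  obtain ⟨u, hu, hau, hbu⟩ : ∃ u : TangentSpace 𝓘(ℝ, E) (T.proj x),
      mvfderiv 𝓘(ℝ, E) T.z (T.proj x) u = 0 ∧ L.A 0 (T.proj x) u = 1 ∧
      ∀ u', mvfderiv 𝓘(ℝ, E) T.z (T.proj x) u' = 0 → L.B (T.proj x) u u' = 0 := by
    let ζ : E →ₗ[ℝ] ℝ := (mvfderiv 𝓘(ℝ, E) T.z (T.proj x)).toLinearMap
    let a : E →ₗ[ℝ] ℝ := (L.A 0 (T.proj x)).toLinearMap
    let b : E →ₗ[ℝ] E →ₗ[ℝ] ℝ := LinearMap.mk₂ ℝ (fun v w ↦ L.B (T.proj x) v w)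
      (fun v v' w ↦ by
        exact congrArg (fun l : TangentSpace 𝓘(ℝ, E) (T.proj x) →L[ℝ] ℝ ↦ l w)
          (map_add (L.B (T.proj x)) v v'))
      (fun c v w ↦ by
        exact congrArg (fun l : TangentSpace 𝓘(ℝ, E) (T.proj x) →L[ℝ] ℝ ↦ l w)
          (map_smul (L.B (T.proj x)) c v))
      (fun v w w' ↦ map_add (L.B (T.proj x) v) w w')
      (fun c v w ↦ map_smul (L.B (T.proj x) v) c w)
    exact exists_reeb_of_nondegenerate ζ a b (L.alternating_B _ hqN)
      (L.nondegenerate_on_hypersurface hm hΩ hq)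
  obtain ⟨R, hR, hPR⟩ := T.exists_lift hx (hreg _ hq) 0 u hu
  refine ⟨R, hR, ?_, fun w ↦ ?_⟩
  · rw [L.pullback_A 0 (by omega) x hx, hPR, hau]
  · rw [L.pullback_B x hx, hPR]
    exact hbu _ (T.mvfderiv_z_mfderiv_proj hx w)

/-- In `dz / z ^ (2 m) ∧ ∑ z ^ i π^* α_i + π^* β` the coefficient `z ^ (- 2 m)` may be replaced by
any nonzero number. On `Z` this is the nondegeneracy of the `b^{2m}`-form there. -/
theorem nondegenerate_smul_wedge_add [FiniteDimensional ℝ E] (hm : 1 ≤ m)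
    (hΩ : IsBSymplectic (2 * m) Z T.N T.z Ω) {x : M} (hx : x ∈ T.N) {c : ℝ} (hc : c ≠ 0)
    {v : TangentSpace 𝓘(ℝ, E) x}
    (hv : ∀ w, (c • wedge (mvfderiv 𝓘(ℝ, E) T.z x) (L.sumA x) + L.B x) v w = 0) : v = 0 := by
  obtain ⟨n, hn, hPn⟩ := T.exists_normal hΩ.isDefiningFunction.regular hx
  by_cases hxZ : x ∈ Z
  · -- split `v` into its normal part and a vector tangent to `Z`
    have hv' : ∀ w, c * (mvfderiv 𝓘(ℝ, E) T.z x v * L.A 0 x w -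
        L.A 0 x v * mvfderiv 𝓘(ℝ, E) T.z x w) + L.B x v w = 0 := fun w ↦ by
      have := hv w
      rw [L.sumA_of_mem hm hxZ] at this
      simpa using this
    have hAn : L.A 0 x n = 0 := L.A_apply_of_proj_eq_zero (by omega) hx hPn
    have hAv : L.A 0 x v = 0 := by
      have := hv' n
      rw [hAn, hn, L.B_apply_right_of_proj_eq_zero hx hPn] at this
      have : c * L.A 0 x v = 0 := by linarith
      simpa [hc] using this
    obtain ⟨h1, h2⟩ := L.nondegenerate_on_hypersurface hm hΩ hxZ
      (c * mvfderiv 𝓘(ℝ, E) T.z x v) (v - mvfderiv 𝓘(ℝ, E) T.z x v • n) (by simp [hn])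
      fun s' u' hu' ↦ by
        have := hv' u'
        rw [hu'] at this
        simp only [map_sub, map_smul, sub_apply, smul_apply, hAn, hAv,
          L.B_apply_left_of_proj_eq_zero hx hPn, smul_eq_mul]
        linarith
    have h3 : mvfderiv 𝓘(ℝ, E) T.z x v = 0 := by simpa [hc] using h1
    simpa [h3] using h2
  · have hz : (T.z x ^ (2 * m))⁻¹ ≠ 0 :=
      inv_ne_zero (pow_ne_zero _ fun h ↦ hxZ ((T.z_eq_zero_iff hx).1 h))
    refine nondegenerate_of_smul_wedge_add hz hc hn (L.sumA_apply_of_proj_eq_zero hx hPn)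
      (L.B_apply_left_of_proj_eq_zero hx hPn) (L.B_apply_right_of_proj_eq_zero hx hPn) ?_ hv
    rw [← L.laurent_eq ⟨hx, hxZ⟩]
    exact hΩ.symplectic.nondegenerate x hxZ

theorem chartTwoForm_desingularization {f : ℝ → ℝ} (hf : IsDesingularizingFunction m f)
    (hm : 1 ≤ m) {ε : ℝ} (hε : 0 < ε) {x : M} (hx : x ∈ T.N) :
    chartTwoForm (L.desingularization f ε) x =ᶠ[𝓝 (extChartAt 𝓘(ℝ, E) x x)] fun y ↦
      ∑ i ∈ Finset.range (2 * m),
        (fun s ↦ deriv (rescale m f ε) s * s ^ i) (T.z ((extChartAt 𝓘(ℝ, E) x).symm y)) •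
        wedge (fderiv ℝ (fun y ↦ T.z ((extChartAt 𝓘(ℝ, E) x).symm y)) y) (chartOneForm (L.A i) x y)
      + chartTwoForm L.B x y := by
  filter_upwards [eventually_chartOneForm_z hx,
    eventually_extChartAt_symm (T.isOpen.mem_nhds hx)] with y hy hyN
  rw [chartTwoForm_smul_wedge_add (d := mvfderiv 𝓘(ℝ, E) T.z) (a := L.sumA)
    (L.desingularization_eq_of_mem hf hm hε hyN), hy, L.chartOneForm_sumA]
  congr 1
  ext v w
  simp only [smul_apply, wedge_apply, sum_apply, smul_eq_mul, Finset.mul_sum, Finset.sum_mul,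
    ← Finset.sum_sub_distrib]
  exact Finset.sum_congr rfl fun i _ ↦ by ring

/-- The desingularization is symplectic as soon as the tube in which the form is changed stays away
from the boundary of the tubular neighbourhood. -/
theorem isSymplecticOn_desingularization [FiniteDimensional ℝ E] {f : ℝ → ℝ}
    (hf : IsDesingularizingFunction m f) (hm : 1 ≤ m) (hΩ : IsBSymplectic (2 * m) Z T.N T.z Ω)
    {ε : ℝ} (hε : 0 < ε) (hcl : closure (T.tube ε) ⊆ T.N) :
    IsSymplecticOn univ (L.desingularization f ε) := by
  have hout : ∀ x ∉ T.N, x ∈ Zᶜ ∧ ∀ᶠ x' in 𝓝 x, L.desingularization f ε x' = Ω x' := by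
    refine fun x hx ↦ ⟨fun h ↦ hx (T.subset h), ?_⟩
    filter_upwards [isClosed_closure.isOpen_compl.mem_nhds fun h ↦ hx (hcl h)] with x' hx'
    exact L.desingularization_eq_of_notMem fun h ↦ hx' (subset_closure h)
  have hp : ∀ i : ℕ, ContDiff ℝ ∞ fun s ↦ deriv (rescale m f ε) s * s ^ i := fun i ↦
    (contDiff_infty_iff_deriv.1 (hf.contDiff_rescale ε)).2.mul (contDiff_id.pow i)
  have hterm : ∀ x ∈ T.N, ∀ i ∈ Finset.range (2 * m), ContDiffAt ℝ ∞ (fun y ↦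
      (fun s ↦ deriv (rescale m f ε) s * s ^ i) (T.z ((extChartAt 𝓘(ℝ, E) x).symm y)) •
        wedge (fderiv ℝ (fun y ↦ T.z ((extChartAt 𝓘(ℝ, E) x).symm y)) y) (chartOneForm (L.A i) x y))
      (extChartAt 𝓘(ℝ, E) x x) := fun x hx i hi ↦
    contDiffAt_smul_wedge ((hp i).contDiffAt.comp _ (T.contDiffAt_chart_z hx))
      ((T.contDiffAt_chart_z hx).fderiv_right (by simp))
      ((L.smooth_A i (Finset.mem_range.1 hi)).contDiffAt T.isOpen hx)
  refine ⟨fun x _ ↦ ?_, fun x _ v ↦ ?_, fun x _ u v w ↦ ?_, fun x _ v hv ↦ ?_⟩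
  · rw [contMDiffWithinAt_univ]
    refine smoothTwoFormAt_iff.2 ?_
    by_cases hx : x ∈ T.N
    · refine ContDiffAt.congr_of_eventuallyEq ?_ (L.chartTwoForm_desingularization hf hm hε hx)
      exact (ContDiffAt.sum (hterm x hx)).add (L.smooth_B.contDiffAt T.isOpen hx)
    · obtain ⟨hxZ, hx'⟩ := hout x hx
      exact (hΩ.symplectic.smooth.contDiffAt hΩ.isDefiningFunction.isClosed.isOpen_compl
        hxZ).congr_of_eventuallyEq (chartTwoForm_congr hx')
  · by_cases hx : x ∈ T.N
    · rw [L.desingularization_eq_of_mem hf hm hε hx]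
      simp [L.alternating_B x hx, mul_comm]
    · obtain ⟨hxZ, hx'⟩ := hout x hx
      rw [hx'.self_of_nhds]
      exact hΩ.symplectic.alternating x hxZ v
  · by_cases hx : x ∈ T.N
    · have hB : DifferentiableAt ℝ (chartTwoForm L.B x) (extChartAt 𝓘(ℝ, E) x x) :=
        (L.smooth_B.contDiffAt T.isOpen hx).differentiableAt (by simp)
      have hA := fun i hi ↦ (hterm x hx i hi).differentiableAt (by simp)
      rw [(L.chartTwoForm_desingularization hf hm hε hx).fderiv_eq,
        fderiv_fun_add (DifferentiableAt.fun_sum hA) hB, fderiv_fun_sum hA]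
      have h1 := L.closed_B x hx u v w
      have h2 : ∀ i ∈ Finset.range (2 * m), _ := fun i hi ↦ closed_smul_wedge_fderiv (hp i)
        (T.contDiffAt_chart_z hx)
        ((L.smooth_A i (Finset.mem_range.1 hi)).contDiffAt T.isOpen hx)
        (L.closed_A i (Finset.mem_range.1 hi) x hx) u v w
      have h3 := Finset.sum_eq_zero h2
      simp only [Finset.sum_add_distrib] at h3
      simp only [add_apply, sum_apply]
      linear_combination h1 + h3
    · obtain ⟨hxZ, hx'⟩ := hout x hx
      rw [(chartTwoForm_congr hx').fderiv_eq]
      exact hΩ.symplectic.closed x hxZ u v w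
  · by_cases hx : x ∈ T.N
    · rw [L.desingularization_eq_of_mem hf hm hε hx] at hv
      exact L.nondegenerate_smul_wedge_add hm hΩ hx (hf.deriv_rescale_pos hm hε _).ne' hv
    · obtain ⟨hxZ, hx'⟩ := hout x hx
      rw [hx'.self_of_nhds] at hv
      exact hΩ.symplectic.nondegenerate x hxZ v hv

end LaurentDecomposition
end Desingularization

/-! ### Hamiltonian vector fields -/

section HamiltonianField

variable {E : Type*} [NormedAddCommGroup E] [NormedSpace ℝ E] [FiniteDimensional ℝ E]

theorem isInvertible_of_nondegenerate {σ : E →L[ℝ] E →L[ℝ] ℝ}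
    (h : ∀ v, (∀ w, σ v w = 0) → v = 0) : σ.IsInvertible := by
  have hinj : Function.Injective σ.toLinearMap := (injective_iff_map_eq_zero _).2 fun v hv ↦
    h v fun w ↦ DFunLike.congr_fun hv w
  have hfin : Module.finrank ℝ E = Module.finrank ℝ (E →L[ℝ] ℝ) := by
    rw [← (LinearMap.toContinuousLinearMap (𝕜 := ℝ) (E := E) (F' := ℝ)).finrank_eq]
    exact Subspace.dual_finrank_eq.symm
  exact ⟨(σ.toLinearMap.linearEquivOfInjective hinj hfin).toContinuousLinearEquiv, by ext; rfl⟩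

variable {M : Type*} [TopologicalSpace M] [ChartedSpace E M] [IsManifold 𝓘(ℝ, E) ∞ M]

theorem isInvertible_chartTwoForm {σ : TwoForm E M}
    (hσ : ∀ x, ∀ v, (∀ w, σ x v w = 0) → v = 0) {x : M} {y : E}
    (hy : y ∈ (extChartAt 𝓘(ℝ, E) x).target) : (chartTwoForm σ x y).IsInvertible := by
  refine isInvertible_of_nondegenerate fun v hv ↦ ?_
  have h0 : chartFrame x y v = 0 := hσ ((extChartAt 𝓘(ℝ, E) x).symm y) _ fun w ↦
    (congrArg (σ _ (chartFrame x y v)) (chartFrame_comp_mfderiv hy w)).symm.trans (hv _)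
  rw [← mfderiv_comp_chartFrame hy v, h0]
  exact map_zero _

/-- The Hamiltonian vector field of a smooth time-dependent function for a symplectic form exists
and is smooth in all variables. -/
theorem exists_smooth_hamiltonianField {σ : TwoForm E M} (hσ : IsSymplecticOn univ σ)
    {H : ℝ → M → ℝ} (hH : SmoothPeriodicOn E univ H) :
    ∃ X : ℝ → ∀ x : M, TangentSpace 𝓘(ℝ, E) x,
      ContMDiff (𝓘(ℝ, ℝ).prod 𝓘(ℝ, E)) 𝓘(ℝ, E).tangent ∞
        (fun p : ℝ × M ↦ (⟨p.2, X p.1 p.2⟩ : TangentBundle 𝓘(ℝ, E) M)) ∧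
      IsHamiltonianFieldOn univ σ H X := by
  have hnd : ∀ x, ∀ v, (∀ w, σ x v w = 0) → v = 0 := fun x ↦ hσ.nondegenerate x (mem_univ x)
  have hex : ∀ (t : ℝ) (x : M), ∃ v : TangentSpace 𝓘(ℝ, E) x,
      ∀ w, σ x v w = - mvfderiv 𝓘(ℝ, E) (H t) x w := by
    intro t x
    let s : E →L[ℝ] E →L[ℝ] ℝ := σ x
    obtain ⟨e, he⟩ := isInvertible_of_nondegenerate (σ := s) (hnd x)
    let η : E →L[ℝ] ℝ := mvfderiv 𝓘(ℝ, E) (H t) x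
    have key : ∀ w, s (e.symm (-η)) w = -η w := fun w ↦ by
      rw [← he]; simp
    exact ⟨e.symm (-η), key⟩
  choose X hX using hex
  have hHs : ∀ p : ℝ × M, ContMDiffAt (𝓘(ℝ, ℝ).prod 𝓘(ℝ, E)) 𝓘(ℝ, ℝ) ∞
      (fun p : ℝ × M ↦ H p.1 p.2) p := fun p ↦
    hH.1.contMDiffAt (by rw [univ_prod_univ]; exact Filter.univ_mem)
  have hHd : ∀ t x, MDifferentiableAt 𝓘(ℝ, E) 𝓘(ℝ, ℝ) (H t) x := fun t x ↦
    ((hHs (t, x)).comp x (contMDiffAt_const.prodMk contMDiffAt_id)).mdifferentiableAt (by simp)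
  refine ⟨X, fun ⟨t₀, x₀⟩ ↦ contMDiffAt_vectorField ?_, fun t x _ v ↦ hX t x v⟩
  have hHc := contMDiffAt_prod_iff_chart.1 (hHs (t₀, x₀))
  have hσc := hσ.smooth.contDiffAt isOpen_univ (mem_univ x₀)
  have hinv := isInvertible_chartTwoForm hnd (mem_extChartAt_target (I := 𝓘(ℝ, E)) x₀)
  have hev : ∀ᶠ p : ℝ × E in 𝓝 (t₀, extChartAt 𝓘(ℝ, E) x₀ x₀),
      p.2 ∈ (extChartAt 𝓘(ℝ, E) x₀).target :=
    continuousAt_snd.eventually (extChartAt_target_mem_nhds (I := 𝓘(ℝ, E)) x₀)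
  have h1 : ContDiffAt ℝ ∞ (fun p : ℝ × E ↦ fderiv ℝ
      (fun y ↦ H p.1 ((extChartAt 𝓘(ℝ, E) x₀).symm y)) p.2) (t₀, extChartAt 𝓘(ℝ, E) x₀ x₀) := by
    refine ContDiffAt.fderiv (n := ∞)
      (f := fun (p : ℝ × E) (y : E) ↦ H p.1 ((extChartAt 𝓘(ℝ, E) x₀).symm y)) ?_
      contDiffAt_snd (by simp)
    exact ContDiffAt.comp (g := fun p : ℝ × E ↦ H p.1 ((extChartAt 𝓘(ℝ, E) x₀).symm p.2))
      (f := fun q : (ℝ × E) × E ↦ (q.1.1, q.2)) _ hHc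
      ((contDiff_fst.comp contDiff_fst).prodMk contDiff_snd).contDiffAt
  have h2 : ContDiffAt ℝ ∞ (fun p : ℝ × E ↦ (chartTwoForm σ x₀ p.2).inverse)
      (t₀, extChartAt 𝓘(ℝ, E) x₀ x₀) :=
    ContDiffAt.comp
      (g := (ContinuousLinearMap.inverse : (E →L[ℝ] E →L[ℝ] ℝ) → ((E →L[ℝ] ℝ) →L[ℝ] E)))
      (t₀, extChartAt 𝓘(ℝ, E) x₀ x₀) hinv.contDiffAt_map_inverse
      (ContDiffAt.comp (g := chartTwoForm σ x₀) (f := fun p : ℝ × E ↦ p.2)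
        (t₀, extChartAt 𝓘(ℝ, E) x₀ x₀) hσc contDiffAt_snd)
  refine (h2.clm_apply h1.neg).congr_of_eventuallyEq ?_
  filter_upwards [hev] with p hp
  obtain ⟨e, he⟩ := isInvertible_chartTwoForm hnd hp
  rw [← he, ContinuousLinearMap.inverse_equiv]
  refine (ContinuousLinearEquiv.eq_symm_apply e).2 ?_
  have hee : ∀ v, e v = chartTwoForm σ x₀ p.2 v := fun v ↦ by rw [← he]; rfl
  ext w
  refine (DFunLike.congr_fun (hee _) w).trans ?_
  refine (congrArg (fun v : TangentSpace 𝓘(ℝ, E) ((extChartAt 𝓘(ℝ, E) x₀).symm p.2) ↦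
    σ _ v (chartFrame x₀ p.2 w)) (chartFrame_comp_mfderiv hp _)).trans ?_
  refine (hX _ _ _).trans ?_
  rw [← chartOneForm_mvfderiv hp (hHd _ _)]
  rfl

end HamiltonianField

section Transfer

variable {E : Type*} [NormedAddCommGroup E] [NormedSpace ℝ E] [FiniteDimensional ℝ E]
  {M : Type*} [TopologicalSpace M] [ChartedSpace E M] [IsManifold 𝓘(ℝ, E) ∞ M]
  {Z : Set M} {T : TubularNbhd E Z} {m : ℕ} {Ω : TwoForm E M}

/-- If `η` takes the value `k` on `X^σ` and vanishes on the Reeb vector, replacing `k z ^ (- 2 m)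
dz` by `k c dz` in `η` is the same change of coefficient as replacing `z ^ (- 2 m)` by `c` in `Ω`,
and the Hamiltonian vector stays the same. -/
theorem LaurentDecomposition.hamiltonian_of_desingularized (L : LaurentDecomposition T m Ω)
    (hm : 1 ≤ m) (hΩ : IsBSymplectic (2 * m) Z T.N T.z Ω) {x : M} (hx : x ∈ T.N \ Z)
    {η : TangentSpace 𝓘(ℝ, E) x →L[ℝ] ℝ} {k c : ℝ} (hc : c ≠ 0)
    (hnormal : ∀ v, T.IsNormalVector m x v → η v = k) (hreeb : ∀ v, L.IsReebVector x v → η v = 0)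
    {X : TangentSpace 𝓘(ℝ, E) x}
    (hX : ∀ w, (c • wedge (mvfderiv 𝓘(ℝ, E) T.z x) (L.sumA x) + L.B x) X w =
      -(c * k * mvfderiv 𝓘(ℝ, E) T.z x w +
        (η w - (T.z x ^ (2 * m))⁻¹ * k * mvfderiv 𝓘(ℝ, E) T.z x w))) (w) :
    Ω x X w = - η w := by
  obtain ⟨n, hn, hPn⟩ := T.exists_normal hΩ.isDefiningFunction.regular hx.1
  obtain ⟨R, hR⟩ := L.exists_isReebVector hm hΩ hx.1
  have hz : T.z x ^ (2 * m) ≠ 0 := pow_ne_zero _ fun h ↦ hx.2 ((T.z_eq_zero_iff hx.1).1 h)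
  have hηn : T.z x ^ (2 * m) * η n = k := by
    have := hnormal (T.z x ^ (2 * m) • n) ⟨by simp [hn], by simp [hPn]⟩
    simpa using this
  have h := hamiltonian_of_smul_wedge_add (c₀ := (T.z x ^ (2 * m))⁻¹) (k := k)
    (A := L.sumA x) (A₀ := L.A 0 x) (B := L.B x)
    (g := η - ((T.z x ^ (2 * m))⁻¹ * k) • mvfderiv 𝓘(ℝ, E) T.z x) hc hn
    (L.sumA_apply_of_proj_eq_zero hx.1 hPn) (L.alternating_B x hx.1)
    (L.B_apply_right_of_proj_eq_zero hx.1 hPn)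
    (by simp only [sub_apply, smul_apply, hn, smul_eq_mul, ← hηn]; field_simp; ring) hR.1 hR.2.1
    hR.2.2 (by simp [hreeb R hR, hR.1])
    (by rw [← L.laurent_eq hx]; exact hΩ.symplectic.nondegenerate x hx.2) hX w
  rw [← L.laurent_eq hx] at h
  rw [h]
  simp

end Transfer

/-! ### Coordinates adapted to the hypersurface -/

section Straightening

variable {E : Type*} [NormedAddCommGroup E] [NormedSpace ℝ E] [FiniteDimensional ℝ E]

/-- The inverse function theorem, with smoothness of the inverse on a whole ball. -/
theorem exists_smooth_localInverse {F : E → E} {O : Set E} {y₀ : E} (hO : O ∈ 𝓝 y₀)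
    (hF : ∀ y ∈ O, ContDiffAt ℝ ∞ F y) (hinj : ∀ u, fderiv ℝ F y₀ u = 0 → u = 0) :
    ∃ (g : E → E) (r : ℝ), 0 < r ∧ g (F y₀) = y₀ ∧ ContDiffOn ℝ ∞ g (Metric.ball (F y₀) r) ∧
      (∀ w ∈ Metric.ball (F y₀) r, g w ∈ O ∧ F (g w) = w) ∧ ∀ᶠ y in 𝓝 y₀, g (F y) = y := by
  have hF₀ := hF y₀ (mem_of_mem_nhds hO)
  let f' : E ≃L[ℝ] E := (LinearEquiv.ofInjectiveEndo (fderiv ℝ F y₀).toLinearMap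
    ((injective_iff_map_eq_zero _).2 hinj)).toContinuousLinearEquiv
  have hf' : (f' : E →L[ℝ] E) = fderiv ℝ F y₀ := by ext; rfl
  have hd : HasFDerivAt F (f' : E →L[ℝ] E) y₀ := by
    rw [hf']; exact (hF₀.differentiableAt (by simp)).hasFDerivAt
  let e := hF₀.toOpenPartialHomeomorph F hd (by simp)
  have he : ∀ y, e y = F y := fun y ↦ rfl
  have hy₀ : y₀ ∈ e.source := hF₀.mem_toOpenPartialHomeomorph_source hd (by simp)
  have hFy₀ : F y₀ ∈ e.target := e.map_source hy₀
  have hsymm : e.symm (F y₀) = y₀ := e.left_inv hy₀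
  have hinv : ∀ᶠ y in 𝓝 y₀, fderiv ℝ F y ∈ range ((↑) : (E ≃L[ℝ] E) → E →L[ℝ] E) := by
    have hc : ContinuousAt (fderiv ℝ F) y₀ := (hF₀.fderiv_right (m := ∞) (by simp)).continuousAt
    refine hc.eventually ?_
    rw [← hf']
    exact f'.nhds
  have hcs : ContinuousAt e.symm (F y₀) := e.continuousAt_symm hFy₀
  have hgood : ∀ᶠ w in 𝓝 (F y₀), w ∈ e.target ∧ e.symm w ∈ O ∧
      fderiv ℝ F (e.symm w) ∈ range ((↑) : (E ≃L[ℝ] E) → E →L[ℝ] E) := by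
    refine Filter.Eventually.and (e.open_target.mem_nhds hFy₀) (hcs.eventually (p := fun y ↦
      y ∈ O ∧ fderiv ℝ F y ∈ range ((↑) : (E ≃L[ℝ] E) → E →L[ℝ] E)) ?_)
    rw [hsymm]
    exact Filter.Eventually.and hO hinv
  obtain ⟨r, hr, hball⟩ := Metric.eventually_nhds_iff_ball.1 hgood
  refine ⟨e.symm, r, hr, hsymm, fun w hw ↦ ?_, fun w hw ↦ ?_, ?_⟩
  · obtain ⟨hw1, hw2, f'', hf''⟩ := hball w hw
    refine (e.contDiffAt_symm (f₀' := f'') hw1 ?_ (hF _ hw2)).contDiffWithinAt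
    rw [hf'']
    exact ((hF _ hw2).differentiableAt (by simp)).hasFDerivAt
  · exact ⟨(hball w hw).2.1, e.right_inv (hball w hw).1⟩
  · filter_upwards [e.open_source.mem_nhds hy₀] with y hy using e.left_inv hy

variable {M : Type*} [TopologicalSpace M] [ChartedSpace E M] [IsManifold 𝓘(ℝ, E) ∞ M]
  {Z : Set M}

namespace TubularNbhd

/-- Coordinates around a point `p` of `Z` in which `z` is a linear function and, along `Z`, the
fibres of the projection are parallel lines. -/
theorem exists_straightening (T : TubularNbhd E Z) {p : M} (hp : p ∈ Z)
    (hreg : mvfderiv 𝓘(ℝ, E) T.z p ≠ 0) :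
    ∃ (l : E →L[ℝ] ℝ) (v : E) (θ : E → M) (r : ℝ) (κ : M → E), l v = 1 ∧ θ 0 = p ∧ 0 < r ∧
      ContMDiffOn 𝓘(ℝ, E) 𝓘(ℝ, E) ∞ θ (Metric.ball 0 r) ∧
      (∀ w ∈ Metric.ball 0 r, θ w ∈ T.N ∧ T.z (θ w) = l w) ∧
      (∀ ρ > 0, θ '' Metric.ball 0 ρ ∈ 𝓝 p) ∧ ContinuousAt κ p ∧ κ p = 0 ∧
      (∀ q, l (κ q) = 0) ∧
      ∀ᶠ sq : ℝ × M in 𝓝 (0, p), sq.2 ∈ Z → T.proj (θ (κ sq.2 + sq.1 • v)) = sq.2 := by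
  have hpN := T.subset hp
  have hpp := T.proj_eq p hp
  set φ := extChartAt 𝓘(ℝ, E) p with hφ
  set y₀ := φ p with hy₀
  have hy₀p : φ.symm y₀ = p := extChartAt_to_inv (I := 𝓘(ℝ, E)) p
  let ζ : E → ℝ := fun y ↦ T.z (φ.symm y)
  let P : E → E := fun y ↦ φ (T.proj (φ.symm y))
  have hζ₀ : ζ y₀ = 0 := by simp only [ζ, hy₀p]; exact T.z_eq p hp
  have hP₀ : P y₀ = y₀ := by simp only [P]; rw [hy₀p, hpp]
  -- the domain on which everything is smooth
  let O : Set E := {y | y ∈ φ.target ∧ φ.symm y ∈ T.N ∧ T.proj (φ.symm y) ∈ φ.source}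
  have hO : O ∈ 𝓝 y₀ := by
    have h1 : ∀ᶠ y in 𝓝 y₀, φ.symm y ∈ T.N :=
      eventually_extChartAt_symm (T.isOpen.mem_nhds hpN)
    have h2 : ∀ᶠ x in 𝓝 p, T.proj x ∈ φ.source := by
      refine (T.contMDiffAt_proj hpN).continuousAt.eventually ?_
      rw [hpp]
      exact extChartAt_source_mem_nhds p
    have h3 : ∀ᶠ y in 𝓝 y₀, T.proj (φ.symm y) ∈ φ.source := eventually_extChartAt_symm h2
    exact Filter.Eventually.and (extChartAt_target_mem_nhds (I := 𝓘(ℝ, E)) p) (h1.and h3)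
  have hsymmC : ∀ y ∈ O, ContMDiffAt 𝓘(ℝ, E) 𝓘(ℝ, E) ∞ φ.symm y := fun y hy ↦
    (contMDiffOn_extChartAt_symm (n := ∞) p).contMDiffAt (extChartAt_target_mem_nhds' hy.1)
  have hζC : ∀ y ∈ O, ContDiffAt ℝ ∞ ζ y := fun y hy ↦ contMDiffAt_iff_contDiffAt.1
    ((T.contMDiffAt_z hy.2.1).comp y (hsymmC y hy))
  have hPC : ∀ y ∈ O, ContDiffAt ℝ ∞ P y := fun y hy ↦ contMDiffAt_iff_contDiffAt.1
    ((contMDiffAt_extChartAt' (by simpa [hφ] using hy.2.2)).comp y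
      ((T.contMDiffAt_proj hy.2.1).comp y (hsymmC y hy)))
  have hO₀ : y₀ ∈ O := mem_of_mem_nhds hO
  let l : E →L[ℝ] ℝ := fderiv ℝ ζ y₀
  have hζd : HasFDerivAt ζ l y₀ := ((hζC y₀ hO₀).differentiableAt (by simp)).hasFDerivAt
  have hPd : HasFDerivAt P (fderiv ℝ P y₀) y₀ :=
    ((hPC y₀ hO₀).differentiableAt (by simp)).hasFDerivAt
  have hl : ∀ u : E, l u = mvfderiv 𝓘(ℝ, E) T.z p u := fun u ↦
    (DFunLike.congr_fun
      (LaurentDecomposition.eventually_chartOneForm_z hpN).self_of_nhds u).symm.trans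
      (chartOneForm_self (mvfderiv 𝓘(ℝ, E) T.z) p u)
  have hDP : ∀ u : E, fderiv ℝ P y₀ u = mfderiv 𝓘(ℝ, E) 𝓘(ℝ, E) T.proj p u := fun u ↦ by
    have h1 : fderivWithin ℝ (writtenInExtChartAt 𝓘(ℝ, E) 𝓘(ℝ, E) p T.proj)
        (range 𝓘(ℝ, E)) (extChartAt 𝓘(ℝ, E) p p) = fderiv ℝ P y₀ := by
      simp only [writtenInExtChartAt, modelWithCornersSelf_coe, range_id, fderivWithin_univ, hpp]
      rfl
    have h2 : (mfderiv 𝓘(ℝ, E) 𝓘(ℝ, E) T.proj p : E →L[ℝ] E) = fderiv ℝ P y₀ :=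
      (T.mdifferentiableAt_proj hpN).mfderiv.trans h1
    exact (DFunLike.congr_fun h2 u).symm
  obtain ⟨v, hv⟩ : ∃ v, l v = 1 := by
    obtain ⟨u, hu⟩ : ∃ u, l u ≠ 0 := by
      by_contra! hcon
      exact hreg (ContinuousLinearMap.ext fun u ↦ (hl u).symm.trans (hcon u))
    exact ⟨(l u)⁻¹ • u, by simp [hu]⟩
  have hlP : ∀ u, l (fderiv ℝ P y₀ u) = 0 := by
    have h1 : HasFDerivAt (fun y ↦ ζ (P y)) (l.comp (fderiv ℝ P y₀)) y₀ :=
      HasFDerivAt.comp (g := ζ) y₀ (by rw [hP₀]; exact hζd) hPd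
    have h2 : HasFDerivAt (fun y ↦ ζ (P y)) (0 : E →L[ℝ] ℝ) y₀ := by
      refine (hasFDerivAt_const (0 : ℝ) y₀).congr_of_eventuallyEq ?_
      filter_upwards [hO] with y hy
      simp only [ζ, P]
      rw [φ.left_inv hy.2.2]
      exact T.z_proj hy.2.1
    exact fun u ↦ DFunLike.congr_fun (h1.unique h2) u
  -- the chart of `π` with its component along `v` replaced by `z`
  let F : E → E := fun y ↦ P y - y₀ - l (P y - y₀) • v + ζ y • v
  have hFC : ∀ y ∈ O, ContDiffAt ℝ ∞ F y := fun y hy ↦ by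
    have h1 := hPC y hy
    have h2 := hζC y hy
    fun_prop
  have hF₀ : F y₀ = 0 := by simp [F, hP₀, hζ₀]
  have hlF : ∀ y, l (F y) = ζ y := fun y ↦ by simp [F, hv]
  have hDF : ∀ u, fderiv ℝ F y₀ u = fderiv ℝ P y₀ u + l u • v := fun u ↦ by
    have h1 : HasFDerivAt F _ y₀ := (((hPd.sub_const y₀).sub
      ((l.hasFDerivAt.comp y₀ (hPd.sub_const y₀)).smul_const v)).add (hζd.smul_const v))
    rw [h1.fderiv]
    simp [hlP]
  have hinj : ∀ u, fderiv ℝ F y₀ u = 0 → u = 0 := fun u hu ↦ by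
    rw [hDF] at hu
    have h1 : l u = 0 := by simpa [hlP, hv] using congrArg l hu
    have h2 : fderiv ℝ P y₀ u = 0 := by simpa [h1] using hu
    exact T.injective_deriv p hpN u ((hl u).symm.trans h1) ((hDP u).symm.trans h2)
  obtain ⟨g, r, hr, hg₀, hgC, hgF, hFg⟩ := exists_smooth_localInverse hO hFC hinj
  rw [hF₀] at hg₀ hgC hgF
  have hφc : ContinuousAt φ p := continuousAt_extChartAt p
  have hgc : ContinuousAt g 0 := hgC.continuousOn.continuousAt (Metric.ball_mem_nhds _ hr)
  let κ : M → E := fun q ↦ φ q - y₀ - l (φ q - y₀) • v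
  have hκc : ContinuousAt κ p := by fun_prop
  have hκ₀ : κ p = 0 := by simp [κ, ← hy₀]
  refine ⟨l, v, fun w ↦ φ.symm (g w), r, κ, hv, by simp only [hg₀, hy₀p], hr, ?_,
    fun w hw ↦ ⟨(hgF w hw).1.2.1, ?_⟩, fun ρ hρ ↦ ?_, hκc, hκ₀, fun q ↦ by simp [κ, hv], ?_⟩
  · exact fun w hw ↦ ((hsymmC _ (hgF w hw).1).comp w
      (hgC.contDiffAt (Metric.isOpen_ball.mem_nhds hw)).contMDiffAt).contMDiffWithinAt
  · change ζ (g w) = l w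
    rw [← hlF, (hgF w hw).2]
  · have h1 : ∀ᶠ y in 𝓝 y₀, F y ∈ Metric.ball 0 ρ := by
      refine (hFC y₀ hO₀).continuousAt.eventually ?_
      rw [hF₀]
      exact Metric.ball_mem_nhds _ hρ
    filter_upwards [hφc.eventually (h1.and hFg), extChartAt_source_mem_nhds (I := 𝓘(ℝ, E)) p]
      with x ⟨hx1, hx2⟩ hx3
    exact ⟨F (φ x), hx1, by simp only [hx2]; exact φ.left_inv hx3⟩
  · -- two points of `Z` near `p` whose difference is parallel to `v` coincide
    have hstrict : HasStrictFDerivAt ζ l y₀ := (hζC y₀ hO₀).hasStrictFDerivAt (by simp)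
    have hc : (0 : ℝ) < (2 * (‖v‖ + 1))⁻¹ := by positivity
    have hlo := (hstrict.isLittleO.def hc)
    have hw : ContinuousAt (fun sq : ℝ × M ↦ κ sq.2 + sq.1 • v) (0, p) :=
      (ContinuousAt.comp (f := Prod.snd) (g := κ) (x := ((0 : ℝ), p)) hκc continuousAt_snd).add
        (continuousAt_fst.smul continuousAt_const)
    have hw₀ : κ p + (0 : ℝ) • v = 0 := by simp [hκ₀]
    have hgw : ContinuousAt (fun sq : ℝ × M ↦ g (κ sq.2 + sq.1 • v)) (0, p) :=
      ContinuousAt.comp (g := g) (f := fun sq : ℝ × M ↦ κ sq.2 + sq.1 • v)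
        (by simpa only [hw₀] using hgc) hw
    have hPg : ContinuousAt (fun sq : ℝ × M ↦ P (g (κ sq.2 + sq.1 • v))) (0, p) :=
      ContinuousAt.comp (g := P) (f := fun sq : ℝ × M ↦ g (κ sq.2 + sq.1 • v))
        (by simpa only [hw₀, hg₀] using (hPC y₀ hO₀).continuousAt) hgw
    have hφs : ContinuousAt (fun sq : ℝ × M ↦ φ sq.2) (0, p) :=
      ContinuousAt.comp (g := φ) (f := Prod.snd) (x := ((0 : ℝ), p)) hφc continuousAt_snd
    have hpair := (hPg.prodMk hφs).eventually (p := fun ab : E × E ↦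
      ‖ζ ab.1 - ζ ab.2 - l (ab.1 - ab.2)‖ ≤ (2 * (‖v‖ + 1))⁻¹ * ‖ab.1 - ab.2‖) (by
        simpa only [hw₀, hg₀, hP₀] using hlo)
    have hball := hw.eventually (p := fun w ↦ w ∈ Metric.ball 0 r) (by
      simp only [hw₀]
      exact Metric.ball_mem_nhds _ hr)
    have hsrc := (continuousAt_snd (p := ((0 : ℝ), p))).eventually
      (extChartAt_source_mem_nhds (I := 𝓘(ℝ, E)) p)
    filter_upwards [hpair, hball, hsrc] with ⟨s, q⟩ h1 h2 h3 hq
    dsimp only at h1 h2 h3 hq ⊢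
    obtain ⟨hgO, hFgw⟩ := hgF _ h2
    have hqφ : φ.symm (φ q) = q := φ.left_inv h3
    have hζ1 : ζ (P (g (κ q + s • v))) = 0 := by
      simp only [ζ, P]
      rw [φ.left_inv hgO.2.2]
      exact T.z_proj hgO.2.1
    have hζ2 : ζ (φ q) = 0 := by
      simp only [ζ]
      rw [hqφ]
      exact T.z_eq q hq
    have hζ3 : ζ (g (κ q + s • v)) = s := by
      rw [← hlF, hFgw]; simp [κ, hv]
    have hdiff : P (g (κ q + s • v)) - φ q = l (P (g (κ q + s • v)) - φ q) • v := by
      have h5 : P (g (κ q + s • v)) - y₀ - l (P (g (κ q + s • v)) - y₀) • v +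
          ζ (g (κ q + s • v)) • v = φ q - y₀ - l (φ q - y₀) • v + s • v := hFgw
      rw [hζ3] at h5
      have h6 := add_right_cancel h5
      have h7 : l (P (g (κ q + s • v)) - φ q) =
          l (P (g (κ q + s • v)) - y₀) - l (φ q - y₀) := by
        simp only [map_sub]; ring
      rw [h7, sub_smul]
      have h8 : P (g (κ q + s • v)) = φ q - y₀ - l (φ q - y₀) • v +
        l (P (g (κ q + s • v)) - y₀) • v + y₀ := by rw [← h6]; abel
      nth_rewrite 1 [h8]
      abel
    set τ := l (P (g (κ q + s • v)) - φ q) with hτ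
    rw [hζ1, hζ2, hdiff] at h1
    simp only [sub_zero, zero_sub, norm_neg, norm_smul] at h1
    have hτ0 : τ = 0 := by
      by_contra hne
      have hpos : 0 < ‖τ‖ := norm_pos_iff.2 hne
      have hn := norm_nonneg v
      have h9 : (2 * (‖v‖ + 1))⁻¹ * (‖τ‖ * ‖v‖) < ‖τ‖ := by
        rw [inv_mul_lt_iff₀ (by positivity)]
        nlinarith
      linarith
    rw [hτ0, zero_smul, sub_eq_zero] at hdiff
    have h10 : φ.symm (P (g (κ q + s • v))) = T.proj (φ.symm (g (κ q + s • v))) :=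
      φ.left_inv hgO.2.2
    rw [← h10, hdiff, hqφ]

end TubularNbhd
end Straightening

/-! ### Topology near the hypersurface -/

section Consequences

variable {E : Type*} [NormedAddCommGroup E] [NormedSpace ℝ E] [FiniteDimensional ℝ E]
  {M : Type*} [TopologicalSpace M] [ChartedSpace E M] [IsManifold 𝓘(ℝ, E) ∞ M] {Z : Set M}

namespace TubularNbhd

variable {T : TubularNbhd E Z} (hreg : ∀ p ∈ Z, mvfderiv 𝓘(ℝ, E) T.z p ≠ 0)
include hreg

/-- Arbitrarily small connected neighbourhoods of a point of `Z` that `Z` cuts into two connected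
sides, namely `z > 0` (for `σ > 0`) and `z < 0` (for `σ < 0`). -/
theorem exists_flowbox {p : M} (hp : p ∈ Z) {W : Set M} (hW : W ∈ 𝓝 p) :
    ∃ V ∈ 𝓝 p, V ⊆ W ∧ V ⊆ T.N ∧ IsPreconnected V ∧
      ∀ σ : ℝ, σ ≠ 0 → IsPreconnected {x ∈ V | 0 < σ * T.z x} := by
  obtain ⟨l, v, θ, r, κ, -, hθ₀, hr, hθ, hθz, hθn, -⟩ := T.exists_straightening hp (hreg p hp)
  have hθc : ContinuousAt θ 0 := hθ.continuousOn.continuousAt (Metric.ball_mem_nhds _ hr)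
  have hW' : ∀ᶠ w in 𝓝 (0 : E), θ w ∈ W := hθc.eventually (p := fun x ↦ x ∈ W) (by rwa [hθ₀])
  obtain ⟨ρ, hρ, hρW⟩ := Metric.eventually_nhds_iff_ball.1
    (hW'.and (Metric.ball_mem_nhds (0 : E) hr))
  have hcont : ContinuousOn θ (Metric.ball 0 ρ) :=
    hθ.continuousOn.mono fun w hw ↦ (hρW w hw).2
  refine ⟨θ '' Metric.ball 0 ρ, hθn ρ hρ, ?_, ?_, ?_, fun σ _ ↦ ?_⟩
  · rintro _ ⟨w, hw, rfl⟩
    exact (hρW w hw).1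
  · rintro _ ⟨w, hw, rfl⟩
    exact (hθz w (hρW w hw).2).1
  · exact (convex_ball 0 ρ).isPreconnected.image θ hcont
  · have h1 : {x ∈ θ '' Metric.ball 0 ρ | 0 < σ * T.z x} =
        θ '' (Metric.ball 0 ρ ∩ {w | 0 < (σ • l) w}) := by
      ext x
      constructor
      · rintro ⟨⟨w, hw, rfl⟩, hx⟩
        refine ⟨w, ⟨hw, ?_⟩, rfl⟩
        rw [(hθz w (hρW w hw).2).2] at hx
        exact hx
      · rintro ⟨w, ⟨hw, hx⟩, rfl⟩
        refine ⟨⟨w, hw, rfl⟩, ?_⟩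
        rw [(hθz w (hρW w hw).2).2]
        exact hx
    rw [h1]
    refine (((convex_ball 0 ρ).inter ?_).isPreconnected).image θ
      (hcont.mono inter_subset_left)
    exact convex_halfSpace_gt (σ • l).isLinear 0

/-- The fibre of the projection through a point `p` of `Z`, parametrized by `z`. -/
theorem exists_normalCurve {p : M} (hp : p ∈ Z) :
    ∃ (η : ℝ) (γ : ℝ → M), 0 < η ∧ γ 0 = p ∧
      ContMDiffOn 𝓘(ℝ, ℝ) 𝓘(ℝ, E) ∞ γ (Ioo (-η) η) ∧
      ∀ s ∈ Ioo (-η) η, γ s ∈ T.N ∧ T.z (γ s) = s ∧ T.proj (γ s) = p := by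
  obtain ⟨l, v, θ, r, κ, hlv, hθ₀, hr, hθ, hθz, -, -, hκ₀, -, hκ⟩ :=
    T.exists_straightening hp (hreg p hp)
  have hc : ContinuousAt (fun s : ℝ ↦ (s, p)) 0 := by fun_prop
  have h1 : ∀ᶠ s in 𝓝 (0 : ℝ), T.proj (θ (s • v)) = p := by
    filter_upwards [hc.eventually hκ] with s hs
    simpa [hκ₀] using hs hp
  have h2 : ∀ᶠ s in 𝓝 (0 : ℝ), s • v ∈ Metric.ball 0 r := by
    have : ContinuousAt (fun s : ℝ ↦ s • v) 0 := by fun_prop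
    refine this.eventually (p := fun w ↦ w ∈ Metric.ball 0 r) ?_
    simp only [zero_smul]
    exact Metric.ball_mem_nhds (0 : E) hr
  obtain ⟨η, hη, hball⟩ := Metric.eventually_nhds_iff_ball.1 (h1.and h2)
  have hmem : ∀ s ∈ Ioo (-η) η, s ∈ Metric.ball (0 : ℝ) η := fun s hs ↦ by
    rwa [Real.ball_eq_Ioo, zero_sub, zero_add]
  refine ⟨η, fun s ↦ θ (s • v), hη, by simp [hθ₀], ?_, fun s hs ↦ ?_⟩
  · refine hθ.comp (t := Metric.ball 0 r) (f := fun s : ℝ ↦ s • v) ?_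
      fun s hs ↦ (hball s (hmem s hs)).2
    exact (contDiff_id.smul contDiff_const).contMDiff.contMDiffOn
  · obtain ⟨hs1, hs2⟩ := hball s (hmem s hs)
    refine ⟨(hθz _ hs2).1, ?_, hs1⟩
    rw [(hθz _ hs2).2]
    simp [hlv]

/-- Both sides of `Z` accumulate at every point of `Z`. -/
theorem frequently_side {p : M} (hp : p ∈ Z) {σ : ℝ} (hσ : σ ≠ 0) :
    ∃ᶠ x in 𝓝 p, 0 < σ * T.z x := by
  obtain ⟨η, γ, hη, hγ₀, hγ, hγ'⟩ := T.exists_normalCurve hreg hp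
  have hI : Ioo (-η) η ∈ 𝓝 (0 : ℝ) := Ioo_mem_nhds (by linarith) hη
  have hc : ContinuousAt γ 0 := hγ.continuousOn.continuousAt hI
  intro hcon
  have h1 : ∀ᶠ s in 𝓝 (0 : ℝ), ¬ 0 < σ * T.z (γ s) :=
    hc.eventually (p := fun x ↦ ¬ 0 < σ * T.z x) (by rwa [hγ₀])
  have h2 : ∀ᶠ s in 𝓝 (0 : ℝ), ¬ 0 < σ * s := by
    filter_upwards [h1, hI] with s hs hs'
    rwa [(hγ' s hs').2.1] at hs
  have h3 : Filter.Tendsto (fun τ : ℝ ↦ τ * σ) (𝓝 0) (𝓝 0) := by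
    have : ContinuousAt (fun τ : ℝ ↦ τ * σ) 0 := by fun_prop
    simpa [ContinuousAt] using this
  have h4 := ((h3.eventually h2).filter_mono (nhdsWithin_le_nhds (s := Ioi 0))).and
    self_mem_nhdsWithin
  obtain ⟨τ, hτ, hτ0⟩ := h4.exists
  refine hτ ?_
  have : 0 < τ := hτ0
  have : 0 < σ ^ 2 := by positivity
  nlinarith [mul_pos ‹0 < τ› this]

/-- The point of the tubular neighbourhood with coordinates `(s, q)` tends to `p ∈ Z` as
`(s, q)` tends to `(0, p)`. -/
theorem eventually_mem_of_coord {p : M} (hp : p ∈ Z) {W : Set M} (hW : W ∈ 𝓝 p) :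
    ∀ᶠ sq : ℝ × M in 𝓝 (0, p), ∀ x ∈ T.N, T.z x = sq.1 → T.proj x = sq.2 → x ∈ W := by
  obtain ⟨l, v, θ, r, κ, hlv, hθ₀, hr, hθ, hθz, -, hκc, hκ₀, hlκ, hκ⟩ :=
    T.exists_straightening hp (hreg p hp)
  have hθc : ContinuousAt θ 0 := hθ.continuousOn.continuousAt (Metric.ball_mem_nhds _ hr)
  have hW' : ∀ᶠ w in 𝓝 (0 : E), θ w ∈ W := hθc.eventually (p := fun x ↦ x ∈ W) (by rwa [hθ₀])
  have hw : ContinuousAt (fun sq : ℝ × M ↦ κ sq.2 + sq.1 • v) (0, p) :=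
    (ContinuousAt.comp (f := Prod.snd) (g := κ) (x := ((0 : ℝ), p)) hκc continuousAt_snd).add
      (continuousAt_fst.smul continuousAt_const)
  have hev := hw.eventually (p := fun w ↦ θ w ∈ W ∧ w ∈ Metric.ball 0 r) (by
    simp only [hκ₀, zero_smul, add_zero]
    exact hW'.and (Metric.ball_mem_nhds (0 : E) hr))
  filter_upwards [hev, hκ] with ⟨s, q⟩ ⟨h1, h2⟩ h3 x hx hxs hxq
  dsimp only at h1 h2 h3 hxs hxq
  have hq : q ∈ Z := hxq ▸ (T.bijOn.mapsTo hx).2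
  have hxθ : x = θ (κ q + s • v) := by
    refine T.bijOn.injOn hx (hθz _ h2).1 (Prod.ext ?_ ?_)
    · change T.z x = T.z (θ (κ q + s • v))
      rw [(hθz _ h2).2, hxs]
      simp [hlκ, hlv]
    · change T.proj x = T.proj (θ (κ q + s • v))
      rw [h3 hq, hxq]
  rwa [hxθ]

theorem exists_tube_subset (hZ : IsCompact Z) {V : Set M} (hV : V ∈ 𝓝ˢ Z) :
    ∃ ρ > 0, T.tube ρ ⊆ V := by
  have h1 : ∀ᶠ s in 𝓝 (0 : ℝ), ∀ q ∈ Z, ∀ x ∈ T.N, T.z x = s → T.proj x = q → x ∈ V :=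
    hZ.eventually_forall_of_forall_eventually fun p hp ↦
      T.eventually_mem_of_coord hreg hp (mem_nhdsSet_iff_forall.1 hV p hp)
  obtain ⟨ρ, hρ, hball⟩ := Metric.eventually_nhds_iff_ball.1 h1
  refine ⟨ρ, hρ, fun x hx ↦ hball (T.z x) ?_ (T.proj x) (T.bijOn.mapsTo hx.1).2 x hx.1 rfl rfl⟩
  simpa using hx.2

omit hreg [FiniteDimensional ℝ E] [IsManifold 𝓘(ℝ, E) ∞ M] in
theorem isOpen_tube (r : ℝ) : IsOpen (T.tube r) := by
  rw [isOpen_iff_mem_nhds]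
  intro x hx
  have hc : ContinuousAt T.z x := T.smooth_z.continuousOn.continuousAt (T.isOpen.mem_nhds hx.1)
  exact Filter.Eventually.and (T.isOpen.mem_nhds hx.1)
    (hc.abs.eventually_lt continuousAt_const hx.2)

omit hreg [FiniteDimensional ℝ E] [IsManifold 𝓘(ℝ, E) ∞ M] in
theorem subset_tube {r : ℝ} (hr : 0 < r) : Z ⊆ T.tube r := fun p hp ↦
  ⟨T.subset hp, by rwa [T.z_eq p hp, abs_zero]⟩

/-- The components of `Z` are open in `Z`. -/
theorem eventually_mem_around {x : M} (hx : x ∈ T.N) :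
    ∀ᶠ y in 𝓝 x, y ∈ T.around (T.proj x) := by
  have key : ∀ p ∈ Z, ∀ᶠ y in 𝓝 p, y ∈ T.around p := fun p hp ↦ by
    obtain ⟨V, hV, -, hVN, hVc, -⟩ := T.exists_flowbox hreg hp Filter.univ_mem
    filter_upwards [hV] with y hy
    refine ⟨hVN hy, ?_⟩
    have h1 : IsPreconnected (T.proj '' V) := hVc.image _ (T.smooth_proj.continuousOn.mono hVN)
    refine h1.subset_connectedComponentIn ⟨p, mem_of_mem_nhds hV, T.proj_eq p hp⟩ ?_ ⟨y, hy, rfl⟩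
    rintro _ ⟨y', hy', rfl⟩
    exact T.proj_mem (hVN hy')
  have hq := T.proj_mem hx
  filter_upwards [(T.contMDiffAt_proj hx).continuousAt.eventually (key _ hq),
    T.isOpen.mem_nhds hx] with y hy hyN
  refine ⟨hyN, ?_⟩
  have := hy.2
  rwa [T.proj_eq _ (T.proj_mem hyN)] at this

omit hreg [FiniteDimensional ℝ E] [IsManifold 𝓘(ℝ, E) ∞ M] in
theorem component_eq_of_mem_around {p x : M} (hx : x ∈ T.around p) :
    connectedComponentIn Z (T.proj x) = connectedComponentIn Z p :=
  (connectedComponentIn_eq hx.2).symm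

theorem isOpen_around (p : M) : IsOpen (T.around p) := by
  rw [isOpen_iff_mem_nhds]
  intro x hx
  filter_upwards [T.eventually_mem_around hreg hx.1] with y hy
  exact ⟨hy.1, T.component_eq_of_mem_around hx ▸ hy.2⟩

/-- A quantity that can be read off on one side of `Z` is constant on the components of `Z`. -/
theorem side_value_eq {α : Type*} {F g : M → α} {σ : ℝ} (hσ : σ ≠ 0)
    (hg : ∀ p ∈ Z, ∀ᶠ x in 𝓝 p, 0 < σ * T.z x → F x = g p) {p q : M} (hp : p ∈ Z)
    (hq : q ∈ connectedComponentIn Z p) : g q = g p := by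
  have hloc : ∀ q ∈ Z, ∀ᶠ q' in 𝓝 q, q' ∈ Z → g q' = g q := fun q hq ↦ by
    filter_upwards [eventually_eventually_nhds.2 (hg q hq)] with q' h1 hq'
    obtain ⟨x, hx, hx1, hx2⟩ :=
      ((T.frequently_side hreg hq' hσ).and_eventually (h1.and (hg q' hq'))).exists
    exact (hx2 hx).symm.trans (hx1 hx)
  let _ : TopologicalSpace α := ⊥
  have : DiscreteTopology α := ⟨rfl⟩
  refine isPreconnected_connectedComponentIn.constant (s := connectedComponentIn Z p) ?_ hq
    (mem_connectedComponentIn hp)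
  intro q hq
  have hqZ := connectedComponentIn_subset Z p hq
  refine tendsto_nhds_of_eventually_eq ?_
  filter_upwards [(hloc q hqZ).filter_mono nhdsWithin_le_nhds, self_mem_nhdsWithin] with q' h1 h2
  exact h1 (connectedComponentIn_subset Z p h2)

omit hreg [FiniteDimensional ℝ E] [IsManifold 𝓘(ℝ, E) ∞ M] in
theorem notMem_of_side {x : M} {σ : ℝ} (h : 0 < σ * T.z x) : x ∉ Z := fun hx ↦ by
  rw [T.z_eq x hx, mul_zero] at h
  exact lt_irrefl _ h

/-- Every side of `Z` at a point of `Z` lies in one component of the complement. -/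
theorem exists_side_component {p : M} (hp : p ∈ Z) {σ : ℝ} (hσ : σ ≠ 0) :
    ∃ W : Set M, ∀ᶠ x in 𝓝 p, 0 < σ * T.z x → connectedComponentIn Zᶜ x = W := by
  obtain ⟨V, hV, -, hVN, -, hside⟩ := T.exists_flowbox hreg hp Filter.univ_mem
  obtain ⟨x₀, hx₀, hx₀V⟩ := ((T.frequently_side hreg hp hσ).and_eventually hV).exists
  refine ⟨connectedComponentIn Zᶜ x₀, ?_⟩
  filter_upwards [hV] with x hx hxσ
  refine (connectedComponentIn_eq ?_).symm
  exact (hside σ hσ).subset_connectedComponentIn ⟨hx₀V, hx₀⟩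
    (fun y hy ↦ notMem_of_side hy.2) ⟨hx, hxσ⟩

/-- A choice of one base point in each component of `Z`. -/
theorem exists_basePoint (hZ : IsCompact Z) : ∃ b : M → M, (b '' Z).Finite ∧
    ∀ p ∈ Z, b p ∈ Z ∧ connectedComponentIn Z (b p) = connectedComponentIn Z p ∧
      ∀ q, connectedComponentIn Z q = connectedComponentIn Z p → b q = b p := by
  classical
  let b : M → M := fun p ↦ Classical.epsilon (h := ⟨p⟩)
    fun q ↦ q ∈ Z ∧ connectedComponentIn Z q = connectedComponentIn Z p
  have hb : ∀ p ∈ Z, b p ∈ Z ∧ connectedComponentIn Z (b p) = connectedComponentIn Z p :=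
    fun p hp ↦ Classical.epsilon_spec
      (p := fun q ↦ q ∈ Z ∧ connectedComponentIn Z q = connectedComponentIn Z p) ⟨p, hp, rfl⟩
  have hbb : ∀ p q, connectedComponentIn Z q = connectedComponentIn Z p → b q = b p :=
    fun p q hpq ↦ by simp only [b, hpq]
  refine ⟨b, ?_, fun p hp ↦ ⟨(hb p hp).1, (hb p hp).2, fun q hq ↦ hbb p q hq⟩⟩
  obtain ⟨t, htZ, ht⟩ := hZ.elim_nhds_subcover T.around fun p hp ↦ by
    have := T.eventually_mem_around hreg (T.subset hp)
    rwa [T.proj_eq p hp] at this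
  refine (t.finite_toSet.image b).subset ?_
  rintro _ ⟨p, hp, rfl⟩
  obtain ⟨q, hq, hpq⟩ := mem_iUnion₂.1 (ht hp)
  refine ⟨q, hq, hbb p q ?_⟩
  rw [← T.component_eq_of_mem_around hpq, T.proj_eq p hp]

end TubularNbhd
end Consequences

/-! ### Linear growth along the normal direction -/

section RegularPart

variable {E : Type*} [NormedAddCommGroup E] [NormedSpace ℝ E] [FiniteDimensional ℝ E]
  {M : Type*} [TopologicalSpace M] [ChartedSpace E M] [IsManifold 𝓘(ℝ, E) ∞ M] {Z : Set M}

/-- The primitive `- 1 / ((2 m - 1) s ^ (2 m - 1))` of `s ^ (- 2 m)`. -/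
def pole (m : ℕ) (s : ℝ) : ℝ := -1 / ((2 * (m : ℝ) - 1) * s ^ (2 * m - 1))

theorem hasDerivAt_pole {m : ℕ} (hm : 1 ≤ m) {s : ℝ} (hs : s ≠ 0) :
    HasDerivAt (pole m) (s ^ (2 * m))⁻¹ s := by
  obtain ⟨j, rfl⟩ : ∃ j, m = j + 1 := ⟨m - 1, by omega⟩
  have h := hasDerivAt_neg_inv_pow (2 * j) hs
  have h1 : pole (j + 1) = fun x ↦ -1 / (((2 * j + 1 : ℕ) : ℝ) * x ^ (2 * j + 1)) := by
    funext x
    simp only [pole, show 2 * (j + 1) - 1 = 2 * j + 1 by omega]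
    push_cast
    ring_nf
  rwa [h1, show 2 * (j + 1) = 2 * j + 2 by ring]

theorem pow_mul_pole {m : ℕ} {s : ℝ} (hs : s ≠ 0) :
    s ^ (2 * m - 1) * pole m s = -1 / (2 * (m : ℝ) - 1) := by
  have : s ^ (2 * m - 1) ≠ 0 := pow_ne_zero _ hs
  rw [pole, div_mul_eq_div_div, mul_div_cancel₀ _ this]

theorem eqOn_const_of_hasDerivAt_zero {φ : ℝ → ℝ} {a b : ℝ}
    (h : ∀ s ∈ Ioo a b, HasDerivAt φ 0 s) {s s' : ℝ} (hs : s ∈ Ioo a b) (hs' : s' ∈ Ioo a b) :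
    φ s = φ s' :=
  isOpen_Ioo.is_const_of_deriv_eq_zero isPreconnected_Ioo
    (fun s hs ↦ (h s hs).differentiableAt.differentiableWithinAt)
    (fun s hs ↦ (h s hs).deriv) hs hs'

theorem SmoothPeriodicOn.contMDiffAt {F : Type*} [NormedAddCommGroup F] [NormedSpace ℝ F]
    {N : Type*} [TopologicalSpace N] [ChartedSpace F N] {U : Set N} {h : ℝ → N → ℝ}
    (hh : SmoothPeriodicOn F U h) (hU : IsOpen U) (t : ℝ) {x : N} (hx : x ∈ U) :
    ContMDiffAt (𝓘(ℝ, ℝ).prod 𝓘(ℝ, F)) 𝓘(ℝ, ℝ) ∞ (fun p : ℝ × N ↦ h p.1 p.2) (t, x) :=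
  hh.1.contMDiffAt ((isOpen_univ.prod hU).mem_nhds ⟨mem_univ t, hx⟩)

theorem SmoothPeriodicOn.contMDiffAt_right {F : Type*} [NormedAddCommGroup F] [NormedSpace ℝ F]
    {N : Type*} [TopologicalSpace N] [ChartedSpace F N] {U : Set N} {h : ℝ → N → ℝ}
    (hh : SmoothPeriodicOn F U h) (hU : IsOpen U) (t : ℝ) {x : N} (hx : x ∈ U) :
    ContMDiffAt 𝓘(ℝ, F) 𝓘(ℝ, ℝ) ∞ (h t) x :=
  ContMDiffAt.comp (g := fun p : ℝ × N ↦ h p.1 p.2) (f := fun y ↦ (t, y)) x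
    (hh.contMDiffAt hU t hx) (contMDiffAt_const.prodMk contMDiffAt_id)

namespace TubularNbhd

variable {T : TubularNbhd E Z} {m : ℕ}

omit [FiniteDimensional ℝ E] [IsManifold 𝓘(ℝ, E) ∞ M] in
/-- Along the curve normal to `Z` through `p` the linearity of `H` along `X^σ` determines `H` up to
an additive constant on either side. -/
theorem hasDerivAt_normalCurve {H : M → ℝ} {γ : ℝ → M} {p : M} {s k : ℝ}
    (hs : s ≠ 0) (hγ : ContMDiffAt 𝓘(ℝ, ℝ) 𝓘(ℝ, E) ∞ γ s) (hγN : γ s ∈ T.N)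
    (hz : ∀ᶠ s' in 𝓝 s, T.z (γ s') = s') (hp : ∀ᶠ s' in 𝓝 s, T.proj (γ s') = p)
    (hH : MDifferentiableAt 𝓘(ℝ, E) 𝓘(ℝ, ℝ) H (γ s))
    (hk : ∀ v, T.IsNormalVector m (γ s) v → mvfderiv 𝓘(ℝ, E) H (γ s) v = k) :
    HasDerivAt (fun s ↦ H (γ s)) (k * (s ^ (2 * m))⁻¹) s := by
  have hγd : HasMFDerivAt 𝓘(ℝ, ℝ) 𝓘(ℝ, E) γ s (mfderiv 𝓘(ℝ, ℝ) 𝓘(ℝ, E) γ s) :=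
    (hγ.mdifferentiableAt (by simp)).hasMFDerivAt
  set γ' : TangentSpace 𝓘(ℝ, E) (γ s) := mfderiv 𝓘(ℝ, ℝ) 𝓘(ℝ, E) γ s (1 : ℝ) with hγ'
  have hcomp : ∀ F : M → ℝ, MDifferentiableAt 𝓘(ℝ, E) 𝓘(ℝ, ℝ) F (γ s) →
      HasDerivAt (fun s ↦ F (γ s)) (mvfderiv 𝓘(ℝ, E) F (γ s) γ') s := fun F hF ↦ by
    have h1 := hF.hasMFDerivAt.comp s hγd
    rw [hasMFDerivAt_iff_hasFDerivAt] at h1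
    have h2 : HasFDerivAt (fun s ↦ F (γ s)) (ContinuousLinearMap.comp (M₂ := E)
      (mvfderiv 𝓘(ℝ, E) F (γ s)) (mfderiv 𝓘(ℝ, ℝ) 𝓘(ℝ, E) γ s) : ℝ →L[ℝ] ℝ) s := h1
    exact h2.hasDerivAt
  have h1 : mvfderiv 𝓘(ℝ, E) T.z (γ s) γ' = 1 :=
    (hcomp T.z (T.mdifferentiableAt_z hγN)).unique ((hasDerivAt_id s).congr_of_eventuallyEq hz)
  have h2 : mfderiv 𝓘(ℝ, E) 𝓘(ℝ, E) T.proj (γ s) γ' = 0 := by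
    have h3 := (T.mdifferentiableAt_proj hγN).hasMFDerivAt.comp s hγd
    have h4 : HasMFDerivAt 𝓘(ℝ, ℝ) 𝓘(ℝ, E) (T.proj ∘ γ) s
        (0 : TangentSpace 𝓘(ℝ, ℝ) s →L[ℝ] TangentSpace 𝓘(ℝ, E) p) :=
      (hasMFDerivAt_const p s).congr_of_eventuallyEq hp
    exact DFunLike.congr_fun (hasMFDerivAt_unique h3 h4) (1 : ℝ)
  have hzs : T.z (γ s) = s := hz.self_of_nhds
  -- `z ^ (2 m)` times the velocity of the curve is the value of `X^σ`
  have h5 := hk (s ^ (2 * m) • γ') ⟨by rw [map_smul, h1, hzs]; simp,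
    by rw [map_smul, h2, smul_zero]⟩
  rw [map_smul, smul_eq_mul] at h5
  have hne : s ^ (2 * m) ≠ 0 := pow_ne_zero _ hs
  convert hcomp H hH using 1
  rw [← h5]
  field_simp

end TubularNbhd
end RegularPart

/-! ### The regular part of an admissible Hamiltonian -/

section RegularPart

variable {E : Type*} [NormedAddCommGroup E] [NormedSpace ℝ E] [FiniteDimensional ℝ E]
  {M : Type*} [TopologicalSpace M] [ChartedSpace E M] [IsManifold 𝓘(ℝ, E) ∞ M] {Z : Set M}

namespace TubularNbhd

variable {T : TubularNbhd E Z} {m : ℕ} (hreg : ∀ p ∈ Z, mvfderiv 𝓘(ℝ, E) T.z p ≠ 0)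
include hreg

/-- Around a component of `Z` an admissible Hamiltonian is `- k(t) / ((2 m - 1) z ^ (2 m - 1))` plus
a function that is smooth across `Z`: by linearity along `X^σ` this holds on a curve normal to `Z`
with one additive constant on each side, and the form of a `b^{2m}`-function forces the two
constants to agree. -/
theorem exists_regularPart (hm : 1 ≤ m) (hZ : IsClosed Z) {H : ℝ → M → ℝ}
    (hH : IsBFunction T m H) {p : M} (hp : p ∈ Z) {r : ℝ} (hr : 0 < r) {k : ℝ → ℝ}
    (hk : SmoothPeriodic k) (hslope : ∀ t, ∀ x ∈ (T.around p ∩ T.tube r) \ Z, ∀ v,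
      T.IsNormalVector m x v → mvfderiv 𝓘(ℝ, E) (H t) x v = k t) :
    ∃ η > 0, ∃ G : ℝ → M → ℝ, SmoothPeriodicOn E (T.around p ∩ T.tube η) G ∧
      ∀ t, ∀ x ∈ (T.around p ∩ T.tube η) \ Z, H t x = k t * pole m (T.z x) + G t x := by
  obtain ⟨η₀, γ, hη₀, hγ₀, hγ, hγ'⟩ := T.exists_normalCurve hreg hp
  obtain ⟨hHs, hform⟩ := hH
  obtain ⟨k₀, c, h, hk₀, hc, hh, hHeq⟩ := hform p hp
  have hZo : IsOpen Zᶜ := hZ.isOpen_compl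
  have hAo := T.isOpen_around hreg p
  set η := min η₀ r with hη
  have hηpos : 0 < η := lt_min hη₀ hr
  have hsub : Ioo (-η) η ⊆ Ioo (-η₀) η₀ :=
    Ioo_subset_Ioo (neg_le_neg (min_le_left _ _)) (min_le_left _ _)
  have hγC : ∀ s ∈ Ioo (-η) η, ContMDiffAt 𝓘(ℝ, ℝ) 𝓘(ℝ, E) ∞ γ s := fun s hs ↦
    hγ.contMDiffAt (isOpen_Ioo.mem_nhds (hsub hs))
  have hγA : ∀ s ∈ Ioo (-η) η, γ s ∈ T.around p ∩ T.tube r := fun s hs ↦ by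
    obtain ⟨h1, h2, h3⟩ := hγ' s (hsub hs)
    refine ⟨⟨h1, by rw [h3]; exact mem_connectedComponentIn hp⟩, h1, ?_⟩
    rw [h2, abs_lt]
    exact ⟨by linarith [hs.1, min_le_right η₀ r], hs.2.trans_le (min_le_right _ _)⟩
  have hγz : ∀ s ∈ Ioo (-η) η, T.z (γ s) = s := fun s hs ↦ (hγ' s (hsub hs)).2.1
  have hγZ : ∀ s ∈ Ioo (-η) η, s ≠ 0 → γ s ∉ Z := fun s hs hs0 hsZ ↦
    hs0 ((hγz s hs).symm.trans (T.z_eq _ hsZ))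
  have hder : ∀ t, ∀ s ∈ Ioo (-η) η, s ≠ 0 →
      HasDerivAt (fun s ↦ H t (γ s) - k t * pole m s) 0 s := fun t s hs hs0 ↦ by
    have hev : ∀ᶠ s' in 𝓝 s, s' ∈ Ioo (-η) η := isOpen_Ioo.mem_nhds hs
    have h1 := hasDerivAt_normalCurve (T := T) (m := m) (H := H t) (p := p) hs0 (hγC s hs)
      (hγA s hs).1.1 (hev.mono hγz) (hev.mono fun s' hs' ↦ (hγ' s' (hsub hs')).2.2)
      ((hHs.contMDiffAt_right hZo t (hγZ s hs hs0)).mdifferentiableAt (by simp))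
      (hslope t _ ⟨hγA s hs, hγZ s hs hs0⟩)
    have h2 := h1.sub ((hasDerivAt_pole hm hs0).const_mul (k t))
    rwa [sub_self] at h2
  -- the additive constants on the two sides
  have hpos : ∀ t, ∀ s ∈ Ioo 0 η, H t (γ s) =
      k t * pole m s + (H t (γ (η / 2)) - k t * pole m (η / 2)) := fun t s hs ↦ by
    have := eqOn_const_of_hasDerivAt_zero (a := 0) (b := η) (fun s hs ↦ hder t s
      ⟨by linarith [hs.1], hs.2⟩ hs.1.ne') hs ⟨half_pos hηpos, half_lt_self hηpos⟩
    linarith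
  have hneg : ∀ t, ∀ s ∈ Ioo (-η) 0, H t (γ s) =
      k t * pole m s + (H t (γ (-(η / 2))) - k t * pole m (-(η / 2))) := fun t s hs ↦ by
    have := eqOn_const_of_hasDerivAt_zero (a := -η) (b := 0) (fun s hs ↦ hder t s
      ⟨hs.1, by linarith [hs.2]⟩ hs.2.ne) hs (s' := -(η / 2)) ⟨by linarith, by linarith⟩
    linarith
  have hgg : ∀ t, H t (γ (η / 2)) - k t * pole m (η / 2) =
      H t (γ (-(η / 2))) - k t * pole m (-(η / 2)) := fun t ↦ by
    -- the form of a `b^{2m}`-function, multiplied by `s ^ (2 m - 1)`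
    have hQ : ∀ s ∈ Ioo (-η) η, s ≠ 0 → ∀ g, H t (γ s) = k t * pole m s + g →
        s ^ (2 * m - 1) * h t (γ s) + ∑ i ∈ Finset.Icc 1 (2 * m - 1),
          s ^ (2 * m - 1 - i) * c i t s + k t / (2 * (m : ℝ) - 1) =
        s ^ (2 * m - 1) * (g + -k₀ t * Real.log s) := fun s hs hs0 g hg ↦ by
      have h1 := hHeq t (γ s) ⟨(hγA s hs).1, hγZ s hs hs0⟩
      rw [hg, hγz s hs, Real.log_abs] at h1
      have h2 : s ^ (2 * m - 1) * (k t * pole m s) = - (k t / (2 * (m : ℝ) - 1)) := by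
        rw [mul_left_comm, pow_mul_pole hs0]; ring
      have h3 : ∑ i ∈ Finset.Icc 1 (2 * m - 1), s ^ (2 * m - 1 - i) * c i t s =
          s ^ (2 * m - 1) * ∑ i ∈ Finset.Icc 1 (2 * m - 1), (s ^ i)⁻¹ * c i t s := by
        rw [Finset.mul_sum]
        refine Finset.sum_congr rfl fun i hi ↦ ?_
        rw [← mul_assoc, pow_sub₀ s hs0 (Finset.mem_Icc.1 hi).2]
      rw [h3]
      linear_combination (s ^ (2 * m - 1)) * (-h1) + h2
    refine (log_coeff_eq_zero_of_contDiffAt hηpos (2 * m - 1) _ _ _ (-k₀ t) ?_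
      (fun s hs ↦ hQ s ⟨by linarith [hs.1], hs.2⟩ hs.1.ne' _ (hpos t s hs))
      (fun s hs ↦ hQ s ⟨hs.1, by linarith [hs.2]⟩ hs.2.ne _ (hneg t s hs))).2
    intro s hs
    have h1 : ContDiffAt ℝ ∞ (fun s ↦ h t (γ s)) s := contMDiffAt_iff_contDiffAt.1
      ((hh.contMDiffAt_right hAo t (hγA s hs).1).comp s (hγC s hs))
    have h2 : ∀ i, ContDiffAt ℝ ∞ (c i t) s := fun i ↦ contMDiffAt_iff_contDiffAt.1
      ((hc i).contMDiffAt_right isOpen_univ t (mem_univ s))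
    refine ContDiffAt.contDiffWithinAt ?_
    refine ((ContDiffAt.mul (contDiffAt_id.pow _) h1).add (ContDiffAt.sum fun i _ ↦
      ContDiffAt.mul (contDiffAt_id.pow _) (h2 i))).add contDiffAt_const
  have hall : ∀ t, ∀ s ∈ Ioo (-η) η, s ≠ 0 → H t (γ s) =
      k t * pole m s + (H t (γ (η / 2)) - k t * pole m (η / 2)) := fun t s hs hs0 ↦ by
    rcases lt_or_gt_of_ne hs0 with h0 | h0
    · rw [hgg]; exact hneg t s ⟨hs.1, h0⟩
    · exact hpos t s ⟨h0, hs.2⟩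
  have hη2 : η / 2 ∈ Ioo (-η) η := ⟨by linarith, half_lt_self hηpos⟩
  have hη2Z := hγZ _ hη2 (half_pos hηpos).ne'
  -- the terms of `H` that depend only on `z` cancel in the difference of `H` at `x` and at the
  -- point of the normal curve with the same value of `z`
  refine ⟨η, hηpos, fun t x ↦ h t x - h t (γ (T.z x)) +
    (H t (γ (η / 2)) - k t * pole m (η / 2)), ⟨?_, fun t x hx ↦ ?_⟩, fun t x hx ↦ ?_⟩
  · rintro ⟨t, x⟩ ⟨-, hxA, hxN, hxη⟩
    have hzη : T.z x ∈ Ioo (-η) η := abs_lt.1 hxη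
    refine ContMDiffAt.contMDiffWithinAt ?_
    have h1 := hh.contMDiffAt hAo t hxA
    have h2 : ContMDiffAt (𝓘(ℝ, ℝ).prod 𝓘(ℝ, E)) 𝓘(ℝ, ℝ) ∞
        (fun q : ℝ × M ↦ h q.1 (γ (T.z q.2))) (t, x) := by
      refine ContMDiffAt.comp (g := fun q : ℝ × M ↦ h q.1 q.2)
        (f := fun q : ℝ × M ↦ (q.1, γ (T.z q.2))) (t, x)
        (hh.contMDiffAt hAo t (hγA _ hzη).1) (contMDiffAt_fst.prodMk ?_)
      exact ContMDiffAt.comp (g := γ) (f := fun q : ℝ × M ↦ T.z q.2) (t, x) (hγC _ hzη)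
        (ContMDiffAt.comp (g := T.z) (f := Prod.snd) (t, x) (T.contMDiffAt_z hxN) contMDiffAt_snd)
    have h3 : ContMDiffAt (𝓘(ℝ, ℝ).prod 𝓘(ℝ, E)) 𝓘(ℝ, ℝ) ∞
        (fun q : ℝ × M ↦ H q.1 (γ (η / 2))) (t, x) :=
      ContMDiffAt.comp (g := fun q : ℝ × M ↦ H q.1 q.2)
        (f := fun q : ℝ × M ↦ (q.1, γ (η / 2))) (t, x) (hHs.contMDiffAt hZo t hη2Z)
        (contMDiffAt_fst.prodMk contMDiffAt_const)
    have h4 : ContMDiffAt (𝓘(ℝ, ℝ).prod 𝓘(ℝ, E)) 𝓘(ℝ, ℝ) ∞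
        (fun q : ℝ × M ↦ k q.1 * pole m (η / 2)) (t, x) :=
      ContMDiffAt.comp (g := fun τ ↦ k τ * pole m (η / 2)) (f := Prod.fst) (t, x)
        (hk.1.mul contDiff_const).contMDiff.contMDiffAt contMDiffAt_fst
    exact (h1.sub h2).add (h3.sub h4)
  · simp only [hh.2 t x hx.1, hh.2 t _ (hγA _ (abs_lt.1 hx.2.2)).1, hHs.2 t _ hη2Z, hk.2 t]
  · obtain ⟨⟨hxA, hxN, hxη⟩, hxZ⟩ := hx
    have hzη : T.z x ∈ Ioo (-η) η := abs_lt.1 hxη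
    have hz0 : T.z x ≠ 0 := fun h0 ↦ hxZ ((T.z_eq_zero_iff hxN).1 h0)
    have h1 := hHeq t x ⟨hxA, hxZ⟩
    have h2 := hHeq t (γ (T.z x)) ⟨(hγA _ hzη).1, hγZ _ hzη hz0⟩
    rw [hγz _ hzη] at h2
    have h3 := hall t _ hzη hz0
    linarith

/-- A neighbourhood of `Z` on which an admissible Hamiltonian is the sum of a singular term, whose
coefficient is constant on the components of `Z`, and a smooth function. -/
theorem exists_regularPart_near (hm : 1 ≤ m) (hZ : IsCompact Z) (hZc : IsClosed Z)
    {H : ℝ → M → ℝ}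
    (hH : IsBFunction T m H) {r : ℝ} (hr : 0 < r)
    (hslope : ∀ p ∈ Z, ∃ k : ℝ → ℝ, SmoothPeriodic k ∧
      ∀ t, ∀ x ∈ (T.around p ∩ T.tube r) \ Z, ∀ v, T.IsNormalVector m x v →
        mvfderiv 𝓘(ℝ, E) (H t) x v = k t) :
    ∃ (k G : ℝ → M → ℝ) (V : Set M), IsOpen V ∧ Z ⊆ V ∧ V ⊆ T.tube r ∧
      (∀ p ∈ Z, SmoothPeriodic fun t ↦ k t p) ∧
      (∀ p ∈ Z, ∀ q ∈ connectedComponentIn Z p, ∀ t, k t q = k t p) ∧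
      SmoothPeriodicOn E V G ∧ ∀ t, ∀ x ∈ V \ Z,
        H t x = k t (T.proj x) * pole m (T.z x) + G t x ∧
        ∀ v, T.IsNormalVector m x v → mvfderiv 𝓘(ℝ, E) (H t) x v = k t (T.proj x) := by
  choose! k hk hks using hslope
  have hex := fun p (hp : p ∈ Z) ↦ T.exists_regularPart hreg hm hZc hH hp hr (hk p hp) (hks p hp)
  choose! η hη G hG hHG using hex
  obtain ⟨b, -, hb⟩ := T.exists_basePoint hreg hZ
  have hbq : ∀ p ∈ Z, ∀ q ∈ connectedComponentIn Z p, b q = b p := fun p hp q hq ↦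
    (hb p hp).2.2 q (connectedComponentIn_eq hq).symm
  have hbx : ∀ {x y}, x ∈ T.N → y ∈ T.around (T.proj x) → b (T.proj y) = b (T.proj x) :=
    fun hx hy ↦ hbq _ (T.proj_mem hx) _ hy.2
  have hA : ∀ {x}, x ∈ T.N → x ∈ T.around (b (T.proj x)) := fun {x} hx ↦ by
    refine ⟨hx, ?_⟩
    rw [(hb _ (T.proj_mem hx)).2.1]
    exact mem_connectedComponentIn (T.proj_mem hx)
  have hVo : ∀ x ∈ T.N, |T.z x| < η (b (T.proj x)) → ∀ᶠ y in 𝓝 x,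
      y ∈ T.around (b (T.proj x)) ∩ T.tube (η (b (T.proj x))) := fun x hx hxη ↦
    ((T.isOpen_around hreg _).inter (T.isOpen_tube _)).mem_nhds ⟨hA hx, hx, hxη⟩
  refine ⟨fun t q ↦ k (b q) t, fun t x ↦ G (b (T.proj x)) t x,
    {x ∈ T.N | |T.z x| < η (b (T.proj x))} ∩ T.tube r, ?_, fun p hp ↦ ⟨⟨T.subset hp, ?_⟩,
      T.subset_tube hr hp⟩, inter_subset_right, fun p hp ↦ hk _ (hb p hp).1,
      fun p hp q hq t ↦ congrArg (k · t) (hbq p hp q hq), ⟨?_, fun t x hx ↦ ?_⟩, fun t x hx ↦ ?_⟩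
  · refine IsOpen.inter (isOpen_iff_mem_nhds.2 fun x hx ↦ ?_) (T.isOpen_tube r)
    filter_upwards [hVo x hx.1 hx.2, T.eventually_mem_around hreg hx.1] with y hy hy'
    exact ⟨hy.1.1, by rw [hbx hx.1 hy']; exact hy.2.2⟩
  · rw [T.z_eq p hp, abs_zero, T.proj_eq p hp]
    exact hη _ (hb p hp).1
  · rintro ⟨t, x⟩ ⟨-, ⟨hxN, hxη⟩, -⟩
    have hbZ := (hb _ (T.proj_mem hxN)).1
    refine (((hG _ hbZ).contMDiffAt ((T.isOpen_around hreg _).inter (T.isOpen_tube _)) t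
      ⟨hA hxN, hxN, hxη⟩).congr_of_eventuallyEq ?_).contMDiffWithinAt
    filter_upwards [continuousAt_snd.eventually (T.eventually_mem_around hreg hxN)] with y hy
    rw [hbx hxN hy]
  · exact (hG _ (hb _ (T.proj_mem hx.1.1)).1).2 t x ⟨hA hx.1.1, hx.1.1, hx.1.2⟩
  · obtain ⟨⟨⟨hxN, hxη⟩, hxr⟩, hxZ⟩ := hx
    have hbZ := (hb _ (T.proj_mem hxN)).1
    exact ⟨hHG _ hbZ t x ⟨⟨hA hxN, hxN, hxη⟩, hxZ⟩, hks _ hbZ t x ⟨⟨hA hxN, hxr⟩, hxZ⟩⟩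

end TubularNbhd
end RegularPart

/-! ### The associated graph -/

section Graphs

/-- In an acyclic multigraph the ends of an edge are not joined by a path avoiding this edge. -/
theorem GraphIsAcyclic.not_reflTransGen {α β : Type*} {G : Graph α β} (hG : GraphIsAcyclic G)
    {e : β} {u v : α} (he : G.IsLink e u v) :
    ¬ Relation.ReflTransGen (fun a b ↦ ∃ e' ≠ e, G.IsLink e' a b) u v := by
  classical
  intro huv
  let S : SimpleGraph α :=
    { Adj := fun a b ↦ a ≠ b ∧ ∃ e' ≠ e, G.IsLink e' a b
      symm := ⟨fun a b h ↦ ⟨h.1.symm, h.2.imp fun e' h' ↦ ⟨h'.1, h'.2.symm⟩⟩⟩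
      loopless := ⟨fun a h ↦ h.1 rfl⟩ }
  have hreach : S.Reachable u v := by
    clear he
    induction huv with
    | refl => rfl
    | @tail b c _ hbc ih =>
      by_cases hbc' : b = c
      · exact hbc' ▸ ih
      · exact ih.trans (SimpleGraph.Adj.reachable (G := S) ⟨hbc', hbc⟩)
  obtain ⟨w⟩ := hreach
  have hw := w.toPath.2
  set w' : S.Walk u v := w.toPath.1
  let n := w'.length
  have hadj : ∀ i < n, ∃ e' ≠ e, G.IsLink e' (w'.getVert i) (w'.getVert (i + 1)) :=
    fun i hi ↦ (w'.adj_getVert_succ hi).2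
  have : Nonempty β := ⟨e⟩
  choose! ed hed hlink using hadj
  have hinj : ∀ i ≤ n, ∀ j ≤ n, w'.getVert i = w'.getVert j → i = j := fun i hi j hj h ↦
    hw.getVert_injOn hi hj h
  have hedinj : ∀ i < n, ∀ j < n, ed i = ed j → i = j := fun i hi j hj h ↦ by
    have h1 := hlink i hi
    rw [h] at h1
    rcases h1.eq_and_eq_or_eq_and_eq (hlink j hj) with ⟨h2, -⟩ | ⟨h2, h3⟩
    · exact hinj i hi.le j hj.le h2
    · have := hinj _ hi.le _ hj h2
      have := hinj _ hi _ hj.le h3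
      omega
  -- the path is closed up by the edge `e`; a path of length zero gives a loop
  refine hG ⟨n, fun i ↦ w'.getVert (Fin.val (n := n + 1) i),
    fun i ↦ if Fin.val (n := n + 1) i = n then e else ed (Fin.val (n := n + 1) i),
    fun i j hij ↦ ?_, fun i j hij ↦ ?_, fun i ↦ ?_⟩
  · exact Fin.ext (n := n + 1) (hinj _ (Nat.lt_succ_iff.1 (Fin.is_lt (n := n + 1) i)) _
      (Nat.lt_succ_iff.1 (Fin.is_lt (n := n + 1) j)) hij)
  · have hi := Nat.lt_succ_iff.1 (Fin.is_lt (n := n + 1) i)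
    have hj := Nat.lt_succ_iff.1 (Fin.is_lt (n := n + 1) j)
    refine Fin.ext (n := n + 1) ?_
    dsimp only at hij
    split_ifs at hij with h1 h2 h2
    · rw [h1, h2]
    · exact absurd hij.symm (hed _ (lt_of_le_of_ne hj h2))
    · exact absurd hij (hed _ (lt_of_le_of_ne hi h1))
    · exact hedinj _ (lt_of_le_of_ne hi h1) _ (lt_of_le_of_ne hj h2) hij
  · have hi := Nat.lt_succ_iff.1 (Fin.is_lt (n := n + 1) i)
    have hsucc : Fin.val (n := n + 1) (i + 1 : ZMod (n + 1)) = if Fin.val (n := n + 1) i = n then 0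
        else Fin.val (n := n + 1) i + 1 := by
      have h := Fin.val_add_one (n := n) i
      by_cases hin : Fin.val (n := n + 1) i = n
      · rw [if_pos hin]
        exact h.trans (if_pos (Fin.ext (n := n + 1) hin))
      · rw [if_neg hin]
        exact h.trans (if_neg fun h' ↦ hin (congrArg (Fin.val (n := n + 1)) h'))
    dsimp only
    rw [hsucc]
    split_ifs with h1
    · rw [h1, w'.getVert_zero, show w'.getVert n = v from w'.getVert_length]
      exact he.symm
    · exact hlink _ (lt_of_le_of_ne hi h1)

end Graphs

section Jump

theorem eventually_component_eq (E : Type*) [NormedAddCommGroup E] [NormedSpace ℝ E] {M : Type*}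
    [TopologicalSpace M] [ChartedSpace E M] {Z : Set M} (hZ : IsClosed Z) {x : M} (hx : x ∉ Z) :
    ∀ᶠ y in 𝓝 x, y ∉ Z ∧ connectedComponentIn Zᶜ y = connectedComponentIn Zᶜ x := by
  have : LocallyConnectedSpace M := ChartedSpace.locallyConnectedSpace E M
  filter_upwards [hZ.isOpen_compl.connectedComponentIn.mem_nhds (mem_connectedComponentIn hx)]
    with y hy
  exact ⟨connectedComponentIn_subset _ _ hy, (connectedComponentIn_eq hy).symm⟩

variable {E : Type*} [NormedAddCommGroup E] [NormedSpace ℝ E] [FiniteDimensional ℝ E]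
  {M : Type*} [TopologicalSpace M] [ChartedSpace E M] [IsManifold 𝓘(ℝ, E) ∞ M] {Z : Set M}

namespace TubularNbhd

variable {T : TubularNbhd E Z} (hreg : ∀ p ∈ Z, mvfderiv 𝓘(ℝ, E) T.z p ≠ 0)
include hreg

/-- The edge of the associated graph given by a component of `Z` joins the components of the
complement on its two sides. -/
theorem isLink_associatedGraph {W : ℝ → M → Set M}
    (hW : ∀ σ ≠ 0, ∀ p ∈ Z, ∀ᶠ x in 𝓝 p, 0 < σ * T.z x → connectedComponentIn Zᶜ x = W σ p)
    {p : M} (hp : p ∈ Z) :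
    (associatedGraph Z).IsLink (connectedComponentIn Z p) (W 1 p) (W (-1) p) := by
  refine ⟨⟨p, hp, rfl⟩, Subset.antisymm ?_ ?_⟩
  · rintro _ ⟨⟨x, hx, rfl⟩, q, hqx, hqp⟩
    have hq := connectedComponentIn_subset Z p hqp
    obtain ⟨y, hyx, h1, h2, hyN⟩ := ((mem_closure_iff_frequently.1 hqx).and_eventually
      ((hW 1 one_ne_zero q hq).and ((hW (-1) (by simp) q hq).and
        (T.isOpen.mem_nhds (T.subset hq))))).exists
    have hxy := connectedComponentIn_eq hyx
    have hz : T.z y ≠ 0 := fun h ↦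
      connectedComponentIn_subset _ _ hyx ((T.z_eq_zero_iff hyN).1 h)
    rcases lt_or_gt_of_ne hz with h0 | h0
    · right
      rw [hxy, h2 (by linarith)]
      exact T.side_value_eq hreg (by simp) (hW (-1) (by simp)) hp hqp
    · left
      rw [hxy, h1 (by linarith)]
      exact T.side_value_eq hreg one_ne_zero (hW 1 one_ne_zero) hp hqp
  · have key : ∀ σ ≠ 0, (∃ x ∈ Zᶜ, W σ p = connectedComponentIn Zᶜ x) ∧
        (closure (W σ p) ∩ connectedComponentIn Z p).Nonempty := fun σ hσ ↦ by
      have hf := (T.frequently_side hreg hp hσ).and_eventually (hW σ hσ p hp)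
      obtain ⟨x, hx, hxW⟩ := hf.exists
      refine ⟨⟨x, notMem_of_side hx, (hxW hx).symm⟩, p, ?_, mem_connectedComponentIn hp⟩
      refine mem_closure_iff_frequently.2 (hf.mono fun y hy ↦ ?_)
      rw [← hy.2 hy.1]
      exact mem_connectedComponentIn (notMem_of_side hy.1)
    rintro _ (rfl | rfl)
    · exact key 1 one_ne_zero
    · exact key (-1) (by simp)

/-- If the graph is acyclic, then for every component of `Z` there is a locally constant function
off `Z` that jumps from `-1` to `1` across this component and does not jump across the others: it
is `1` on the part of the graph that can be reached from the positive side without crossing the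
given component. -/
theorem exists_jumpFunction (hZ : IsClosed Z) (hG : GraphIsAcyclic (associatedGraph Z)) {q : M}
    (hq : q ∈ Z) : ∃ c : M → ℝ, (∀ x ∉ Z, ∀ᶠ y in 𝓝 x, c y = c x) ∧
      (∀ p ∈ connectedComponentIn Z q, ∀ᶠ x in 𝓝 p, x ∉ Z → c x = SignType.sign (T.z x)) ∧
      ∀ p ∈ Z, p ∉ connectedComponentIn Z q → ∃ d, ∀ᶠ x in 𝓝 p, x ∉ Z → c x = d := by
  classical
  have hex := fun σ (hσ : σ ≠ 0) p (hp : p ∈ Z) ↦ T.exists_side_component hreg hp hσ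
  choose! W hW using hex
  have hlink := fun p (hp : p ∈ Z) ↦ T.isLink_associatedGraph hreg hW hp
  let χ : Set M → ℝ := fun w ↦ if Relation.ReflTransGen
    (fun a b ↦ ∃ e' ≠ connectedComponentIn Z q, (associatedGraph Z).IsLink e' a b) (W 1 q) w
    then 1 else -1
  have hside : ∀ p ∈ Z, ∀ᶠ x in 𝓝 p, x ∉ Z →
      (0 < T.z x ∧ χ (connectedComponentIn Zᶜ x) = χ (W 1 p)) ∨
      (T.z x < 0 ∧ χ (connectedComponentIn Zᶜ x) = χ (W (-1) p)) := fun p hp ↦ by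
    filter_upwards [hW 1 one_ne_zero p hp, hW (-1) (by simp) p hp,
      T.isOpen.mem_nhds (T.subset hp)] with x h1 h2 hxN hxZ
    rcases lt_or_gt_of_ne fun h ↦ hxZ ((T.z_eq_zero_iff hxN).1 h) with h0 | h0
    · exact Or.inr ⟨h0, by rw [h2 (by linarith)]⟩
    · exact Or.inl ⟨h0, by rw [h1 (by linarith)]⟩
  refine ⟨fun x ↦ χ (connectedComponentIn Zᶜ x), fun x hx ↦ ?_, fun p hp ↦ ?_, fun p hp hpq ↦ ?_⟩
  · filter_upwards [eventually_component_eq E hZ hx] with y hy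
    rw [hy.2]
  · have hpZ := connectedComponentIn_subset Z q hp
    have h1 : χ (W 1 p) = 1 := by
      rw [T.side_value_eq hreg one_ne_zero (hW 1 one_ne_zero) hq hp]
      exact if_pos .refl
    have h2 : χ (W (-1) p) = -1 := by
      rw [T.side_value_eq hreg (by simp) (hW (-1) (by simp)) hq hp]
      exact if_neg (hG.not_reflTransGen (hlink q hq))
    filter_upwards [hside p hpZ] with x hx hxZ
    rcases hx hxZ with ⟨h0, h3⟩ | ⟨h0, h3⟩
    · rw [h3, h1, sign_pos h0]; simp
    · rw [h3, h2, sign_neg h0]; simp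
  · have hne : connectedComponentIn Z p ≠ connectedComponentIn Z q := fun h ↦
      hpq (h ▸ mem_connectedComponentIn hp)
    have h1 : χ (W (-1) p) = χ (W 1 p) := if_congr
      ⟨fun h ↦ h.tail ⟨_, hne, (hlink p hp).symm⟩, fun h ↦ h.tail ⟨_, hne, hlink p hp⟩⟩ rfl rfl
    refine ⟨χ (W 1 p), ?_⟩
    filter_upwards [hside p hp] with x hx hxZ
    rcases hx hxZ with ⟨-, h3⟩ | ⟨-, h3⟩
    · exact h3
    · exact h3.trans h1

end TubularNbhd
end Jump

/-! ### The jump problem -/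

section Jump

variable {E : Type*} [NormedAddCommGroup E] [NormedSpace ℝ E] [FiniteDimensional ℝ E]
  {M : Type*} [TopologicalSpace M] [ChartedSpace E M] [IsManifold 𝓘(ℝ, E) ∞ M] {Z : Set M}

theorem SmoothPeriodic.const_mul {k : ℝ → ℝ} (hk : SmoothPeriodic k) (a : ℝ) :
    SmoothPeriodic fun t ↦ a * k t :=
  ⟨contDiff_const.mul hk.1, fun t ↦ congrArg (a * ·) (hk.2 t)⟩

theorem SmoothPeriodic.sum {ι : Type*} {s : Finset ι} {k : ι → ℝ → ℝ}
    (hk : ∀ i ∈ s, SmoothPeriodic (k i)) : SmoothPeriodic fun t ↦ ∑ i ∈ s, k i t :=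
  ⟨ContDiff.sum fun i hi ↦ (hk i hi).1, fun t ↦ Finset.sum_congr rfl fun i hi ↦ (hk i hi).2 t⟩

theorem smoothPeriodic_zero : SmoothPeriodic fun _ ↦ 0 := ⟨contDiff_const, fun _ ↦ rfl⟩

namespace TubularNbhd

variable (T : TubularNbhd E Z)

/-- The function `C` is a solution of the jump problem with data `k`: it is locally constant off
`Z`, and across `Z` at `p` it jumps from `D p - k p` to `D p + k p`. The functions `C` and `D`
depend smoothly and periodically on time. -/
structure IsJumpSolution (k C D : ℝ → M → ℝ) : Prop where
  smooth : ∀ x, SmoothPeriodic fun t ↦ C t x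
  smooth_center : ∀ p ∈ Z, SmoothPeriodic fun t ↦ D t p
  locallyConst : ∀ x ∉ Z, ∀ᶠ y in 𝓝 x, ∀ t, C t y = C t x
  jump : ∀ p ∈ Z, ∀ᶠ x in 𝓝 p, x ∉ Z → ∀ t, C t x = k t p * SignType.sign (T.z x) + D t p

variable {T} (hreg : ∀ p ∈ Z, mvfderiv 𝓘(ℝ, E) T.z p ≠ 0)
include hreg

/-- On an acyclic graph the jump problem is solved by superposing the solutions for single
edges. -/
theorem exists_isJumpSolution_of_acyclic (hZ : IsCompact Z) (hZc : IsClosed Z)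
    (hG : GraphIsAcyclic (associatedGraph Z)) {k : ℝ → M → ℝ}
    (hk : ∀ p ∈ Z, SmoothPeriodic fun t ↦ k t p)
    (hkc : ∀ p ∈ Z, ∀ q ∈ connectedComponentIn Z p, ∀ t, k t q = k t p) :
    ∃ C D, T.IsJumpSolution k C D := by
  classical
  obtain ⟨b, hbfin, hb⟩ := T.exists_basePoint hreg hZ
  have hex := fun q (hq : q ∈ Z) ↦ T.exists_jumpFunction hreg hZc hG hq
  choose! c hcloc hcjump hcconst using hex
  choose! d hd using hcconst
  set R := hbfin.toFinset with hR
  have hRZ : ∀ q ∈ R, q ∈ Z := fun q hq ↦ by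
    obtain ⟨p, hp, rfl⟩ := hbfin.mem_toFinset.1 hq
    exact (hb p hp).1
  have hpb : ∀ p ∈ Z, p ∈ connectedComponentIn Z (b p) := fun p hp ↦ by
    rw [(hb p hp).2.1]; exact mem_connectedComponentIn hp
  refine ⟨fun t x ↦ ∑ q ∈ R, c q x * k t q,
    fun t p ↦ ∑ q ∈ R, (if p ∈ connectedComponentIn Z q then 0 else d q p) * k t q,
    fun x ↦ .sum fun q hq ↦ (hk q (hRZ q hq)).const_mul _,
    fun p _ ↦ .sum fun q hq ↦ (hk q (hRZ q hq)).const_mul _, fun x hx ↦ ?_, fun p hp ↦ ?_⟩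
  · have h1 : ∀ᶠ y in 𝓝 x, ∀ q ∈ R, c q y = c q x :=
      (Filter.eventually_all_finset R).2 fun q hq ↦ hcloc q (hRZ q hq) x hx
    filter_upwards [h1] with y hy t
    exact Finset.sum_congr rfl fun q hq ↦ by rw [hy q hq]
  · have h1 : ∀ᶠ x in 𝓝 p, ∀ q ∈ R, x ∉ Z → c q x =
        (if p ∈ connectedComponentIn Z q then (SignType.sign (T.z x) : ℝ) else 0) +
          (if p ∈ connectedComponentIn Z q then 0 else d q p) := by
      refine (Filter.eventually_all_finset R).2 fun q hq ↦ ?_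
      by_cases hpq : p ∈ connectedComponentIn Z q
      · filter_upwards [hcjump q (hRZ q hq) p hpq] with x hx hxZ
        rw [if_pos hpq, if_pos hpq, add_zero, hx hxZ]
      · filter_upwards [hd q (hRZ q hq) p hp hpq] with x hx hxZ
        rw [if_neg hpq, if_neg hpq, zero_add, hx hxZ]
    filter_upwards [h1] with x hx hxZ t
    rw [Finset.sum_congr rfl fun q hq ↦ by rw [hx q hq hxZ, add_mul], Finset.sum_add_distrib]
    congr 1
    -- only the component of `Z` through `p` contributes a jump at `p`
    rw [Finset.sum_eq_single_of_mem (b p) (hbfin.mem_toFinset.2 ⟨p, hp, rfl⟩)]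
    · rw [if_pos (hpb p hp), hkc (b p) (hb p hp).1 p (hpb p hp), mul_comm]
    · intro q hq hne
      rw [if_neg, zero_mul]
      intro hpq
      obtain ⟨p', hp', rfl⟩ := hbfin.mem_toFinset.1 hq
      refine hne ((hb p hp).2.2 p' ?_)
      rw [← (hb p' hp').2.1]
      exact connectedComponentIn_eq hpq

/-- In the unimodular case the slopes of all components agree, and the sign of the global defining
function solves the jump problem. -/
theorem exists_isJumpSolution_of_unimodular {m : ℕ} (hm : 1 ≤ m) {H : ℝ → M → ℝ}
    (hU : IsUnimodular T m H) {k G : ℝ → M → ℝ} {V : Set M} (hVo : IsOpen V) (hZV : Z ⊆ V)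
    (hG : SmoothPeriodicOn E V G)
    (hHG : ∀ t, ∀ x ∈ V \ Z, H t x = k t (T.proj x) * pole m (T.z x) + G t x) :
    ∃ C D, T.IsJumpSolution k C D := by
  obtain ⟨f, hf, ⟨r, hr, hfz⟩, κ, U, h, hκ, hUo, hZU, hh, hHh⟩ := hU
  have hm2 : (2 * (m : ℝ) - 1) ≠ 0 := by
    have : (1 : ℝ) ≤ m := by exact_mod_cast hm
    linarith
  have hslope : ∀ p ∈ Z, ∀ t, k t p = -(2 * (m : ℝ) - 1) * κ t := fun p hp t ↦ by
    obtain ⟨η, γ, hη, hγ₀, hγ, hγ'⟩ := T.exists_normalCurve hreg hp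
    have hI : Ioo (-η) η ∈ 𝓝 (0 : ℝ) := Ioo_mem_nhds (by linarith) hη
    have hγc : ContinuousAt γ 0 := hγ.continuousOn.continuousAt hI
    have hnear : ∀ᶠ s in 𝓝 (0 : ℝ), γ s ∈ V ∩ U ∩ T.tube r := by
      refine hγc.eventually (p := fun x ↦ x ∈ V ∩ U ∩ T.tube r) ?_
      rw [hγ₀]
      exact ((hVo.inter hUo).inter (T.isOpen_tube r)).mem_nhds
        ⟨⟨hZV hp, hZU hp⟩, T.subset_tube hr hp⟩
    have hcont : ContinuousAt (fun s ↦ s ^ (2 * m - 1) * (h t (γ s) - G t (γ s))) 0 := by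
      have h1 : ContinuousAt (fun s ↦ h t (γ s)) 0 := ContinuousAt.comp (g := h t) (f := γ)
        (by rw [hγ₀]; exact (hh.contMDiffAt_right hUo t (hZU hp)).continuousAt) hγc
      have h2 : ContinuousAt (fun s ↦ G t (γ s)) 0 := ContinuousAt.comp (g := G t) (f := γ)
        (by rw [hγ₀]; exact (hG.contMDiffAt_right hVo t (hZV hp)).continuousAt) hγc
      exact (continuousAt_id.pow _).mul (h1.sub h2)
    -- the two expressions of `H`, multiplied by `s ^ (2 m - 1)`
    have hconst : ∀ᶠ s in 𝓝[≠] (0 : ℝ), s ^ (2 * m - 1) * (h t (γ s) - G t (γ s)) =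
        -1 / (2 * (m : ℝ) - 1) * k t p - κ t := by
      filter_upwards [hnear.filter_mono nhdsWithin_le_nhds, mem_nhdsWithin_of_mem_nhds hI,
        self_mem_nhdsWithin] with s ⟨⟨hsV, hsU⟩, hsr⟩ hs hs0
      obtain ⟨hγN, hγz, hγp⟩ := hγ' s hs
      have hsZ : γ s ∉ Z := fun hZ ↦ hs0 (hγz.symm.trans (T.z_eq _ hZ))
      have h1 := hHG t _ ⟨hsV, hsZ⟩
      have h2 := hHh t _ ⟨hsU, hsZ⟩
      rw [hfz _ hsr] at h2
      rw [hγz] at h1 h2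
      rw [hγp, h2] at h1
      have hs' : s ^ (2 * m - 1) ≠ 0 := pow_ne_zero _ hs0
      rw [← pow_mul_pole (m := m) hs0, ← sub_eq_zero]
      have h3 : s ^ (2 * m - 1) * (κ t / s ^ (2 * m - 1)) = κ t := mul_div_cancel₀ _ hs'
      linear_combination s ^ (2 * m - 1) * h1 - h3
    have hlim := tendsto_nhds_unique ((hcont.tendsto.mono_left nhdsWithin_le_nhds).congr' hconst)
      tendsto_const_nhds
    rw [zero_pow (by omega), zero_mul] at hlim
    field_simp at hlim
    linarith
  have hf0 : ∀ x, x ∉ Z → f x ≠ 0 := fun x hx h0 ↦ hx ((hf.zero_iff x (mem_univ x)).1 h0)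
  have hfc : Continuous f := continuousOn_univ.1 hf.smooth.continuousOn
  refine ⟨fun t x ↦ (SignType.sign (f x) : ℝ) * (-(2 * (m : ℝ) - 1) * κ t), fun _ _ ↦ 0,
    fun x ↦ (hκ.const_mul _).const_mul _, fun _ _ ↦ smoothPeriodic_zero, fun x hx ↦ ?_,
    fun p hp ↦ ?_⟩
  · have hs : ∀ᶠ y in 𝓝 x, SignType.sign (f y) = SignType.sign (f x) := by
      rcases lt_or_gt_of_ne (hf0 x hx) with h0 | h0
      · filter_upwards [hfc.continuousAt.eventually_lt continuousAt_const h0] with y hy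
        rw [sign_neg hy, sign_neg h0]
      · filter_upwards [continuousAt_const.eventually_lt hfc.continuousAt h0] with y hy
        rw [sign_pos hy, sign_pos h0]
    filter_upwards [hs] with y hy t
    rw [hy]
  · filter_upwards [(T.isOpen_tube r).mem_nhds (T.subset_tube hr hp)] with x hx _ t
    rw [hfz x hx, hslope p hp, add_zero, mul_comm]

/-- The data of a jump problem are constant on the components of `Z`, and so are the mean values of
its solutions. -/
theorem IsJumpSolution.center_eq {k C D : ℝ → M → ℝ} (hC : T.IsJumpSolution k C D)
    (hkc : ∀ p ∈ Z, ∀ q ∈ connectedComponentIn Z p, ∀ t, k t q = k t p) {p q : M} (hp : p ∈ Z)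
    (hq : q ∈ connectedComponentIn Z p) (t : ℝ) : D t q = D t p := by
  have h1 : k t q + D t q = k t p + D t p := by
    refine T.side_value_eq hreg (σ := 1) one_ne_zero (F := C t) (g := fun p ↦ k t p + D t p)
      (fun p hp ↦ ?_) hp hq
    filter_upwards [hC.jump p hp] with x hx hx0
    rw [hx (notMem_of_side hx0) t, sign_pos (by linarith)]
    simp
  rw [hkc p hp q hq t] at h1
  exact add_left_cancel h1

end TubularNbhd
end Jump

/-! ### Gluing -/

section Gluing

variable {E : Type*} [NormedAddCommGroup E] [NormedSpace ℝ E] [FiniteDimensional ℝ E]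
  {M : Type*} [TopologicalSpace M] [ChartedSpace E M] [IsManifold 𝓘(ℝ, E) ∞ M] {Z : Set M}

theorem SmoothPeriodic.contMDiffAt_fst {F : Type*} [NormedAddCommGroup F] [NormedSpace ℝ F]
    {N : Type*} [TopologicalSpace N] [ChartedSpace F N] {k : ℝ → ℝ} (hk : SmoothPeriodic k)
    (q : ℝ × N) :
    ContMDiffAt (𝓘(ℝ, ℝ).prod 𝓘(ℝ, F)) 𝓘(ℝ, ℝ) ∞ (fun p : ℝ × N ↦ k p.1) q :=
  ContMDiffAt.comp (g := k) (f := Prod.fst) q hk.1.contMDiff.contMDiffAt _root_.contMDiffAt_fst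

omit [FiniteDimensional ℝ E] [IsManifold 𝓘(ℝ, E) ∞ M] in
theorem mvfderiv_congr {F F' : M → ℝ} {x : M} (h : F =ᶠ[𝓝 x] F') (w : TangentSpace 𝓘(ℝ, E) x) :
    mvfderiv 𝓘(ℝ, E) F x w = mvfderiv 𝓘(ℝ, E) F' x w :=
  congrArg (fun A : E →L[ℝ] ℝ ↦ A w) (h.mfderiv_eq (I := 𝓘(ℝ, E)) (I' := 𝓘(ℝ, ℝ)))

omit [FiniteDimensional ℝ E] [IsManifold 𝓘(ℝ, E) ∞ M] in
theorem TubularNbhd.mvfderiv_add_comp_z {T : TubularNbhd E Z} {F G : M → ℝ} {g : ℝ → ℝ} {g' : ℝ}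
    {x : M} (hx : x ∈ T.N) (hg : HasDerivAt g g' (T.z x))
    (hG : MDifferentiableAt 𝓘(ℝ, E) 𝓘(ℝ, ℝ) G x) (hF : F =ᶠ[𝓝 x] fun y ↦ g (T.z y) + G y)
    (w : TangentSpace 𝓘(ℝ, E) x) :
    mvfderiv 𝓘(ℝ, E) F x w = g' * mvfderiv 𝓘(ℝ, E) T.z x w + mvfderiv 𝓘(ℝ, E) G x w := by
  have hz : MDifferentiableAt 𝓘(ℝ, E) 𝓘(ℝ, ℝ) (fun y ↦ g (T.z y)) x :=
    MDifferentiableAt.comp (g := g) x hg.differentiableAt.mdifferentiableAt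
      (T.mdifferentiableAt_z hx)
  rw [mvfderiv_congr hF]
  refine (DFunLike.congr_fun (mvfderiv_add hz hG) w).trans ?_
  rw [T.mvfderiv_comp_z hg hx]
  rfl

end Gluing

end BSymplectic

end

theorem mainTheorem6
    {E : Type*} [NormedAddCommGroup E] [NormedSpace ℝ E] [FiniteDimensional ℝ E]
    {M : Type*} [TopologicalSpace M] [ChartedSpace E M] [IsManifold 𝓘(ℝ, E) ∞ M]
    [T2Space M] [CompactSpace M] [ConnectedSpace M]
    {m : ℕ} (hm : 1 ≤ m) {Z : Set M} (T : BSymplectic.TubularNbhd E Z)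
    {Ω : BSymplectic.TwoForm E M}
    (hΩ : BSymplectic.IsBSymplectic (2 * m) Z T.N T.z Ω)
    (L : BSymplectic.LaurentDecomposition T m Ω)
    {H : ℝ → M → ℝ} (hH : BSymplectic.IsAdmissible L H)
    (hglobal : BSymplectic.IsUnimodular T m H ∨
      BSymplectic.GraphIsAcyclic (BSymplectic.associatedGraph Z)) :
    ∃ ε₀ > 0, ∀ ε ∈ Ioo 0 ε₀, ∀ f : ℝ → ℝ, BSymplectic.IsDesingularizingFunction m f →
      BSymplectic.IsSymplecticOn univ (L.desingularization f ε) ∧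
      ∃ H' : ℝ → M → ℝ, BSymplectic.SmoothPeriodicOn E univ H' ∧
        ∃ X : ℝ → ∀ x : M, TangentSpace 𝓘(ℝ, E) x,
          BSymplectic.IsBHamiltonianField Z Ω H X ∧
          BSymplectic.IsHamiltonianFieldOn univ (L.desingularization f ε) H' X := by
  open BSymplectic in
  classical
  have hreg := hΩ.isDefiningFunction.regular
  have hZc := hΩ.isDefiningFunction.isClosed
  have hZ := hZc.isCompact
  obtain ⟨hB, r, hr, hslope, hreeb, -⟩ := hH
  obtain ⟨k, G, V, hVo, hZV, hVr, hk, hkc, hG, hHG⟩ :=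
    T.exists_regularPart_near hreg hm hZ hZc hB hr hslope
  obtain ⟨C, D, hCD⟩ : ∃ C D, T.IsJumpSolution k C D := by
    rcases hglobal with hU | hA
    · exact T.exists_isJumpSolution_of_unimodular hreg hm hU hVo hZV hG
        fun t x hx ↦ (hHG t x hx).1
    · exact T.exists_isJumpSolution_of_acyclic hreg hZ hZc hA hk hkc
  -- a tube on which both the singular part of `H` and the jump of `C` are under control
  obtain ⟨ρ, hρ, hρV⟩ : ∃ ρ > 0, T.tube ρ ⊆ {x | x ∈ V ∧ (x ∉ Z → ∀ t,
      C t x = k t (T.proj x) * SignType.sign (T.z x) + D t (T.proj x))} := by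
    refine T.exists_tube_subset hreg hZ (mem_nhdsSet_iff_forall.2 fun p hp ↦ ?_)
    have hA := T.eventually_mem_around hreg (T.subset hp)
    rw [T.proj_eq p hp] at hA
    filter_upwards [hVo.mem_nhds (hZV hp), hA, hCD.jump p hp] with x hxV hxA hx
    refine ⟨hxV, fun hxZ t ↦ ?_⟩
    rw [hx hxZ, hkc p hp _ hxA.2, hCD.center_eq hreg hkc hp hxA.2]
  obtain ⟨V₁, hV₁o, hZV₁, hV₁ρ⟩ :=
    normal_exists_closure_subset hZc (T.isOpen_tube ρ) (T.subset_tube hρ)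
  obtain ⟨ε₀, hε₀, hε₀V⟩ := T.exists_tube_subset hreg hZ (hV₁o.mem_nhdsSet.2 hZV₁)
  refine ⟨ε₀, hε₀, fun ε hε f hf ↦ ?_⟩
  have hεpos : 0 < ε := hε.1
  have hcl : closure (T.tube ε) ⊆ T.tube ρ := (closure_mono fun x hx ↦
    hε₀V ⟨hx.1, hx.2.trans hε.2⟩).trans hV₁ρ
  have hsymp := L.isSymplecticOn_desingularization hf hm hΩ hεpos fun x hx ↦ (hcl hx).1
  set a := 2 / ε ^ (2 * m - 1) with ha
  let H' : ℝ → M → ℝ := fun t x ↦ if x ∈ T.tube ε then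
    k t (T.proj x) * rescale m f ε (T.z x) + G t x + a * D t (T.proj x) else H t x + a * C t x
  -- the two formulas for `H'` agree on the rest of the tube, because `a * C` jumps across `Z` by
  -- the amount `4 k / ε ^ (2 m - 1)` by which the two ends of `k φ_ε` are mutually shifted
  have hin : ∀ x ∈ T.tube ρ, ∀ t, H' t x =
      k t (T.proj x) * rescale m f ε (T.z x) + G t x + a * D t (T.proj x) := fun x hx t ↦ by
    by_cases hxε : x ∈ T.tube ε
    · exact if_pos hxε
    · have hεz : ε ≤ |T.z x| := not_lt.1 fun h ↦ hxε ⟨hx.1, h⟩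
      have hxZ : x ∉ Z := fun h ↦ hxε (T.subset_tube hεpos h)
      refine (if_neg hxε).trans ?_
      rw [(hHG t x ⟨(hρV hx).1, hxZ⟩).1, (hρV hx).2 hxZ t, hf.rescale_of_le hm hεpos hεz, pole, ha]
      ring
  have hnear : ∀ x ∈ T.tube ρ, ∀ᶠ y in 𝓝 x, ∀ t, H' t y =
      k t (T.proj x) * rescale m f ε (T.z y) + G t y + a * D t (T.proj x) := fun x hx ↦ by
    filter_upwards [(T.isOpen_tube ρ).mem_nhds hx, T.eventually_mem_around hreg hx.1]
      with y hy hyA t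
    rw [hin y hy t, hkc _ (T.proj_mem hx.1) _ hyA.2,
      hCD.center_eq hreg hkc (T.proj_mem hx.1) hyA.2]
  have hfar : ∀ x ∉ T.tube ρ, x ∉ Z ∧ x ∉ T.tube ε ∧
      ∀ᶠ y in 𝓝 x, ∀ t, H' t y = H t y + a * C t x := fun x hx ↦ by
    have hxZ : x ∉ Z := fun h ↦ hx (T.subset_tube hρ h)
    refine ⟨hxZ, fun h ↦ hx (hcl (subset_closure h)), ?_⟩
    filter_upwards [isClosed_closure.isOpen_compl.mem_nhds fun h ↦ hx (hcl h),
      hCD.locallyConst x hxZ] with y hy hyC t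
    rw [← hyC t]
    exact if_neg fun h ↦ hy (subset_closure h)
  have hH'per : ∀ t x, H' (t + 1) x = H' t x := fun t x ↦ by
    by_cases hx : x ∈ T.tube ρ
    · have h1 : k (t + 1) (T.proj x) = k t (T.proj x) := (hk _ (T.proj_mem hx.1)).2 t
      have h2 : D (t + 1) (T.proj x) = D t (T.proj x) :=
        (hCD.smooth_center _ (T.proj_mem hx.1)).2 t
      rw [hin x hx, hin x hx, h1, h2, hG.2 t x (hρV hx).1]
    · obtain ⟨hxZ, -, hev⟩ := hfar x hx
      rw [hev.self_of_nhds, hev.self_of_nhds, hB.1.2 t x hxZ, show C (t + 1) x = C t x from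
        (hCD.smooth x).2 t]
  have hH' : SmoothPeriodicOn E univ H' := by
    refine ⟨fun ⟨t, x⟩ _ ↦ ContMDiffAt.contMDiffWithinAt ?_, fun t x _ ↦ hH'per t x⟩
    by_cases hx : x ∈ T.tube ρ
    · have hz : ContMDiffAt (𝓘(ℝ, ℝ).prod 𝓘(ℝ, E)) 𝓘(ℝ, ℝ) ∞
          (fun q : ℝ × M ↦ rescale m f ε (T.z q.2)) (t, x) :=
        ContMDiffAt.comp (g := fun y ↦ rescale m f ε (T.z y)) (f := Prod.snd) (t, x)
          (((hf.contDiff_rescale ε).contMDiff.contMDiffAt).comp x (T.contMDiffAt_z hx.1))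
          contMDiffAt_snd
      refine ContMDiffAt.congr_of_eventuallyEq
        (((((hk _ (T.proj_mem hx.1)).contMDiffAt_fst (t, x)).mul hz).add
          (hG.contMDiffAt hVo t (hρV hx).1)).add
          (((hCD.smooth_center _ (T.proj_mem hx.1)).const_mul a).contMDiffAt_fst (t, x))) ?_
      filter_upwards [continuousAt_snd.eventually (hnear x hx)] with q hq using hq q.1
    · obtain ⟨hxZ, -, hev⟩ := hfar x hx
      refine ContMDiffAt.congr_of_eventuallyEq
        ((hB.1.contMDiffAt hZc.isOpen_compl t hxZ).add
          (((hCD.smooth x).const_mul a).contMDiffAt_fst (t, x))) ?_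
      filter_upwards [continuousAt_snd.eventually hev] with q hq using hq q.1
  obtain ⟨X, hXs, hX⟩ := exists_smooth_hamiltonianField hsymp hH'
  refine ⟨hsymp, H', hH', X, ⟨hXs, fun t x hxZ v ↦ ?_⟩, hX⟩
  by_cases hx : x ∈ T.tube ρ
  · have hxV := (hρV hx).1
    have hGd := (hG.contMDiffAt_right hVo t hxV).mdifferentiableAt (by simp)
    have hz0 : T.z x ≠ 0 := fun h ↦ hxZ ((T.z_eq_zero_iff hx.1).1 h)
    have hdH : ∀ w, mvfderiv 𝓘(ℝ, E) (H t) x w = k t (T.proj x) * (T.z x ^ (2 * m))⁻¹ *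
        mvfderiv 𝓘(ℝ, E) T.z x w + mvfderiv 𝓘(ℝ, E) (G t) x w := by
      refine T.mvfderiv_add_comp_z hx.1 ((hasDerivAt_pole hm hz0).const_mul _) hGd ?_
      filter_upwards [(hVo.inter hZc.isOpen_compl).mem_nhds ⟨hxV, hxZ⟩,
        T.eventually_mem_around hreg hx.1] with y hy hyA
      rw [(hHG t y hy).1, hkc _ (T.proj_mem hx.1) _ hyA.2]
    have hdH' : ∀ w, mvfderiv 𝓘(ℝ, E) (H' t) x w = k t (T.proj x) *
        deriv (rescale m f ε) (T.z x) * mvfderiv 𝓘(ℝ, E) T.z x w +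
          mvfderiv 𝓘(ℝ, E) (G t) x w := by
      refine T.mvfderiv_add_comp_z (g := fun s ↦ k t (T.proj x) * rescale m f ε s +
        a * D t (T.proj x)) hx.1 (((((hf.contDiff_rescale ε).differentiable (by simp)
          _).hasDerivAt).const_mul _).add_const _) hGd ?_
      filter_upwards [hnear x hx] with y hy
      rw [hy t]
      ring
    refine L.hamiltonian_of_desingularized hm hΩ ⟨hx.1, hxZ⟩
      (hf.deriv_rescale_pos hm hεpos (T.z x)).ne' (hHG t x ⟨hxV, hxZ⟩).2
      (hreeb t x ⟨hVr hxV, hxZ⟩) (fun w ↦ ?_) v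
    have h1 := hX t x (mem_univ x) w
    rw [L.desingularization_eq_of_mem hf hm hεpos hx.1, hdH'] at h1
    rw [h1, hdH]
    ring
  · obtain ⟨-, hxε, hev⟩ := hfar x hx
    have h1 := hX t x (mem_univ x) v
    rw [L.desingularization_eq_of_notMem hxε] at h1
    have h2 : mvfderiv 𝓘(ℝ, E) (H' t) x v = mvfderiv 𝓘(ℝ, E) (H t) x v := by
      rw [mvfderiv_congr (F' := H t + fun _ ↦ a * C t x) (hev.mono fun y hy ↦ hy t)]
      have hHd := (hB.1.contMDiffAt_right hZc.isOpen_compl t hxZ).mdifferentiableAt (by simp)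
      refine (DFunLike.congr_fun (mvfderiv_add hHd mdifferentiableAt_const) v).trans ?_
      rw [mvfderiv_const]
      exact add_zero _
    rw [h1, h2]
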